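/- **Setting.** Let $\mathcal A\subset\mathbb R^2$ be a (filled, closed) regular polygon with $N_0\ge 3$ sides of length $1$, with vertices $q_1,\dots,q_{N_0}$ in counter-clockwise order ($q_{N_0+1}=q_1$), sides $L_i=\overline{q_i,q_{i+1}}$, $\partial\mathcal A=\bigcup_i L_i$, $\mathcal A^o=\mathcal A\setminus\partial\mathcal A$, and dihedral symmetry group $\mathscr G$. Let $\Psi_i(x)=\pm\rho_i x+c_i$ ($0<\rho_i<1$, $i\in S$, $N_0\le \#S<\infty$) satisfy $\Psi_i\mathcal A\subset\mathcal A$, and let $K$ be the unique non-empty compact set with $K=\bigcup_{i\in S}\Psi_iK$. Call $K$ a *bordered polygon carpet* if - $\Psi_i(\mathcal A^o)\cap\Psi_j(\mathcal A^o)=\emptyset$ for $i\ne j$; - $K$ is connected; - $\bigcup_i\Psi_i\mathcal A$ is invariant under every $\Gamma\in\mathscr G$, and moreover $\Gamma$ permutes the first-level cells: for all $\Gamma\in\mathscr G$, $i\in S$ there is $j\in S$ with $\Gamma(\Psi_i\mathcal A)=\Psi_j\mathcal A$; - $\bigcup_i\Psi_i\mathcal A\neq\mathcal A$; - $\partial\mathcal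 A\subset\bigcup_i\Psi_i\mathcal A$. Let $S_1=\{1,\tfrac32,2,\dots,N_0,N_0+\tfrac12\}$, $d_{S_1}(i,j)=\min\{|i-j|,N_0-|i-j|\}$, let $q_{i+1/2}$ be the midpoint of $L_i$ for integers $1\le i\le N_0$, and let $L'_i=\overline{q_i,q_{i+1/2}}$, $i\in S_1$, be the half-sides (with $q_{N_0+1}=q_1$). Let $\Psi_1$ be the map of the system whose image $\Psi_1\mathcal A$ contains $q_1$, that is, the one that fixes the vertex $q_1$ (for a square it may be written with the sign $-$ and then sends the opposite vertex to $q_1$; this does not change the image of a $\mathscr G$-invariant set). **(LI)** $A\cap\Psi_1A\ne\emptyset$ for every closed, path connected, $\mathscr G$-invariant $A\subset K$ with $A\cap L'_i\neq\emptyset$ for all $i\in S_1$. For a finite word $w=w_1\cdots w_n$ over $S$ let $\Psi_w=\Psi_{w_1}\circ\cdots\circ\Psi_{w_n}$, $\rho_w=\rho_{w_1}\cdots\rho_{w_n}$ and $w^-=w_1\cdots w_{n-1}$ (for the empty word, $\Psi_\emptyset=\mathrm{id}$, $\rho_\emptyset=1$). Let $\rho_*=\min_i\rho_i$, $\Lambda_0=\{\emptyset\}$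 and $\Lambda_n=\{w:\rho_w\le\rho_*^n<\rho_{w^-}\}$ for $n\ge1$. Words $w\neq v$ are neighbours, $w\sim v$, if $\Psi_wK\cap\Psi_vK\ne\emptyset$. For a finite set $A$ of words and $f:A\to\mathbb R$ let $\mathcal D_A(f)=\sum_{\{w,v\}\subset A,\,w\sim v}(f(w)-f(v))^2$ and $[f]_A=\big(\sum_{w\in A}\rho_w^{d_H}\big)^{-1}\sum_{w\in A}\rho_w^{d_H}f(w)$, where $d_H$ is the dimension of $K$, the solution of $\sum_i\rho_i^{d_H}=1$. For $w\in\Lambda_n$ let $\mathcal B_m(w)=\{v\in\Lambda_{n+m}:\Psi_vK\subset\Psi_wK\}$. Put $$\sigma_m=\sup\Big\{\big([f]_{\mathcal B_m(w)}-[f]_{\mathcal B_m(w')}\big)^2:\ n\ge1,\ w,w'\in\Lambda_n,\ w\sim w',\ f:\mathcal B_m(w)\cup\mathcal B_m(w')\to\mathbb R,\ \mathcal D_{\mathcal B_m(w)\cup\mathcal B_m(w')}(f)=1\Big\},$$ and, for $w\ne v\in\Lambda_m$, $$R_m(w,v)=\Big(\inf\{\mathcal D_{\Lambda_m}(f): f:\Lambda_m\to\mathbb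 R,\ f(w)=1,\ f(v)=0\}\Big)^{-1},\qquad R_m(w,w)=0.$$ For an integer $1\le i\le N_0$ let $\partial_i\Lambda_m=\{v\in\Lambda_m:\Psi_vK\cap L_i\ne\emptyset\}$, $$\partial'_i\Lambda_m=\{v\in\partial_i\Lambda_m:\mathrm{dist}(\Psi_vK,q_i)\le\mathrm{dist}(\Psi_vK,q_{i+1})\},\qquad \partial'_{i+1/2}\Lambda_m=\{v\in\partial_i\Lambda_m:\mathrm{dist}(\Psi_vK,q_i)\ge\mathrm{dist}(\Psi_vK,q_{i+1})\}.$$ **Theorem.** Let $K$ be a bordered polygon carpet that satisfies (LI). Then there are $C>0$ and $m_0\ge1$ such that $$R_m(w,v)\ \ge\ C\,\sigma_m$$ for all $m\ge m_0$, all $i\in S_1$ with $d_{S_1}(1,i)\ge1$, all $w\in\partial'_1\Lambda_m$ and all $v\in\partial'_i\Lambda_m$. -/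

import Mathlib

open scoped ENNReal

noncomputable section

namespace PolygonCarpet

/-! ## The regular polygon, its sides, half-sides and symmetries -/

/-- The `k`-th vertex of the regular `N`-gon with centre `z` and one vertex at `z + u`,
numbered counter-clockwise and cyclically in `k`. -/
def vertex (N : ℕ) (z u : ℂ) (k : ℕ) : ℂ :=
  z + u * Complex.exp (2 * Real.pi * Complex.I * k / N)

/-- A regular polygon in the plane, with `N ≥ 3` sides of length `1`, in arbitrary position. -/
structure UnitPolygon where
  N : ℕ
  three_le : 3 ≤ N
  ctr : ℂ
  arm : ℂ
  side_length : dist (vertex N ctr arm 1) (vertex N ctr arm 2) = 1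

namespace UnitPolygon

variable (P : UnitPolygon)

/-- The vertices `q₁, …, q_N`; the index is cyclic, so `q_{N+1} = q₁`. -/
def q (k : ℕ) : ℂ := vertex P.N P.ctr P.arm k

/-- The filled closed polygon `𝒜`. -/
def body : Set ℂ := convexHull ℝ (P.q '' Set.Icc 1 P.N)

/-- The side `L_k` from `q_k` to `q_{k+1}`. -/
def side (k : ℕ) : Set ℂ := segment ℝ (P.q k) (P.q (k + 1))

/-- The boundary `∂𝒜`, the union of the sides. -/
def bdry : Set ℂ := ⋃ k ∈ Set.Icc 1 P.N, P.side k

/-- The interior `𝒜° = 𝒜 \ ∂𝒜`. -/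
def inside : Set ℂ := P.body \ P.bdry

/-- The index set `S₁ = {1, 3/2, 2, …, N, N + 1/2}` of the half-sides. -/
def halfIndex : Set ℚ := {i | ∃ k : ℕ, 1 ≤ k ∧ k ≤ P.N ∧ (i = k ∨ i = k + 1 / 2)}

/-- The cyclic distance on `S₁`. -/
def halfDist (i j : ℚ) : ℚ := min |i - j| (P.N - |i - j|)

/-- The half-sides: for an integer `k`, the half `L'_k` of `L_k` is the one that contains `q_k`,
and `L'_{k+1/2}` is the one that contains `q_{k+1}`. -/
def halfSide (i : ℚ) : Set ℂ :=
  if i = (⌊i⌋₊ : ℚ) then segment ℝ (P.q ⌊i⌋₊) (midpoint ℝ (P.q ⌊i⌋₊) (P.q (⌊i⌋₊ + 1)))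
  else segment ℝ (midpoint ℝ (P.q ⌊i⌋₊) (P.q (⌊i⌋₊ + 1))) (P.q (⌊i⌋₊ + 1))

/-- The dihedral symmetry group `𝒢` of the polygon, as a set of isometries of the plane: the
rotations `q_j ↦ q_{j+k}` and the axial symmetries `q_j ↦ q_{k-j}` (indices modulo `N`; the axial
symmetry that exchanges `q_i` and `q_l` is the one with `k = i + l`). -/
def symmetries : Set (ℂ ≃ᵢ ℂ) :=
  {g | (∃ k : ℕ, ∀ j, g (P.q j) = P.q (j + k)) ∨
    ∃ k : ℕ, ∀ j l : ℕ, j + l ≡ k [MOD P.N] → g (P.q j) = P.q l}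

end UnitPolygon

/-! ## Iterated function systems and the attractor -/

/-- A polygon `𝒜` together with a finite system of contracting similarities
`Ψ_i(x) = ± ρ_i x + c_i`, `i ∈ S`, that map `𝒜` into itself, with at least as many maps as `𝒜` has
vertices. -/
structure PolygonIFS (S : Type*) [Fintype S] where
  poly : UnitPolygon
  ρ : S → ℝ
  sgn : S → ℤˣ
  shift : S → ℂ
  ρ_pos : ∀ i, 0 < ρ i
  ρ_lt_one : ∀ i, ρ i < 1
  card_le : poly.N ≤ Fintype.card S
  maps_body : ∀ i, ∀ z ∈ poly.body, ((sgn i : ℤ) : ℂ) * (ρ i : ℂ) * z + shift i ∈ poly.body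

namespace PolygonIFS

variable {S : Type*} [Fintype S] (F : PolygonIFS S)

/-- The similarity `Ψ_i`. -/
def Ψ (i : S) (z : ℂ) : ℂ := ((F.sgn i : ℤ) : ℂ) * (F.ρ i : ℂ) * z + F.shift i

theorem nonempty_index (F : PolygonIFS S) : Nonempty S :=
  Fintype.card_pos_iff.1 (lt_of_lt_of_le (by have := F.poly.three_le; omega) F.card_le)

theorem dist_Ψ (i : S) (x y : ℂ) : dist (F.Ψ i x) (F.Ψ i y) = F.ρ i * dist x y := by
  have h : F.Ψ i x - F.Ψ i y = ((F.sgn i : ℤ) : ℂ) * (F.ρ i : ℂ) * (x - y) := by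
    unfold Ψ; ring
  rw [dist_eq_norm, dist_eq_norm, h, norm_mul, norm_mul, Complex.norm_real, Real.norm_eq_abs,
    abs_of_pos (F.ρ_pos i)]
  rcases Int.units_eq_one_or (F.sgn i) with h | h <;> simp [h]

theorem continuous_Ψ (i : S) : Continuous (F.Ψ i) := by
  unfold Ψ; fun_prop

theorem injective_Ψ (i : S) : Function.Injective (F.Ψ i) := by
  intro x y h
  have h1 := F.dist_Ψ i x y
  rw [h, dist_self] at h1
  rcases mul_eq_zero.1 h1.symm with h2 | h2
  · exact absurd h2 (F.ρ_pos i).ne'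
  · exact dist_eq_zero.1 h2

theorem exists_ratio_bound : ∃ r : ℝ, 0 < r ∧ r < 1 ∧ ∀ i, F.ρ i ≤ r := by
  have := F.nonempty_index
  obtain ⟨i, hi⟩ := Finite.exists_max F.ρ
  exact ⟨F.ρ i, F.ρ_pos i, F.ρ_lt_one i, hi⟩

/-- There is exactly one non-empty compact set `K` with `K = ⋃ i, Ψ_i K`. -/
theorem existsUnique_attractor :
    ∃! K : Set ℂ, IsCompact K ∧ K.Nonempty ∧ K = ⋃ i, F.Ψ i '' K := by
  have := F.nonempty_index
  let Φ : Set ℂ → Set ℂ := fun X => ⋃ i, F.Ψ i '' X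
  have hmono : Monotone Φ := fun X Y h => Set.iUnion_mono fun i => Set.image_mono h
  let A : ℕ → Set ℂ := fun n => Φ^[n] F.poly.body
  have hsucc : ∀ n, A (n + 1) = Φ (A n) := fun n => Function.iterate_succ_apply' Φ n _
  have hstep : ∀ n, A (n + 1) ⊆ A n := by
    intro n
    induction n with
    | zero =>
      rw [hsucc]
      rintro x hx
      obtain ⟨i, z, hz, rfl⟩ := Set.mem_iUnion.1 hx
      exact F.maps_body i z hz
    | succ n ih =>
      rw [hsucc (n + 1)]
      refine (hmono ih).trans ?_
      rw [hsucc n]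
  have hanti : Antitone A := antitone_nat_of_succ_le hstep
  have hcpt : ∀ n, IsCompact (A n) := by
    intro n
    induction n with
    | zero =>
      exact ((Set.finite_Icc 1 F.poly.N).image _).isCompact_convexHull ℝ
    | succ n ih =>
      rw [hsucc]
      exact isCompact_iUnion fun i => ih.image (F.continuous_Ψ i)
  have hne : ∀ n, (A n).Nonempty := by
    intro n
    induction n with
    | zero =>
      have h3 := F.poly.three_le
      exact ⟨_, subset_convexHull ℝ _ (Set.mem_image_of_mem _
        (show (1 : ℕ) ∈ Set.Icc 1 F.poly.N from ⟨le_refl _, by omega⟩))⟩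
    | succ n ih =>
      rw [hsucc]
      obtain ⟨i⟩ := F.nonempty_index
      obtain ⟨x, hx⟩ := ih
      exact ⟨F.Ψ i x, Set.mem_iUnion.2 ⟨i, x, hx, rfl⟩⟩
  have hex : IsCompact (⋂ n, A n) ∧ (⋂ n, A n).Nonempty ∧ (⋂ n, A n) = Φ (⋂ n, A n) := by
    refine ⟨?_, ?_, ?_⟩
    · exact (hcpt 0).of_isClosed_subset (isClosed_iInter fun n => (hcpt n).isClosed)
        (Set.iInter_subset _ 0)
    · exact IsCompact.nonempty_iInter_of_sequence_nonempty_isCompact_isClosed A hstep hne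
        (hcpt 0) fun n => (hcpt n).isClosed
    · have h1 : Φ (⋂ n, A n) = ⋃ i, ⋂ n, F.Ψ i '' A n :=
        Set.iUnion_congr fun i => ((F.injective_Ψ i).injOn).image_iInter_eq
      have h2 : (⋂ n, ⋃ i, F.Ψ i '' A n) = ⋃ i, ⋂ n, F.Ψ i '' A n :=
        Set.iInter_iUnion_of_antitone fun i a b h => Set.image_mono (hanti h)
      rw [h1, ← h2]
      apply Set.Subset.antisymm
      · exact Set.subset_iInter fun n => (Set.iInter_subset A (n + 1)).trans (hsucc n).subset
      · exact Set.subset_iInter fun n =>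
          ((Set.iInter_subset _ n).trans (hsucc n).symm.subset).trans (hstep n)
  refine ⟨⋂ n, A n, hex, ?_⟩
  obtain ⟨r, hr0, hr1, hr⟩ := F.exists_ratio_bound
  have key : ∀ X Y : Set ℂ, IsCompact X → X = Φ X → IsCompact Y → Y.Nonempty → Y = Φ Y →
      X ⊆ Y := by
    intro X Y hX hXf hY hYn hYf
    obtain ⟨D, hD⟩ := (Metric.isBounded_iff (s := X ∪ Y)).1 (hX.union hY).isBounded
    have hap : ∀ n : ℕ, ∀ x ∈ X, ∃ y ∈ Y, dist x y ≤ r ^ n * D := by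
      intro n
      induction n with
      | zero =>
        intro x hx
        obtain ⟨y, hy⟩ := hYn
        exact ⟨y, hy, by simpa using hD (Or.inl hx) (Or.inr hy)⟩
      | succ n ih =>
        intro x hx
        rw [hXf] at hx
        obtain ⟨i, x', hx', rfl⟩ := Set.mem_iUnion.1 hx
        obtain ⟨y', hy', hd⟩ := ih x' hx'
        refine ⟨F.Ψ i y', ?_, ?_⟩
        · rw [hYf]
          exact Set.mem_iUnion.2 ⟨i, y', hy', rfl⟩
        · rw [F.dist_Ψ, pow_succ', mul_assoc]
          exact mul_le_mul (hr i) hd dist_nonneg hr0.le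
    intro x hx
    have hcl : x ∈ closure Y := by
      refine Metric.mem_closure_iff.2 fun ε hε => ?_
      have ht : Filter.Tendsto (fun n : ℕ => r ^ n * D) Filter.atTop (nhds 0) := by
        simpa using (tendsto_pow_atTop_nhds_zero_of_lt_one hr0.le hr1).mul_const D
      obtain ⟨n, hn⟩ := (ht.eventually (gt_mem_nhds hε)).exists
      obtain ⟨y, hy, hd⟩ := hap n x hx
      exact ⟨y, hy, lt_of_le_of_lt hd hn⟩
    exact hY.isClosed.closure_eq ▸ hcl
  rintro Y ⟨hY, hYn, hYf⟩
  exact Set.Subset.antisymm (key _ _ hY hYf hex.1 hex.2.1 hex.2.2)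
    (key _ _ hex.1 hex.2.2 hY hYn hYf)

/-- The attractor: the unique non-empty compact `K` with `K = ⋃ i, Ψ_i K`. -/
def K : Set ℂ := F.existsUnique_attractor.choose

theorem K_spec : IsCompact F.K ∧ F.K.Nonempty ∧ F.K = ⋃ i, F.Ψ i '' F.K :=
  F.existsUnique_attractor.choose_spec.1

theorem exists_dimension : ∃! d : ℝ, ∑ i, F.ρ i ^ d = 1 := by
  have := F.nonempty_index
  have hanti : StrictAnti fun d : ℝ => ∑ i, F.ρ i ^ d := fun a b h =>
    Finset.sum_lt_sum_of_nonempty Finset.univ_nonempty fun i _ =>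
      Real.rpow_lt_rpow_of_exponent_gt (F.ρ_pos i) (F.ρ_lt_one i) h
  have hcont : Continuous fun d : ℝ => ∑ i, F.ρ i ^ d :=
    continuous_finsetSum _ fun i _ => Real.continuous_const_rpow (F.ρ_pos i).ne'
  have hlim : Filter.Tendsto (fun d : ℝ => ∑ i, F.ρ i ^ d) Filter.atTop (nhds 0) := by
    have := tendsto_finsetSum (Finset.univ : Finset S) fun i _ =>
      tendsto_rpow_atTop_of_base_lt_one (F.ρ i) (by linarith [F.ρ_pos i]) (F.ρ_lt_one i)
    simpa using this
  obtain ⟨b, hb, hb0⟩ := ((hlim.eventually (gt_mem_nhds (zero_lt_one' ℝ))).and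
    (Filter.eventually_ge_atTop 0)).exists
  have h0 : (1 : ℝ) ≤ ∑ i, F.ρ i ^ (0 : ℝ) := by
    have h1 : 1 ≤ Fintype.card S := Fintype.card_pos
    simpa using h1
  obtain ⟨d, -, hd⟩ := intermediate_value_Icc' hb0 hcont.continuousOn ⟨hb.le, h0⟩
  exact ⟨d, hd, fun e he => hanti.injective (he.trans hd.symm)⟩

/-- The dimension `d_H` of the attractor: the unique real `d` with `∑ i, ρ_i ^ d = 1`, which under
the open set condition is the Hausdorff dimension of `K`. -/
def dH : ℝ := F.exists_dimension.choose

theorem dH_spec : ∑ i, F.ρ i ^ F.dH = 1 := F.exists_dimension.choose_spec.1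

/-! ## Words, cells and the partitions `Λ_n` -/

/-- `Ψ_w = Ψ_{w₁} ∘ ⋯ ∘ Ψ_{wₙ}`. -/
def Ψw : List S → ℂ → ℂ
  | [] => id
  | i :: w => F.Ψ i ∘ Ψw w

/-- `ρ_w = ρ_{w₁} ⋯ ρ_{wₙ}`. -/
def ρw (w : List S) : ℝ := (w.map F.ρ).prod

/-- The cell `Ψ_w K`. -/
def cell (w : List S) : Set ℂ := F.Ψw w '' F.K

/-- `ρ_* = min_i ρ_i`. -/
def ρmin : ℝ := ⨅ i, F.ρ i

/-- The words with `ρ_w ≤ ρ_*^n < ρ_{σ(w)}`, where `σ(w)` drops the last letter of `w`; and just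
the empty word for `n = 0`. -/
def wordSet (n : ℕ) : Set (List S) :=
  if n = 0 then {[]} else {w | F.ρw w ≤ F.ρmin ^ n ∧ F.ρmin ^ n < F.ρw w.dropLast}

theorem finite_wordSet (n : ℕ) : (F.wordSet n).Finite := by
  unfold wordSet
  split_ifs with hn
  · exact Set.finite_singleton _
  · have := F.nonempty_index
    obtain ⟨r, hr0, hr1, hr⟩ := F.exists_ratio_bound
    have hpos : 0 < F.ρmin := by
      obtain ⟨i, hi⟩ := exists_eq_ciInf_of_finite (f := F.ρ)
      have h : F.ρmin = F.ρ i := hi.symm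
      rw [h]; exact F.ρ_pos i
    have hw : ∀ w : List S, F.ρw w ≤ r ^ w.length := by
      intro w
      induction w with
      | nil => simp [ρw]
      | cons i w ih =>
        have h1 : F.ρw (i :: w) = F.ρ i * F.ρw w := by simp [ρw]
        rw [h1, List.length_cons, pow_succ']
        have h2 : 0 ≤ F.ρw w :=
          List.prod_nonneg (by simp only [List.mem_map]; rintro _ ⟨j, -, rfl⟩; exact (F.ρ_pos j).le)
        exact mul_le_mul (hr i) ih h2 hr0.le
    obtain ⟨M, hM⟩ := exists_pow_lt_of_lt_one (pow_pos hpos n) hr1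
    refine (List.finite_length_lt S (M + 2)).subset ?_
    rintro w ⟨-, h⟩
    by_contra hlen
    have hlen' : M ≤ w.dropLast.length := by
      simp only [Set.mem_ofPred_eq, not_lt] at hlen
      rw [List.length_dropLast]; omega
    have := (hw w.dropLast).trans (pow_le_pow_of_le_one hr0.le hr1.le hlen')
    linarith

/-- The finite partition `Λ_n`, the index set of the cells of level `n`. -/
def Λ (n : ℕ) : Finset (List S) := (F.finite_wordSet n).toFinset

open scoped Classical in
/-- For `w ∈ Λ_n`, the set `ℬ_m(w)` of the words of the `(n+m)`-cells contained in `Ψ_w K`. -/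
def B (n m : ℕ) (w : List S) : Finset (List S) :=
  (F.Λ (n + m)).filter fun v => F.cell v ⊆ F.cell w

/-- Two different words are neighbours if their cells intersect. -/
def Adj (w v : List S) : Prop := w ≠ v ∧ (F.cell w ∩ F.cell v).Nonempty

/-! ## Energy, resistance and the constants `σ_m` -/

open scoped Classical in
/-- The energy `∑ (f w - f v)²` over the edges `{w, v}` of the graph on the set `A`, every edge
being counted once. Only the values of `f` on `A` matter. -/
def energy (A : Finset (List S)) (f : List S → ℝ) : ℝ :=
  (1 / 2) * ∑ w ∈ A, ∑ v ∈ A, if F.Adj w v then (f w - f v) ^ 2 else 0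

/-- The weighted average of `f` on `A`, with weights `ρ_w ^ d_H`. -/
def avg (A : Finset (List S)) (f : List S → ℝ) : ℝ :=
  (∑ w ∈ A, F.ρw w ^ F.dH)⁻¹ * ∑ w ∈ A, F.ρw w ^ F.dH * f w

open scoped Classical in
/-- The resistance between two sets of `m`-cells: the inverse of the least energy of a function on
`Λ_m` that is `1` on `A` and `0` on `B`; it is `0` if `A` and `B` intersect. -/
def R (m : ℕ) (A B : Set (List S)) : ℝ≥0∞ :=
  if (A ∩ B).Nonempty then 0
  else (⨅ (f : List S → ℝ) (_ : (∀ w ∈ A, f w = 1) ∧ ∀ w ∈ B, f w = 0),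
    ENNReal.ofReal (F.energy (F.Λ m) f))⁻¹

open scoped Classical in
/-- `σ_m(w, w')` for `w, w' ∈ Λ_n`: the supremum of the squared difference of the averages of `f`
on `ℬ_m(w)` and `ℬ_m(w')` over all `f` of energy `1` on `ℬ_m(w) ∪ ℬ_m(w')`. -/
def sigmaPair (n m : ℕ) (w w' : List S) : ℝ≥0∞ :=
  ⨆ (f : List S → ℝ) (_ : F.energy (F.B n m w ∪ F.B n m w') f = 1),
    ENNReal.ofReal ((F.avg (F.B n m w) f - F.avg (F.B n m w') f) ^ 2)

/-- `σ_m`: the supremum of `σ_m(w, w')` over all levels `n ≥ 1` and all neighbours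
`w, w' ∈ Λ_n`. -/
def sigma (m : ℕ) : ℝ≥0∞ :=
  ⨆ (n : ℕ) (_ : 1 ≤ n) (w ∈ F.Λ n) (w' ∈ F.Λ n) (_ : F.Adj w w'), F.sigmaPair n m w w'

/-! ## Boundary cells -/

/-- The words in `Λ_m` whose cell meets the side `L_k`. -/
def sideCells (k m : ℕ) : Set (List S) :=
  {v | v ∈ F.Λ m ∧ (F.cell v ∩ F.poly.side k).Nonempty}

/-- The half-side boundary cells `∂'_i Λ_m`: for an integer `k`, the index `k` selects the cells
along `L_k` that are at least as close to `q_k` as to `q_{k+1}`, and `k + 1/2` those that are at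
least as close to `q_{k+1}` as to `q_k`. -/
def halfSideCells (i : ℚ) (m : ℕ) : Set (List S) :=
  if i = (⌊i⌋₊ : ℚ) then
    {v | v ∈ F.sideCells ⌊i⌋₊ m ∧
      Metric.infDist (F.poly.q ⌊i⌋₊) (F.cell v) ≤ Metric.infDist (F.poly.q (⌊i⌋₊ + 1)) (F.cell v)}
  else
    {v | v ∈ F.sideCells ⌊i⌋₊ m ∧
      Metric.infDist (F.poly.q (⌊i⌋₊ + 1)) (F.cell v) ≤ Metric.infDist (F.poly.q ⌊i⌋₊) (F.cell v)}

/-! ## Bordered polygon carpets and the loop intersection condition -/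

/-- The attractor of `F` is a bordered polygon carpet. -/
structure IsBorderedCarpet : Prop where
  /-- the open set condition -/
  open_set : ∀ i j, i ≠ j → Disjoint (F.Ψ i '' F.poly.inside) (F.Ψ j '' F.poly.inside)
  /-- connectivity -/
  connected : IsConnected F.K
  /-- the union of the cells of the first level is invariant under `𝒢` -/
  symm : ∀ g ∈ F.poly.symmetries,
    g '' (⋃ i, F.Ψ i '' F.poly.body) = ⋃ i, F.Ψ i '' F.poly.body
  /-- the elements of `𝒢` act on the words: they permute the cells of the first level (for distinct
  ratios this does not follow from the invariance of the union) -/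
  symm_cells : ∀ g ∈ F.poly.symmetries, ∀ i, ∃ j,
    g '' (F.Ψ i '' F.poly.body) = F.Ψ j '' F.poly.body
  /-- non-triviality -/
  nontrivial : (⋃ i, F.Ψ i '' F.poly.body) ≠ F.poly.body
  /-- the boundary is included -/
  bordered : F.poly.bdry ⊆ ⋃ i, F.Ψ i '' F.poly.body

/-- The loop intersection condition (LI). The index `i` below plays the role of the map `Ψ₁` of the
corner cell at `q₁`, which is the map of the system that fixes `q₁`. (A map of a square onto its
corner cell at `q₁` may also be written with the sign `-`; then it sends the opposite vertex to
`q₁`, but the image of a `𝒢`-symmetric set is the same as under the map that fixes `q₁`.) -/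
def LoopIntersection : Prop :=
  ∀ i, F.poly.q 1 ∈ F.Ψ i '' F.poly.body →
    ∀ A : Set ℂ, A ⊆ F.K → IsClosed A → IsPathConnected A →
      (∀ g ∈ F.poly.symmetries, g '' A = A) →
      (∀ h ∈ F.poly.halfIndex, (A ∩ F.poly.halfSide h).Nonempty) →
      (A ∩ F.Ψ i '' A).Nonempty

end PolygonIFS

end PolygonCarpet

end

/-!
The theorem compares averages over cells (`σ_m`) with a resistance between two cells near different
half-sides. Both are compared with a third quantity: `maxRes s`, the largest effective resistance
between two cells of the partition `cut s` of `K` into cells of size about `s`. The partitions are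
needed at all scales `s > 0`, not only at the powers of `ρ_*` that define `Λ_m`, because the cells
inside a given cell `Ψ_w K` form, after rescaling, a partition at scale `s / ρ_w`. Write `M` for
`maxRes (ρ_* ^ m)`.

*Growth of the maximal resistance* (`exists_maxRes_le`). The first-level cells do not fill the
polygon, so `∑ ρ_i ^ 2 < 1` (`areaRatio_lt_one`), and the cells of size `s` number `o(s ^ (-2))`
(`card_cut_le`). A function on coarse cells extends to the fine cells by smoothing with steps of the
order of the ratio of the scales (`smooth`), and its energy decreases by a power of `areaRatio`. Thus
`maxRes` grows geometrically when the scale is refined; equivalently, a function of energy `1`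
oscillates within a small cell by a small fraction of `√M` only.

*Upper bound for the averages* (`exists_sigma_le`). Within one cell and between neighbours, a function
of energy `1` oscillates by at most a multiple of `√M`, so `σ_m ≤ C M`.

*Lower bound for the resistance* (`exists_maxRes_le_mul`). Let `R` be the resistance between cells `w`
and `v` near the two half-sides, and `u` a function of energy `1` with an oscillation of about `√M`.
For every word `τ` of bounded length, restrict `u` to the cell of `τ` and rescale it to a function on
the whole carpet (`zoom`). All these functions and their images under the dihedral group have bounded
energy, so by cutting off a function at a level set one finds a chain of cells from `w` to `v` along
which each of them varies by `O(√R)` (`reachable_sublevel`, `exists_walk`).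

The boundaries of the cells of the chain form a path connected subset of `K`. Since the half-sides are
at distance at least `1`, it crosses two consecutive axes of symmetry (`exists_axes`), and the
reflections in these generate the dihedral group (`exists_steps`). Hence the union of its images is
path connected as well (`isPathConnected_orbit`), it is invariant, it meets every half-side, and the
restrictions of `u` are still nearly constant on it. So (LI) applies to this union, and by symmetry at
every corner cell `Ψ_c` (`LoopIntersection.exists_Ψ_mem`): the union meets its copy in `Ψ_c`.
Therefore the value of `u` on the copy of the union in the cell of `τ` differs by `O(√R)` from that on
the copy in the cell of `τ c`.

Call the function that assigns to `τ` the value of `u` on the copy in the cell of `τ` a profile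
(`IsProfile`, `exists_isProfile`). It changes by `O(√R)` on passing to a corner cell, and, by the
growth of the maximal resistance, by `O(√R)` and a small fraction of `√M` between small intersecting
cells. Two cells that share a vertex are therefore compared through nested corner cells at that
vertex. As the cells along a side form a chain of cells that share vertices (`link_side`), every cell
with a side on the boundary is compared with its parent; nested cells along the boundary then compare
any two intersecting cells (`close_of_inter`), and connectedness of `K` compares all of them with
their parent (`link_letter`, `close_nil`). Altogether `u` oscillates by at most `C √R + √M / 4`. As its
oscillation exceeds `√M / 2`, this gives `M ≤ C R`.
-/

noncomputable section

namespace PolygonCarpet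

/-! ### Geometry of the regular polygon -/

/-- Among the angles `πn / N` that are not multiples of `2π` the cosine is largest at `± π / N` only.
For odd `n` these are the angles between the vertices and the outer normal of a side, so the side is
the face of the polygon in that direction. -/
theorem cos_int_mul_pi_div_le {N : ℕ} (hN : 0 < N) (n : ℤ) (hn : ¬ (2 * (N : ℤ)) ∣ n) :
    Real.cos (Real.pi * n / N) ≤ Real.cos (Real.pi / N) ∧
      (Real.cos (Real.pi * n / N) = Real.cos (Real.pi / N) →
        (2 * (N : ℤ)) ∣ n - 1 ∨ (2 * (N : ℤ)) ∣ n + 1) := by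
  have hNr : (0 : ℝ) < N := by exact_mod_cast hN
  have hpi := Real.pi_pos
  obtain ⟨r, t, hr0, hrN, hnt⟩ : ∃ r t : ℤ, 0 < r ∧ r < 2 * N ∧ n = r + 2 * N * t := by
    refine ⟨n % (2 * N), n / (2 * N), ?_, Int.emod_lt_of_pos _ (by omega), ?_⟩
    · have h0 := Int.emod_nonneg n (show (2 * (N : ℤ)) ≠ 0 by omega)
      have h1 : n % (2 * N) ≠ 0 := fun h => hn (Int.dvd_of_emod_eq_zero h)
      omega
    · exact (Int.emod_add_mul_ediv n (2 * N)).symm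
  have hcos : Real.cos (Real.pi * n / N) = Real.cos (Real.pi * r / N) := by
    have : Real.pi * n / N = Real.pi * r / N + t * (2 * Real.pi) := by
      rw [hnt]; push_cast; field_simp
    rw [this, Real.cos_add_int_mul_two_pi]
  -- fold `r` into `[1, N]`, where the cosine is injective
  obtain ⟨p, hp1, hpN, hp, hpr⟩ : ∃ p : ℤ, 1 ≤ p ∧ p ≤ N ∧
      Real.cos (Real.pi * r / N) = Real.cos (Real.pi * p / N) ∧ (p = r ∨ p = 2 * N - r) := by
    rcases le_or_gt r N with h | h
    · exact ⟨r, by omega, h, rfl, Or.inl rfl⟩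
    · refine ⟨2 * N - r, by omega, by omega, ?_, Or.inr rfl⟩
      have : Real.pi * ((2 * N - r : ℤ) : ℝ) / N = 2 * Real.pi - Real.pi * r / N := by
        push_cast; field_simp
      rw [this, Real.cos_two_pi_sub]
  rw [hcos, hp]
  have hp1' : (1 : ℝ) ≤ p := by exact_mod_cast hp1
  have hpN' : (p : ℝ) ≤ N := by exact_mod_cast hpN
  have hle : Real.pi / N ≤ Real.pi * p / N := by
    apply div_le_div_of_nonneg_right _ hNr.le; nlinarith
  have hle2 : Real.pi * p / N ≤ Real.pi := by
    rw [div_le_iff₀ hNr]; nlinarith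
  have h0 : 0 ≤ Real.pi / N := by positivity
  refine ⟨Real.cos_le_cos_of_nonneg_of_le_pi h0 hle2 hle, fun h => ?_⟩
  have hinj := Real.injOn_cos ⟨h0.trans hle, hle2⟩ ⟨h0, hle.trans hle2⟩ h
  have : (p : ℝ) = 1 := by
    field_simp at hinj; linarith
  have hp1 : p = 1 := by exact_mod_cast this
  rcases hpr with h | h
  · left; exact ⟨t, by omega⟩
  · right; refine ⟨t + 1, ?_⟩
    have : r = 2 * N - 1 := by omega
    rw [hnt, this]; ring

/-- A linear functional which is bounded by `m` on `S` attains `m` on `convexHull ℝ S` only on the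
hull of the points of `S` where it attains `m`. -/
theorem mem_convexHull_of_eq_max {E : Type*} [AddCommGroup E] [Module ℝ E] (f : E →ₗ[ℝ] ℝ)
    {S : Set E} {m : ℝ} (hS : ∀ s ∈ S, f s ≤ m) {z : E} (hz : z ∈ convexHull ℝ S) (hm : f z = m) :
    z ∈ convexHull ℝ {s ∈ S | f s = m} := by
  have key : convexHull ℝ S ⊆ {z | f z ≤ m ∧ (f z = m → z ∈ convexHull ℝ {s ∈ S | f s = m})} := by
    refine convexHull_min (fun s hs => ⟨hS s hs, fun h => subset_convexHull ℝ _ ⟨hs, h⟩⟩) ?_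
    rintro x ⟨hx, hx'⟩ y ⟨hy, hy'⟩ a b ha hb hab
    have hf : f (a • x + b • y) = a * f x + b * f y := by simp
    have h1 := mul_le_mul_of_nonneg_left hx ha
    have h2 := mul_le_mul_of_nonneg_left hy hb
    have h3 : a * m + b * m = m := by rw [← add_mul, hab, one_mul]
    refine ⟨by rw [hf]; linarith, fun h => ?_⟩
    rw [hf] at h
    rcases ha.eq_or_lt with rfl | ha
    · have : b = 1 := by linarith
      subst this
      simpa using hy' (by linarith)
    rcases hb.eq_or_lt with rfl | hb
    · have : a = 1 := by linarith
      subst this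
      simpa using hx' (by linarith)
    refine convex_convexHull ℝ _ (hx' ?_) (hy' ?_) ha.le hb.le hab
    · exact le_antisymm hx (le_of_mul_le_mul_left (by linarith) ha)
    · exact le_antisymm hy (le_of_mul_le_mul_left (by linarith) hb)
  exact (key hz).2 hm

namespace UnitPolygon

variable (P : UnitPolygon)

theorem N_pos : 0 < P.N := by have := P.three_le; omega

theorem N_pos' : (0 : ℝ) < P.N := by exact_mod_cast P.N_pos

theorem three_le' : (3 : ℝ) ≤ P.N := by exact_mod_cast P.three_le

theorem arm_ne_zero : P.arm ≠ 0 := by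
  intro h
  have := P.side_length
  simp [vertex, h] at this

/-- The affine coordinate in which the vertex `q_k` is the root of unity `exp (2πik / N)`. -/
def coord (z : ℂ) : ℂ := (z - P.ctr) / P.arm

theorem eq_coord (z : ℂ) : z = P.ctr + P.arm * P.coord z := by
  have := P.arm_ne_zero
  unfold coord; field_simp; ring

theorem coord_eq_iff {z x : ℂ} : P.coord z = x ↔ z = P.ctr + P.arm * x := by
  have := P.arm_ne_zero
  unfold coord; field_simp
  constructor <;> intro h
  · linear_combination h
  · linear_combination h

theorem q_eq (k : ℕ) :
    P.q k = P.ctr + P.arm * Complex.exp ((2 * Real.pi * k / P.N : ℝ) * Complex.I) := by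
  unfold q vertex; congr 3; push_cast; ring

theorem coord_q (k : ℕ) :
    P.coord (P.q k) = Complex.exp ((2 * Real.pi * k / P.N : ℝ) * Complex.I) :=
  P.coord_eq_iff.2 (P.q_eq k)

theorem exp_eq_exp_of_dvd {m n : ℤ} (h : (P.N : ℤ) ∣ m - n) :
    Complex.exp ((2 * Real.pi * m / P.N : ℝ) * Complex.I) =
      Complex.exp ((2 * Real.pi * n / P.N : ℝ) * Complex.I) := by
  obtain ⟨t, ht⟩ := h
  rw [Complex.exp_eq_exp_iff_exists_int]
  refine ⟨t, ?_⟩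
  have hN : (P.N : ℂ) ≠ 0 := by exact_mod_cast P.N_pos.ne'
  have : (m : ℂ) = n + P.N * t := by
    have : m = n + P.N * t := by omega
    rw [this]; push_cast; ring
  push_cast
  rw [this]; field_simp

theorem q_congr {k l : ℕ} (h : k ≡ l [MOD P.N]) : P.q k = P.q l := by
  rw [q_eq, q_eq]
  have : (P.N : ℤ) ∣ (k : ℤ) - l := (Nat.modEq_iff_dvd.1 h.symm)
  have := P.exp_eq_exp_of_dvd this
  push_cast at this ⊢
  rw [this]

theorem exists_index (k : ℕ) : ∃ l ∈ Set.Icc 1 P.N, k ≡ l [MOD P.N] := by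
  have h := P.N_pos
  rcases Nat.eq_zero_or_pos (k % P.N) with h0 | h0
  · exact ⟨P.N, ⟨h, le_rfl⟩, by simp [Nat.ModEq, h0]⟩
  · exact ⟨k % P.N, ⟨h0, (Nat.mod_lt _ h).le⟩, (Nat.mod_modEq _ _).symm⟩

theorem q_mem_body (k : ℕ) : P.q k ∈ P.body := by
  obtain ⟨l, hl, h⟩ := P.exists_index k
  rw [P.q_congr h]
  exact subset_convexHull ℝ _ ⟨l, hl, rfl⟩

theorem convex_body : Convex ℝ P.body := convex_convexHull ℝ _

theorem isCompact_body : IsCompact P.body :=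
  ((Set.finite_Icc 1 P.N).image _).isCompact_convexHull ℝ

theorem side_subset_body (k : ℕ) : P.side k ⊆ P.body :=
  P.convex_body.segment_subset (P.q_mem_body _) (P.q_mem_body _)

/-- The linear part of `height`. -/
def heightLin (φ : ℝ) : ℂ →ₗ[ℝ] ℝ :=
  Complex.reLm ∘ₗ LinearMap.mulRight ℝ (P.arm⁻¹ * Complex.exp (-(φ * Complex.I)))

/-- The coordinate of `z` in the direction `φ`, measured from the centre, in units of the
circumradius and with the vertex `q_N` in direction `0`. -/
def height (φ : ℝ) (z : ℂ) : ℝ := (P.coord z * Complex.exp (-(φ * Complex.I))).re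

theorem height_eq (φ : ℝ) (z : ℂ) : P.height φ z = P.heightLin φ z - P.heightLin φ P.ctr := by
  rw [← map_sub]
  simp only [height, heightLin, LinearMap.comp_apply, LinearMap.mulRight_apply, Complex.reLm_coe,
    coord, div_eq_mul_inv, mul_assoc]

theorem height_coord (φ a b : ℝ) (z x y : ℂ) (h : P.coord z = a * P.coord x + b * P.coord y) :
    P.height φ z = a * P.height φ x + b * P.height φ y := by
  unfold height
  rw [h, add_mul, mul_assoc, mul_assoc, Complex.add_re, Complex.re_ofReal_mul,
    Complex.re_ofReal_mul]

theorem height_comb (φ : ℝ) {a b : ℝ} (hab : a + b = 1) (x y : ℂ) :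
    P.height φ (a • x + b • y) = a * P.height φ x + b * P.height φ y := by
  simp only [height_eq, map_add, map_smul, smul_eq_mul]
  linear_combination (P.heightLin φ P.ctr) * hab

theorem height_exp (φ θ : ℝ) :
    (Complex.exp (θ * Complex.I) * Complex.exp (-(φ * Complex.I))).re = Real.cos (θ - φ) := by
  rw [← Complex.exp_add]
  have : (θ : ℂ) * Complex.I + -(φ * Complex.I) = ((θ - φ : ℝ) : ℂ) * Complex.I := by
    push_cast; ring
  rw [this, Complex.exp_ofReal_mul_I_re]

theorem height_q (φ : ℝ) (k : ℕ) : P.height φ (P.q k) = Real.cos (2 * Real.pi * k / P.N - φ) := by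
  rw [height, coord_q, height_exp]

theorem height_ctr (φ : ℝ) : P.height φ P.ctr = 0 := by simp [height, coord]

theorem continuous_height (φ : ℝ) : Continuous (P.height φ) := by
  unfold height coord; fun_prop

theorem convex_height_le (φ m : ℝ) : Convex ℝ {z | P.height φ z ≤ m} := by
  have := convex_halfSpace_le (P.heightLin φ).isLinear (m + P.heightLin φ P.ctr)
  have e : {z | P.height φ z ≤ m} = {w | (P.heightLin φ) w ≤ m + (P.heightLin φ) P.ctr} := by
    ext z; simp [height_eq]
  rw [e]; exact this

theorem convex_height_ge (φ m : ℝ) : Convex ℝ {z | m ≤ P.height φ z} := by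
  have := convex_halfSpace_ge (P.heightLin φ).isLinear (m + P.heightLin φ P.ctr)
  have e : {z | m ≤ P.height φ z} = {w | m + (P.heightLin φ) P.ctr ≤ (P.heightLin φ) w} := by
    ext z; simp [height_eq, le_sub_iff_add_le]
  rw [e]; exact this

/-- The direction of the outer normal of the side `L_k`. -/
def normal (k : ℕ) : ℝ := Real.pi * (2 * k + 1) / P.N

/-- The apothem, in units of the circumradius. -/
def apothem : ℝ := Real.cos (Real.pi / P.N)

theorem apothem_pos : 0 < P.apothem := by
  have h3 := P.three_le'
  have hpi := Real.pi_pos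
  apply Real.cos_pos_of_mem_Ioo
  constructor
  · have : 0 < Real.pi / P.N := div_pos hpi P.N_pos'
    linarith
  · rw [div_lt_iff₀ P.N_pos']; nlinarith

theorem height_normal_q (k j : ℕ) : P.height (P.normal k) (P.q j) =
    Real.cos (Real.pi * ((2 * ((j : ℤ) - k) - 1 : ℤ) : ℝ) / P.N) := by
  rw [height_q, normal]
  congr 1; push_cast; have := P.N_pos'; field_simp; ring

theorem two_N_not_dvd (k j : ℕ) : ¬ (2 * (P.N : ℤ)) ∣ 2 * ((j : ℤ) - k) - 1 := fun h => by
  have := (dvd_mul_right 2 (P.N : ℤ)).trans h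
  omega

theorem height_normal_q_le (k j : ℕ) : P.height (P.normal k) (P.q j) ≤ P.apothem := by
  rw [height_normal_q]
  exact (cos_int_mul_pi_div_le P.N_pos _ (P.two_N_not_dvd k j)).1

theorem eq_of_height_normal_q (k j : ℕ) (h : P.height (P.normal k) (P.q j) = P.apothem) :
    P.q j = P.q k ∨ P.q j = P.q (k + 1) := by
  rw [height_normal_q] at h
  rcases (cos_int_mul_pi_div_le P.N_pos _ (P.two_N_not_dvd k j)).2 h with h | h
  · right
    apply P.q_congr
    rw [Nat.modEq_iff_dvd]
    obtain ⟨t, ht⟩ := h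
    exact ⟨-t, by push_cast; linarith⟩
  · left
    apply P.q_congr
    rw [Nat.modEq_iff_dvd]
    obtain ⟨t, ht⟩ := h
    exact ⟨-t, by linarith⟩

theorem height_normal_self (k : ℕ) : P.height (P.normal k) (P.q k) = P.apothem := by
  rw [height_q, normal, apothem, ← Real.cos_neg]
  congr 1; field_simp; ring

theorem height_normal_succ (k : ℕ) : P.height (P.normal k) (P.q (k + 1)) = P.apothem := by
  rw [height_q, normal, apothem]
  congr 1; field_simp; push_cast; ring

theorem height_normal_le {z : ℂ} (k : ℕ) (hz : z ∈ P.body) :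
    P.height (P.normal k) z ≤ P.apothem := by
  have : P.body ⊆ {z | P.height (P.normal k) z ≤ P.apothem} := by
    refine convexHull_min ?_ (P.convex_height_le _ _)
    rintro _ ⟨j, -, rfl⟩
    exact P.height_normal_q_le k j
  exact this hz

theorem height_normal_side {z : ℂ} {k : ℕ} (hz : z ∈ P.side k) :
    P.height (P.normal k) z = P.apothem := by
  obtain ⟨a, b, ha, hb, hab, rfl⟩ := hz
  rw [P.height_comb _ hab, height_normal_self, height_normal_succ, ← add_mul, hab, one_mul]

/-- The side `L_k` is the face of the polygon in the direction of its outer normal. -/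
theorem mem_side_of_height {z : ℂ} {k : ℕ} (hz : z ∈ P.body)
    (h : P.height (P.normal k) z = P.apothem) : z ∈ P.side k := by
  have h1 := mem_convexHull_of_eq_max (P.heightLin (P.normal k))
    (S := P.q '' Set.Icc 1 P.N) (m := P.apothem + P.heightLin (P.normal k) P.ctr) ?_ hz ?_
  · have h2 : {s ∈ P.q '' Set.Icc 1 P.N | P.heightLin (P.normal k) s =
        P.apothem + P.heightLin (P.normal k) P.ctr} ⊆ P.side k := by
      rintro _ ⟨⟨j, -, rfl⟩, hj⟩
      rcases P.eq_of_height_normal_q k j (by rw [height_eq, hj]; ring) with h | h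
      · rw [h]; exact left_mem_segment ℝ _ _
      · rw [h]; exact right_mem_segment ℝ _ _
    exact convexHull_min h2 (convex_segment _ _) h1
  · rintro _ ⟨j, -, rfl⟩
    have := P.height_normal_q_le k j
    rw [height_eq] at this; linarith
  · rw [height_eq] at h; linarith

theorem two_pi_div_mem : 0 < 2 * Real.pi / P.N ∧ 2 * Real.pi / P.N < Real.pi := by
  have h3 := P.three_le'
  have hpi := Real.pi_pos
  refine ⟨by have := P.N_pos'; positivity, ?_⟩
  rw [div_lt_iff₀ P.N_pos']; nlinarith

/-- Every point of the plane lies in the sector of some side. -/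
theorem exists_sector (z : ℂ) : ∃ k ∈ Set.Icc 1 P.N, ∃ a b : ℝ, 0 ≤ a ∧ 0 ≤ b ∧
    P.coord z = a * P.coord (P.q k) + b * P.coord (P.q (k + 1)) := by
  set x := P.coord z with hx
  have hN := P.N_pos'
  obtain ⟨hs0, hs1⟩ := P.two_pi_div_mem
  set s := 2 * Real.pi / P.N with hs
  -- the sector is given by the integral part of the argument in units of `2π / N`
  set m : ℤ := ⌊x.arg / s⌋ with hm
  have hm1 : (m : ℝ) * s ≤ x.arg := by
    have := Int.floor_le (x.arg / s)
    rwa [le_div_iff₀ hs0] at this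
  have hm2 : x.arg < (m + 1 : ℝ) * s := by
    have := Int.lt_floor_add_one (x.arg / s)
    rwa [div_lt_iff₀ hs0] at this
  have hNz : (0 : ℤ) < P.N := by exact_mod_cast P.N_pos
  obtain ⟨k, hk, hkm⟩ : ∃ k ∈ Set.Icc 1 P.N, (P.N : ℤ) ∣ (k : ℤ) - m := by
    obtain ⟨l, hl, h⟩ := P.exists_index (m % P.N).toNat
    refine ⟨l, hl, ?_⟩
    have h0 := Int.emod_nonneg m hNz.ne'
    have h1 := Nat.modEq_iff_dvd.1 h
    rw [Int.toNat_of_nonneg h0] at h1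
    have h2 := Int.dvd_sub_self_of_emod_eq (a := m) (b := P.N) rfl
    have h3 : (l : ℤ) - m = (l - m % P.N) + (m % P.N - m) := by ring
    rw [h3]; exact dvd_add h1 h2
  have hsin : 0 < Real.sin s := Real.sin_pos_of_pos_of_lt_pi hs0 hs1
  -- the sine rule gives the coefficients of `e^{iθ}` in the basis of the two adjacent vertices
  refine ⟨k, hk, ‖x‖ * (Real.sin ((m + 1 : ℝ) * s - x.arg) / Real.sin s),
    ‖x‖ * (Real.sin (x.arg - m * s) / Real.sin s), ?_, ?_, ?_⟩
  · have := Real.sin_nonneg_of_nonneg_of_le_pi (x := (m + 1 : ℝ) * s - x.arg) (by linarith)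
      (by linarith)
    positivity
  · have := Real.sin_nonneg_of_nonneg_of_le_pi (x := x.arg - m * s) (by linarith)
      (by linarith)
    positivity
  have e1 : P.coord (P.q k) = Complex.exp ((m * s : ℝ) * Complex.I) := by
    rw [coord_q]
    have := P.exp_eq_exp_of_dvd hkm
    push_cast at this
    push_cast [hs]
    rw [this]; congr 2; ring
  have e2 : P.coord (P.q (k + 1)) = Complex.exp (((m + 1) * s : ℝ) * Complex.I) := by
    rw [coord_q]
    have := P.exp_eq_exp_of_dvd (m := (k + 1 : ℕ)) (n := m + 1) (by
      have : ((k + 1 : ℕ) : ℤ) - (m + 1) = k - m := by push_cast; ring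
      rw [this]; exact hkm)
    push_cast at this
    push_cast [hs]
    rw [this]; congr 2; ring
  rw [e1, e2]
  have e3 : x = ‖x‖ * Complex.exp (x.arg * Complex.I) := (Complex.norm_mul_exp_arg_mul_I x).symm
  have e4 : Complex.exp (x.arg * Complex.I) =
      ((Real.sin ((m + 1 : ℝ) * s - x.arg) / Real.sin s : ℝ) : ℂ) *
        Complex.exp ((m * s : ℝ) * Complex.I) +
      ((Real.sin (x.arg - m * s) / Real.sin s : ℝ) : ℂ) *
        Complex.exp (((m + 1) * s : ℝ) * Complex.I) := by
    have hα : ((m + 1 : ℝ) * s) = m * s + s := by ring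
    rw [hα]
    generalize (m : ℝ) * s = α
    generalize x.arg = θ
    have h1 : θ = α + (θ - α) := by ring
    have h2 : α + s - θ = s - (θ - α) := by ring
    rw [h2]
    generalize θ - α = β at *
    subst h1
    apply Complex.ext
    · simp only [Complex.add_re, Complex.re_ofReal_mul, Complex.exp_ofReal_mul_I_re]
      rw [Real.cos_add, Real.cos_add, Real.sin_sub]
      field_simp
      ring
    · simp only [Complex.add_im, Complex.im_ofReal_mul, Complex.exp_ofReal_mul_I_im]
      rw [Real.sin_add, Real.sin_add, Real.sin_sub]
      field_simp
      ring
  conv_lhs => rw [e3, e4]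
  push_cast
  ring

theorem sum_exp_eq_zero : ∑ k ∈ Finset.range P.N,
    Complex.exp ((2 * Real.pi * k / P.N : ℝ) * Complex.I) = 0 := by
  have h := (Complex.isPrimitiveRoot_exp P.N P.N_pos.ne').geom_sum_eq_zero
    (by have := P.three_le; omega)
  rw [← h]
  refine Finset.sum_congr rfl fun k _ => ?_
  rw [← Complex.exp_nat_mul]
  congr 1; push_cast; ring

theorem ctr_mem_body : P.ctr ∈ P.body := by
  have hN := P.N_pos'
  have h := P.convex_body.sum_mem (t := Finset.range P.N) (w := fun _ => (1 / P.N : ℝ))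
    (z := P.q) (fun _ _ => by positivity) (by simp; field_simp) (fun k _ => P.q_mem_body k)
  convert h using 1
  have hNc : (P.N : ℂ) ≠ 0 := by exact_mod_cast P.N_pos.ne'
  rw [← Finset.smul_sum]
  simp_rw [P.q_eq]
  rw [Finset.sum_add_distrib, ← Finset.mul_sum, P.sum_exp_eq_zero]
  simp [hNc]

theorem sector_mem {z : ℂ} {k : ℕ} {a b : ℝ}
    (h : P.coord z = a * P.coord (P.q k) + b * P.coord (P.q (k + 1))) :
    z = (1 - (a + b)) • P.ctr + a • P.q k + b • P.q (k + 1) := by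
  rw [P.eq_coord z, h]
  conv_rhs => rw [P.eq_coord (P.q k), P.eq_coord (P.q (k + 1))]
  simp only [Complex.real_smul]; push_cast; ring

theorem height_sector {z : ℂ} {k : ℕ} {a b : ℝ}
    (h : P.coord z = a * P.coord (P.q k) + b * P.coord (P.q (k + 1))) :
    P.height (P.normal k) z = (a + b) * P.apothem := by
  rw [P.height_coord _ _ _ _ _ _ h, height_normal_self, height_normal_succ]; ring

/-- The polygon is the intersection of the half-planes of its sides: in the sector of `L_k` the height
in the normal direction is `(a + b)` times the apothem. -/
theorem mem_body_of_height {z : ℂ} (h : ∀ k ∈ Set.Icc 1 P.N, P.height (P.normal k) z ≤ P.apothem) :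
    z ∈ P.body := by
  obtain ⟨k, hk, a, b, ha, hb, hz⟩ := P.exists_sector z
  have h1 := h k hk
  rw [P.height_sector hz] at h1
  have h2 : a + b ≤ 1 := by have := P.apothem_pos; nlinarith
  have h3 := P.convex_body.sum_mem (t := Finset.univ) (w := ![1 - (a + b), a, b])
    (z := ![P.ctr, P.q k, P.q (k + 1)]) ?_ ?_ ?_
  · rw [P.sector_mem hz]
    convert h3 using 1
    simp [Fin.sum_univ_three]
  · intro i _; fin_cases i <;> simp <;> linarith
  · simp [Fin.sum_univ_three]; ring
  · intro i _; fin_cases i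
    · exact P.ctr_mem_body
    · exact P.q_mem_body _
    · exact P.q_mem_body _

theorem mem_interior_of_height {z : ℂ}
    (h : ∀ k ∈ Set.Icc 1 P.N, P.height (P.normal k) z < P.apothem) : z ∈ interior P.body := by
  rw [mem_interior]
  refine ⟨⋂ k ∈ Set.Icc 1 P.N, {z | P.height (P.normal k) z < P.apothem}, ?_, ?_, ?_⟩
  · intro w hw
    simp only [Set.mem_iInter] at hw
    exact P.mem_body_of_height fun k hk => (hw k hk).le
  · exact (Set.finite_Icc _ _).isOpen_biInter fun k _ =>
      isOpen_lt (P.continuous_height _) continuous_const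
  · simp only [Set.mem_iInter]
    exact h

theorem ctr_mem_interior : P.ctr ∈ interior P.body :=
  P.mem_interior_of_height fun k _ => by rw [height_ctr]; exact P.apothem_pos

theorem height_lt_of_mem_interior {z : ℂ} (k : ℕ) (hz : z ∈ interior P.body) :
    P.height (P.normal k) z < P.apothem := by
  refine lt_of_le_of_ne (P.height_normal_le k (interior_subset hz)) fun h => ?_
  -- moving away from the centre stays in the polygon but increases the height
  have hc : Filter.Tendsto (fun t : ℝ => z + (t : ℂ) * (z - P.ctr)) (nhdsWithin 0 (Set.Ioi 0))
      (nhds z) := by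
    have : Continuous fun t : ℝ => z + (t : ℂ) * (z - P.ctr) := by fun_prop
    have := (this.tendsto 0).mono_left (nhdsWithin_le_nhds (s := Set.Ioi 0))
    simpa using this
  obtain ⟨t, ht, ht0⟩ := ((hc.eventually (isOpen_interior.mem_nhds hz)).and
    self_mem_nhdsWithin).exists
  have ht0 : 0 < t := ht0
  have h1 := P.height_normal_le k (interior_subset ht)
  have h2 : P.height (P.normal k) (z + (t : ℂ) * (z - P.ctr)) =
      (1 + t) * P.height (P.normal k) z := by
    have : P.coord (z + (t : ℂ) * (z - P.ctr)) = ((1 + t : ℝ) : ℂ) * P.coord z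
        + ((0 : ℝ) : ℂ) * P.coord z := by
      unfold coord; push_cast; ring
    rw [P.height_coord _ _ _ _ _ _ this]; ring
  rw [h2, h] at h1
  have := P.apothem_pos
  nlinarith

theorem bdry_eq : P.bdry = P.body \ interior P.body := by
  ext z
  simp only [bdry, Set.mem_iUnion, Set.mem_sdiff]
  constructor
  · rintro ⟨k, hk, hz⟩
    refine ⟨P.side_subset_body k hz, fun h => ?_⟩
    exact (P.height_lt_of_mem_interior k h).ne (P.height_normal_side hz)
  · rintro ⟨hz, hz'⟩
    by_contra hne
    push Not at hne
    exact hz' (P.mem_interior_of_height fun k hk =>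
      lt_of_le_of_ne (P.height_normal_le k hz) fun h => hne k hk (P.mem_side_of_height hz h))

theorem inside_eq : P.inside = interior P.body := by
  rw [inside, bdry_eq, Set.sdiff_sdiff_right_self]
  exact Set.inter_eq_self_of_subset_right interior_subset

theorem bdry_subset_body : P.bdry ⊆ P.body := by rw [bdry_eq]; exact Set.sdiff_subset

theorem side_congr {k l : ℕ} (h : k ≡ l [MOD P.N]) : P.side k = P.side l := by
  unfold side; rw [P.q_congr h, P.q_congr (h.add_right 1)]

theorem side_subset_bdry (k : ℕ) : P.side k ⊆ P.bdry := by
  obtain ⟨l, hl, h⟩ := P.exists_index k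
  rw [P.side_congr h]
  exact Set.subset_biUnion_of_mem (u := fun k => P.side k) hl

theorem q_mem_bdry (k : ℕ) : P.q k ∈ P.bdry :=
  P.side_subset_bdry k (left_mem_segment ℝ _ _)

theorem exists_mem_side {z : ℂ} (hz : z ∈ P.bdry) : ∃ k ∈ Set.Icc 1 P.N, z ∈ P.side k := by
  simpa [bdry] using hz

theorem isCompact_bdry : IsCompact P.bdry := by
  rw [bdry_eq]
  exact P.isCompact_body.diff isOpen_interior

theorem isPathConnected_side (k : ℕ) : IsPathConnected (P.side k) :=
  (convex_segment _ _).isPathConnected ⟨P.q k, left_mem_segment ℝ _ _⟩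

theorem joinedIn_bdry_q (k : ℕ) : JoinedIn P.bdry (P.q 1) (P.q (k + 1)) := by
  induction k with
  | zero => exact JoinedIn.refl (P.q_mem_bdry 1)
  | succ k ih =>
    exact ih.trans (((P.isPathConnected_side (k + 1)).joinedIn _ (left_mem_segment ℝ _ _) _
      (right_mem_segment ℝ _ _)).mono (P.side_subset_bdry (k + 1)))

theorem isPathConnected_bdry : IsPathConnected P.bdry := by
  refine ⟨P.q 1, P.q_mem_bdry 1, ?_⟩
  intro z hz
  obtain ⟨k, hk, hz⟩ := P.exists_mem_side hz
  have h1 := P.joinedIn_bdry_q (k - 1)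
  rw [Nat.sub_add_cancel hk.1] at h1
  exact h1.trans (((P.isPathConnected_side k).joinedIn _ (left_mem_segment ℝ _ _) _ hz).mono
    (P.side_subset_bdry k))

theorem exists_ball : ∃ r > 0, Metric.ball P.ctr r ⊆ interior P.body :=
  Metric.isOpen_iff.1 isOpen_interior _ P.ctr_mem_interior

end UnitPolygon

namespace UnitPolygon

variable (P : UnitPolygon)

/-! ### The dihedral group -/

/-- The roots of unity `exp (2πik / N)`. -/
def root (k : ℕ) : ℂ := Complex.exp ((2 * Real.pi * k / P.N : ℝ) * Complex.I)

theorem coord_q' (k : ℕ) : P.coord (P.q k) = P.root k := P.coord_q k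

theorem q_eq' (k : ℕ) : P.q k = P.ctr + P.arm * P.root k := P.q_eq k

theorem root_add (k l : ℕ) : P.root (k + l) = P.root k * P.root l := by
  rw [root, root, root, ← Complex.exp_add]
  congr 1; push_cast; ring

theorem root_zero : P.root 0 = 1 := by simp [root]

theorem norm_root (k : ℕ) : ‖P.root k‖ = 1 := Complex.norm_exp_ofReal_mul_I _

theorem root_congr {k l : ℕ} (h : k ≡ l [MOD P.N]) : P.root k = P.root l := by
  rw [← coord_q', ← coord_q', P.q_congr h]

theorem root_ne_zero (k : ℕ) : P.root k ≠ 0 := Complex.exp_ne_zero _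

theorem conj_root_mul (k : ℕ) : (starRingEnd ℂ) (P.root k) * P.root k = 1 := by
  rw [mul_comm, Complex.mul_conj, Complex.normSq_eq_norm_sq, norm_root]; simp

theorem coord_inj {z w : ℂ} (h : P.coord z = P.coord w) : z = w := by
  rw [P.eq_coord z, h, ← P.eq_coord w]

/-- The rotation `q_j ↦ q_{j+k}`. -/
def rot (k : ℕ) : ℂ ≃ᵢ ℂ :=
  IsometryEquiv.mk' (fun z => P.ctr + P.root k * (z - P.ctr))
    (fun z => P.ctr + (P.root k)⁻¹ * (z - P.ctr))
    (fun z => by have := P.root_ne_zero k; field_simp; ring)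
    (Isometry.of_dist_eq fun x y => by
      rw [dist_add_left, dist_eq_norm, ← mul_sub, norm_mul, norm_root, dist_eq_norm]
      ring_nf)

/-- The axial symmetry `q_j ↦ q_{k-j}`. -/
def refl (k : ℕ) : ℂ ≃ᵢ ℂ :=
  IsometryEquiv.mk' (fun z => P.ctr + P.arm * P.root k * (starRingEnd ℂ) (P.coord z))
    (fun z => P.ctr + P.arm * P.root k * (starRingEnd ℂ) (P.coord z))
    (fun z => by
      have h : P.coord (P.ctr + P.arm * P.root k * (starRingEnd ℂ) (P.coord z)) =
          P.root k * (starRingEnd ℂ) (P.coord z) := by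
        rw [coord_eq_iff, mul_assoc]
      rw [h, map_mul, Complex.conj_conj]
      conv_rhs => rw [P.eq_coord z]
      linear_combination (P.arm * P.coord z) * P.conj_root_mul k)
    (Isometry.of_dist_eq fun x y => by
      have h : P.coord x - P.coord y = (x - y) / P.arm := by unfold coord; ring
      have h0 : ‖P.arm‖ ≠ 0 := norm_ne_zero_iff.2 P.arm_ne_zero
      rw [dist_add_left, dist_eq_norm, ← mul_sub, ← map_sub, norm_mul, norm_mul, norm_root,
        RCLike.norm_conj, h, norm_div, dist_eq_norm]
      field_simp)

theorem rot_apply (k : ℕ) (z : ℂ) : P.rot k z = P.ctr + P.root k * (z - P.ctr) := rfl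

theorem coord_rot (k : ℕ) (z : ℂ) : P.coord (P.rot k z) = P.root k * P.coord z := by
  rw [rot_apply]; unfold coord; ring

theorem coord_refl (k : ℕ) (z : ℂ) :
    P.coord (P.refl k z) = P.root k * (starRingEnd ℂ) (P.coord z) := by
  rw [coord_eq_iff, ← mul_assoc]; rfl

theorem rot_q (k j : ℕ) : P.rot k (P.q j) = P.q (j + k) := by
  apply P.coord_inj
  rw [coord_rot, coord_q', coord_q', root_add, mul_comm]

theorem refl_q {k j l : ℕ} (h : j + l ≡ k [MOD P.N]) : P.refl k (P.q j) = P.q l := by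
  apply P.coord_inj
  rw [coord_refl, coord_q', coord_q', ← P.root_congr h, root_add]
  linear_combination P.root l * P.conj_root_mul j

theorem rot_mem (k : ℕ) : P.rot k ∈ P.symmetries := Or.inl ⟨k, P.rot_q k⟩

theorem refl_mem (k : ℕ) : P.refl k ∈ P.symmetries := Or.inr ⟨k, fun _ _ h => P.refl_q h⟩

theorem image_q : P.q '' Set.Icc 1 P.N = Set.range P.q := by
  refine Set.Subset.antisymm (Set.image_subset_range _ _) ?_
  rintro _ ⟨k, rfl⟩
  obtain ⟨l, hl, h⟩ := P.exists_index k
  exact ⟨l, hl, (P.q_congr h).symm⟩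

theorem body_eq : P.body = convexHull ℝ (Set.range P.q) := by rw [body, image_q]

theorem image_convexHull_isometryEquiv (g : ℂ ≃ᵢ ℂ) (S : Set ℂ) :
    g '' convexHull ℝ S = convexHull ℝ (g '' S) := by
  have := AffineMap.image_convexHull
    (g.toRealAffineIsometryEquiv.toAffineEquiv : ℂ →ᵃ[ℝ] ℂ) S
  simpa using this

theorem exists_add_modEq (j k : ℕ) : ∃ l, j + l ≡ k [MOD P.N] := by
  refine ⟨k + P.N * j - j, ?_⟩
  have : j ≤ P.N * j := Nat.le_mul_of_pos_left _ P.N_pos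
  have h : j + (k + P.N * j - j) = k + P.N * j := by omega
  rw [h]
  simp [Nat.ModEq]

/-- A symmetry permutes the vertices, hence maps their convex hull onto itself. -/
theorem image_body_of_mem {g : ℂ ≃ᵢ ℂ} (hg : g ∈ P.symmetries) : g '' P.body = P.body := by
  rw [body_eq, image_convexHull_isometryEquiv]
  congr 1
  ext z
  constructor
  · rintro ⟨_, ⟨j, rfl⟩, rfl⟩
    rcases hg with ⟨k, hk⟩ | ⟨k, hk⟩
    · exact ⟨_, (hk j).symm⟩
    · obtain ⟨l, hl⟩ := P.exists_add_modEq j k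
      exact ⟨l, (hk j l hl).symm⟩
  · rintro ⟨l, rfl⟩
    rcases hg with ⟨k, hk⟩ | ⟨k, hk⟩
    · obtain ⟨j, hj⟩ := P.exists_add_modEq k l
      exact ⟨_, ⟨j, rfl⟩, by rw [hk, add_comm, P.q_congr hj]⟩
    · obtain ⟨j, hj⟩ := P.exists_add_modEq l k
      exact ⟨_, ⟨j, rfl⟩, by rw [hk j l (by rwa [add_comm])]⟩

theorem dist_q_ctr (k : ℕ) : dist (P.q k) P.ctr = ‖P.arm‖ := by
  rw [q_eq', dist_eq_norm, add_sub_cancel_left, norm_mul, norm_root, mul_one]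

theorem body_subset_closedBall : P.body ⊆ Metric.closedBall P.ctr ‖P.arm‖ := by
  rw [body_eq]
  refine convexHull_min ?_ (convex_closedBall _ _)
  rintro _ ⟨k, rfl⟩
  exact (P.dist_q_ctr k).le

theorem norm_coord (z : ℂ) : ‖P.coord z‖ = dist z P.ctr / ‖P.arm‖ := by
  rw [coord, norm_div, dist_eq_norm]

/-- The points of the polygon on the circumscribed circle are the vertices. -/
theorem exists_eq_q {z : ℂ} (hz : z ∈ P.body) (h : ‖P.coord z‖ = 1) :
    ∃ k ∈ Set.Icc 1 P.N, z = P.q k := by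
  obtain ⟨k, hk, a, b, ha, hb, hs⟩ := P.exists_sector z
  have hab : a + b ≤ 1 := by
    have h1 := P.height_normal_le k hz
    rw [P.height_sector hs] at h1
    have := P.apothem_pos
    nlinarith
  set t := 2 * Real.pi / P.N with ht
  have h1 : P.root 1 = Complex.exp ((t : ℝ) * Complex.I) := by
    rw [root, ht]; simp
  have h2 : P.coord z = P.root k * (a + b * P.root 1) := by
    rw [hs, coord_q', coord_q', root_add]; ring
  have h3 : a ^ 2 + b ^ 2 + 2 * a * b * Real.cos t = 1 := by
    rw [h2, norm_mul, norm_root, one_mul] at h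
    have h4 : ‖(a : ℂ) + b * P.root 1‖ ^ 2 = 1 := by rw [h]; norm_num
    rw [← Complex.normSq_eq_norm_sq, Complex.normSq_apply, h1] at h4
    simp only [Complex.add_re, Complex.add_im, Complex.ofReal_re, Complex.ofReal_im,
      Complex.re_ofReal_mul, Complex.im_ofReal_mul, Complex.exp_ofReal_mul_I_re,
      Complex.exp_ofReal_mul_I_im] at h4
    have := Real.sin_sq_add_cos_sq t
    linear_combination h4 - b ^ 2 * this
  have hcos : Real.cos t < 1 := by
    rw [← Real.cos_zero]
    have := P.two_pi_div_mem
    exact Real.cos_lt_cos_of_nonneg_of_le_pi le_rfl this.2.le this.1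
  -- the circle is strictly convex: a point of norm `1` with `a + b ≤ 1` has `a = 0` or `b = 0`
  have hab0 : a * b = 0 := by
    have h5 : 0 ≤ a * b := mul_nonneg ha hb
    have h6 : (a + b) ^ 2 ≤ 1 := by nlinarith
    have h7 : 2 * (a * b) * (1 - Real.cos t) ≤ 0 := by nlinarith
    by_contra hne
    have : 0 < a * b := lt_of_le_of_ne h5 (Ne.symm hne)
    have : 0 < 2 * (a * b) * (1 - Real.cos t) := by
      have : 0 < 1 - Real.cos t := by linarith
      positivity
    linarith
  rcases mul_eq_zero.1 hab0 with rfl | rfl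
  · have hb1 : b = 1 := by nlinarith
    have hz : z = P.q (k + 1) := P.coord_inj (by rw [hs, hb1]; simp)
    obtain ⟨l, hl, hkl⟩ := P.exists_index (k + 1)
    exact ⟨l, hl, by rw [hz, P.q_congr hkl]⟩
  · have ha1 : a = 1 := by nlinarith
    exact ⟨k, hk, P.coord_inj (by rw [hs, ha1]; simp)⟩

/-- The centre is the only point within the circumradius of all the vertices. -/
theorem eq_ctr_of_dist_le {c : ℂ} (h : ∀ k, dist (P.q k) c ≤ ‖P.arm‖) : c = P.ctr := by
  set x := P.coord c with hx
  have hr : 0 < ‖P.arm‖ := norm_pos_iff.2 P.arm_ne_zero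
  have h1 : ∀ k, Complex.normSq x - 2 * (P.root k * (starRingEnd ℂ) x).re ≤ 0 := by
    intro k
    have h2 : ‖P.root k - x‖ ≤ 1 := by
      have : P.q k - c = P.arm * (P.root k - x) := by
        rw [q_eq', P.eq_coord c]; ring
      have h3 := h k
      rw [dist_eq_norm, this, norm_mul] at h3
      exact le_of_mul_le_mul_left (by linarith) hr
    have h3 : Complex.normSq (P.root k - x) ≤ 1 := by
      rw [Complex.normSq_eq_norm_sq]; nlinarith [norm_nonneg (P.root k - x)]
    rw [Complex.normSq_sub, Complex.normSq_eq_norm_sq (P.root k), norm_root] at h3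
    linarith
  -- summed over the vertices, the linear terms cancel
  have h2 : ∑ k ∈ Finset.range P.N,
      (Complex.normSq x - 2 * (P.root k * (starRingEnd ℂ) x).re) ≤ 0 :=
    Finset.sum_nonpos fun k _ => h1 k
  have h3 : ∑ k ∈ Finset.range P.N, P.root k = 0 := P.sum_exp_eq_zero
  rw [Finset.sum_sub_distrib, ← Finset.mul_sum, ← Complex.re_sum, ← Finset.sum_mul, h3] at h2
  simp at h2
  have h4 : Complex.normSq x ≤ 0 := by
    have := P.N_pos'
    nlinarith [Complex.normSq_nonneg x]
  have h5 : x = 0 := Complex.normSq_eq_zero.1 (le_antisymm h4 (Complex.normSq_nonneg x))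
  rw [P.eq_coord c, ← hx, h5]; simp

/-- An isometry that preserves the polygon is one of the `2N` dihedral symmetries. -/
theorem exists_eq_rot_or_refl {g : ℂ ≃ᵢ ℂ} (hg : g '' P.body = P.body) :
    ∃ k ∈ Set.Icc 1 P.N, g = P.rot k ∨ g = P.refl k := by
  have hc : g P.ctr = P.ctr := by
    refine P.eq_ctr_of_dist_le fun k => ?_
    have : P.q k ∈ g '' P.body := by rw [hg]; exact P.q_mem_body k
    obtain ⟨y, hy, hyk⟩ := this
    rw [← hyk, g.dist_eq]
    exact P.body_subset_closedBall hy
  have hr : ‖P.arm‖ ≠ 0 := norm_ne_zero_iff.2 P.arm_ne_zero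
  obtain ⟨k, hk, hgq⟩ : ∃ k ∈ Set.Icc 1 P.N, g (P.q 0) = P.q k := by
    apply P.exists_eq_q
    · rw [← hg]; exact ⟨_, P.q_mem_body 0, rfl⟩
    · rw [norm_coord]
      nth_rw 1 [← hc]
      rw [g.dist_eq, dist_q_ctr, div_self hr]
  have ha := P.arm_ne_zero
  have hq0 : P.q 0 - P.ctr = P.arm := by rw [q_eq', root_zero]; ring
  have hqk : P.q k - P.ctr = P.arm * P.root k := by rw [q_eq']; ring
  -- a linear isometry of the plane is determined by its type and the image of `q_0`
  obtain ⟨a, ha⟩ := linear_isometry_complex g.toRealLinearIsometryEquiv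
  have hlin : ∀ z, g z - P.ctr = g.toRealLinearIsometryEquiv (z - P.ctr) := by
    intro z
    rw [map_sub, IsometryEquiv.toRealLinearIsometryEquiv_apply,
      IsometryEquiv.toRealLinearIsometryEquiv_apply, hc]
    ring
  refine ⟨k, hk, ?_⟩
  rcases ha with ha | ha
  · left
    have h1 := hlin (P.q 0)
    rw [ha, hgq, rotation_apply, hq0, hqk] at h1
    have h2 : (a : ℂ) = P.root k := by
      apply mul_right_cancel₀ P.arm_ne_zero; rw [← h1]; ring
    ext1 z
    have h3 := hlin z
    rw [ha, rotation_apply, h2] at h3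
    rw [rot_apply, ← h3]; ring
  · right
    have h1 := hlin (P.q 0)
    rw [ha, hgq, LinearIsometryEquiv.trans_apply, rotation_apply, hq0, hqk,
      Complex.conjLIE_apply] at h1
    ext1 z
    have h3 := hlin z
    rw [ha, LinearIsometryEquiv.trans_apply, rotation_apply, Complex.conjLIE_apply] at h3
    have h4 : z - P.ctr = P.arm * P.coord z := by conv_lhs => rw [P.eq_coord z]; ring_nf
    apply P.coord_inj
    rw [coord_refl, coord_eq_iff]
    rw [h4, map_mul, ← mul_assoc, ← h1] at h3
    rw [← mul_assoc, ← h3]; ring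

theorem mem_symmetries_iff {g : ℂ ≃ᵢ ℂ} : g ∈ P.symmetries ↔ g '' P.body = P.body := by
  refine ⟨P.image_body_of_mem, fun h => ?_⟩
  obtain ⟨k, -, rfl | rfl⟩ := P.exists_eq_rot_or_refl h
  · exact P.rot_mem k
  · exact P.refl_mem k

theorem finite_symmetries : P.symmetries.Finite := by
  refine (((Set.finite_Icc 1 P.N).image P.rot).union
    ((Set.finite_Icc 1 P.N).image P.refl)).subset fun g hg => ?_
  obtain ⟨k, hk, rfl | rfl⟩ := P.exists_eq_rot_or_refl (P.image_body_of_mem hg)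
  · exact Or.inl ⟨k, hk, rfl⟩
  · exact Or.inr ⟨k, hk, rfl⟩

theorem symm_refl : IsometryEquiv.refl ℂ ∈ P.symmetries :=
  P.mem_symmetries_iff.2 (Set.image_id _)

theorem symm_trans {g h : ℂ ≃ᵢ ℂ} (hg : g ∈ P.symmetries) (hh : h ∈ P.symmetries) :
    g.trans h ∈ P.symmetries := by
  rw [mem_symmetries_iff] at *
  have h1 : ⇑(g.trans h) = h ∘ g := rfl
  rw [h1, Set.image_comp, hg, hh]

theorem symm_symm {g : ℂ ≃ᵢ ℂ} (hg : g ∈ P.symmetries) : g.symm ∈ P.symmetries := by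
  rw [mem_symmetries_iff] at *
  nth_rw 1 [← hg]
  rw [← Set.image_comp]; simp

end UnitPolygon

namespace PolygonIFS

variable {S : Type*} [Fintype S] (F : PolygonIFS S)

/-! ### Words and similarities -/

theorem ρw_nil : F.ρw [] = 1 := rfl

theorem ρw_cons (i : S) (w : List S) : F.ρw (i :: w) = F.ρ i * F.ρw w := by simp [ρw]

theorem ρw_append (u v : List S) : F.ρw (u ++ v) = F.ρw u * F.ρw v := by simp [ρw]

theorem ρw_pos (w : List S) : 0 < F.ρw w := by
  induction w with
  | nil => exact one_pos
  | cons i w ih => rw [ρw_cons]; exact mul_pos (F.ρ_pos i) ih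

theorem ρw_le_one (w : List S) : F.ρw w ≤ 1 := by
  induction w with
  | nil => exact le_rfl
  | cons i w ih => rw [ρw_cons]; exact mul_le_one₀ (F.ρ_lt_one i).le (F.ρw_pos w).le ih

theorem ρmin_le (i : S) : F.ρmin ≤ F.ρ i := ciInf_le (Set.finite_range F.ρ).bddBelow i

theorem ρmin_pos : 0 < F.ρmin := by
  have := F.nonempty_index
  obtain ⟨i, hi⟩ := exists_eq_ciInf_of_finite (f := F.ρ)
  have h : F.ρmin = F.ρ i := hi.symm
  rw [h]; exact F.ρ_pos i

theorem ρmin_lt_one : F.ρmin < 1 := by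
  obtain ⟨i⟩ := F.nonempty_index
  exact (F.ρmin_le i).trans_lt (F.ρ_lt_one i)

/-- `Ψ_i` as a homeomorphism of the plane. -/
def ψ (i : S) : ℂ ≃ₜ ℂ where
  toFun := F.Ψ i
  invFun z := ((F.sgn i : ℤ) : ℂ) * (F.ρ i : ℂ)⁻¹ * (z - F.shift i)
  left_inv z := by
    have h := (F.ρ_pos i).ne'
    have h' : (F.ρ i : ℂ) ≠ 0 := by exact_mod_cast h
    unfold Ψ
    rcases Int.units_eq_one_or (F.sgn i) with h | h <;> simp [h] <;> field_simp
  right_inv z := by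
    have h := (F.ρ_pos i).ne'
    have h' : (F.ρ i : ℂ) ≠ 0 := by exact_mod_cast h
    unfold Ψ
    rcases Int.units_eq_one_or (F.sgn i) with h | h <;> simp [h] <;> field_simp <;> ring
  continuous_toFun := F.continuous_Ψ i
  continuous_invFun := by fun_prop

theorem coe_ψ (i : S) : ⇑(F.ψ i) = F.Ψ i := rfl

/-- `Ψ_w` as a homeomorphism of the plane. -/
def ψw : List S → ℂ ≃ₜ ℂ
  | [] => Homeomorph.refl ℂ
  | i :: w => (ψw w).trans (F.ψ i)

theorem coe_ψw (w : List S) : ⇑(F.ψw w) = F.Ψw w := by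
  induction w with
  | nil => rfl
  | cons i w ih =>
    have h : ⇑(F.ψw (i :: w)) = F.Ψ i ∘ ⇑(F.ψw w) := rfl
    rw [h, ih]; rfl

theorem Ψw_nil : F.Ψw [] = id := rfl

theorem Ψw_cons (i : S) (w : List S) : F.Ψw (i :: w) = F.Ψ i ∘ F.Ψw w := rfl

theorem Ψw_append (u v : List S) : F.Ψw (u ++ v) = F.Ψw u ∘ F.Ψw v := by
  induction u with
  | nil => rfl
  | cons i u ih => rw [List.cons_append, Ψw_cons, ih, Ψw_cons]; rfl

theorem Ψw_singleton (i : S) : F.Ψw [i] = F.Ψ i := rfl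

theorem continuous_Ψw (w : List S) : Continuous (F.Ψw w) := by
  rw [← coe_ψw]; exact (F.ψw w).continuous

theorem dist_Ψw (w : List S) (x y : ℂ) : dist (F.Ψw w x) (F.Ψw w y) = F.ρw w * dist x y := by
  induction w with
  | nil => simp [Ψw_nil, ρw_nil]
  | cons i w ih =>
    rw [Ψw_cons, Function.comp_apply, Function.comp_apply, dist_Ψ, ih, ρw_cons, mul_assoc]

theorem Ψ_comb (i : S) {a b : ℝ} (hab : a + b = 1) (x y : ℂ) :
    F.Ψ i (a • x + b • y) = a • F.Ψ i x + b • F.Ψ i y := by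
  have h : (a : ℂ) + b = 1 := by exact_mod_cast hab
  unfold Ψ
  simp only [Complex.real_smul]
  linear_combination (-F.shift i) * h

theorem Ψw_comb (w : List S) {a b : ℝ} (hab : a + b = 1) (x y : ℂ) :
    F.Ψw w (a • x + b • y) = a • F.Ψw w x + b • F.Ψw w y := by
  induction w with
  | nil => rfl
  | cons i w ih =>
    simp only [Ψw_cons, Function.comp_apply]
    rw [ih, F.Ψ_comb i hab]

theorem Ψ_mem_body (i : S) {z : ℂ} (hz : z ∈ F.poly.body) : F.Ψ i z ∈ F.poly.body :=
  F.maps_body i z hz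

theorem Ψw_mem_body (w : List S) {z : ℂ} (hz : z ∈ F.poly.body) : F.Ψw w z ∈ F.poly.body := by
  induction w with
  | nil => exact hz
  | cons i w ih => exact F.Ψ_mem_body i ih

theorem image_interior_Ψw (w : List S) (X : Set ℂ) :
    F.Ψw w '' interior X = interior (F.Ψw w '' X) := by
  rw [← coe_ψw]; exact (F.ψw w).image_interior X

theorem image_closure_Ψw (w : List S) (X : Set ℂ) :
    F.Ψw w '' closure X = closure (F.Ψw w '' X) := by
  rw [← coe_ψw]; exact (F.ψw w).image_closure X

theorem Ψw_mem_interior (w : List S) {z : ℂ} (hz : z ∈ interior F.poly.body) :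
    F.Ψw w z ∈ interior F.poly.body := by
  have h : F.Ψw w z ∈ interior (F.Ψw w '' F.poly.body) := by
    rw [← image_interior_Ψw]; exact ⟨z, hz, rfl⟩
  refine interior_mono ?_ h
  rintro _ ⟨y, hy, rfl⟩
  exact F.Ψw_mem_body w hy

theorem Ψ_mem_interior (i : S) {z : ℂ} (hz : z ∈ interior F.poly.body) :
    F.Ψ i z ∈ interior F.poly.body := F.Ψw_mem_interior [i] hz

theorem mem_bdry_of_Ψ_mem_bdry (i : S) {z : ℂ} (hz : z ∈ F.poly.body)
    (h : F.Ψ i z ∈ F.poly.bdry) : z ∈ F.poly.bdry := by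
  rw [UnitPolygon.bdry_eq] at h ⊢
  exact ⟨hz, fun hi => h.2 (F.Ψ_mem_interior i hi)⟩

/-! ### The attractor -/

/-- A bounded set covered by its images lies in every closed non-empty set which contains its own
images. -/
theorem subset_of_subset_iUnion {X Y : Set ℂ} (hX : Bornology.IsBounded X)
    (hXf : X ⊆ ⋃ i, F.Ψ i '' X) (hY : IsClosed Y) (hYn : Y.Nonempty)
    (hYf : ∀ i, ∀ y ∈ Y, F.Ψ i y ∈ Y) : X ⊆ Y := by
  obtain ⟨r, hr0, hr1, hr⟩ := F.exists_ratio_bound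
  obtain ⟨y₀, hy₀⟩ := hYn
  obtain ⟨D, hD⟩ := hX.subset_closedBall y₀
  have hap : ∀ n : ℕ, ∀ x ∈ X, ∃ y ∈ Y, dist x y ≤ r ^ n * D := by
    intro n
    induction n with
    | zero => intro x hx; exact ⟨y₀, hy₀, by simpa using hD hx⟩
    | succ n ih =>
      intro x hx
      obtain ⟨i, x', hx', rfl⟩ := Set.mem_iUnion.1 (hXf hx)
      obtain ⟨y', hy', hd⟩ := ih x' hx'
      refine ⟨F.Ψ i y', hYf i _ hy', ?_⟩
      rw [F.dist_Ψ, pow_succ', mul_assoc]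
      exact mul_le_mul (hr i) hd dist_nonneg hr0.le
  intro x hx
  rw [← hY.closure_eq]
  refine Metric.mem_closure_iff.2 fun ε hε => ?_
  have ht : Filter.Tendsto (fun n : ℕ => r ^ n * D) Filter.atTop (nhds 0) := by
    simpa using (tendsto_pow_atTop_nhds_zero_of_lt_one hr0.le hr1).mul_const D
  obtain ⟨n, hn⟩ := (ht.eventually (gt_mem_nhds hε)).exists
  obtain ⟨y, hy, hd⟩ := hap n x hx
  exact ⟨y, hy, lt_of_le_of_lt hd hn⟩

theorem isCompact_K : IsCompact F.K := F.K_spec.1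

theorem K_nonempty : F.K.Nonempty := F.K_spec.2.1

theorem K_eq : F.K = ⋃ i, F.Ψ i '' F.K := F.K_spec.2.2

theorem Ψ_mem_K (i : S) {z : ℂ} (hz : z ∈ F.K) : F.Ψ i z ∈ F.K := by
  rw [K_eq]; exact Set.mem_iUnion.2 ⟨i, z, hz, rfl⟩

theorem Ψw_mem_K (w : List S) {z : ℂ} (hz : z ∈ F.K) : F.Ψw w z ∈ F.K := by
  induction w with
  | nil => exact hz
  | cons i w ih => exact F.Ψ_mem_K i ih

theorem K_subset_body : F.K ⊆ F.poly.body :=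
  F.subset_of_subset_iUnion F.isCompact_K.isBounded F.K_eq.subset F.poly.isCompact_body.isClosed
    ⟨_, F.poly.ctr_mem_body⟩ fun i _ hy => F.Ψ_mem_body i hy

theorem subset_K {X : Set ℂ} (hX : Bornology.IsBounded X) (hXf : X ⊆ ⋃ i, F.Ψ i '' X) :
    X ⊆ F.K :=
  F.subset_of_subset_iUnion hX hXf F.isCompact_K.isClosed F.K_nonempty fun i _ hy => F.Ψ_mem_K i hy

theorem exists_Ψ_of_mem_bdry (hF : F.IsBorderedCarpet) {z : ℂ} (hz : z ∈ F.poly.bdry) :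
    ∃ i, ∃ y ∈ F.poly.bdry, F.Ψ i y = z := by
  obtain ⟨i, y, hy, rfl⟩ := Set.mem_iUnion.1 (hF.bordered hz)
  exact ⟨i, y, F.mem_bdry_of_Ψ_mem_bdry i hy hz, rfl⟩

theorem bdry_subset_K (hF : F.IsBorderedCarpet) : F.poly.bdry ⊆ F.K := by
  refine F.subset_K F.poly.isCompact_bdry.isBounded fun z hz => ?_
  obtain ⟨i, y, hy, rfl⟩ := F.exists_Ψ_of_mem_bdry hF hz
  exact Set.mem_iUnion.2 ⟨i, y, hy, rfl⟩

theorem cell_nil : F.cell [] = F.K := by simp [cell, Ψw_nil]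

theorem cell_append (u v : List S) : F.cell (u ++ v) = F.Ψw u '' F.cell v := by
  rw [cell, cell, Ψw_append, Set.image_comp]

theorem cell_append_subset (u v : List S) : F.cell (u ++ v) ⊆ F.cell u := by
  rw [cell_append]
  refine Set.image_mono ?_
  rintro _ ⟨z, hz, rfl⟩
  exact F.Ψw_mem_K v hz

theorem cell_subset_of_prefix {u w : List S} (h : u <+: w) : F.cell w ⊆ F.cell u := by
  obtain ⟨v, rfl⟩ := h
  exact F.cell_append_subset u v

theorem cell_nonempty (w : List S) : (F.cell w).Nonempty := F.K_nonempty.image _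

theorem isCompact_cell (w : List S) : IsCompact (F.cell w) :=
  F.isCompact_K.image (F.continuous_Ψw w)

theorem cell_subset_body (w : List S) : F.cell w ⊆ F.Ψw w '' F.poly.body :=
  Set.image_mono F.K_subset_body

theorem image_bdry_subset_cell (hF : F.IsBorderedCarpet) (w : List S) :
    F.Ψw w '' F.poly.bdry ⊆ F.cell w := Set.image_mono (F.bdry_subset_K hF)

/-! ### Cuts: the partitions at an arbitrary scale -/

/-- `IsCut s w` says that `w` is the shortest prefix of itself with `ρ_w ≤ s`. -/
def IsCut : ℝ → List S → Prop
  | s, [] => 1 ≤ s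
  | s, i :: w => s < 1 ∧ IsCut (s / F.ρ i) w

open scoped Classical in
/-- The shortest prefix of a word with ratio at most `s`, or the whole word if there is none. -/
def tr : ℝ → List S → List S
  | _, [] => []
  | s, i :: w => if 1 ≤ s then [] else i :: tr (s / F.ρ i) w

theorem isCut_nil {s : ℝ} : F.IsCut s [] ↔ 1 ≤ s := Iff.rfl

theorem isCut_cons {s : ℝ} {i : S} {w : List S} :
    F.IsCut s (i :: w) ↔ s < 1 ∧ F.IsCut (s / F.ρ i) w := Iff.rfl

theorem IsCut.le {s : ℝ} {w : List S} (h : F.IsCut s w) : F.ρw w ≤ s := by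
  induction w generalizing s with
  | nil => exact h
  | cons i w ih =>
    have := ih h.2
    rw [le_div_iff₀ (F.ρ_pos i)] at this
    rw [ρw_cons]; linarith

/-- The stopping words have ratio comparable with the scale. The condition on `s` only matters for
the empty word, which is the stopping word at every scale `s ≥ 1`. -/
theorem IsCut.ge {s : ℝ} {w : List S} (h : F.IsCut s w) (hs : F.ρmin * s ≤ 1) :
    F.ρmin * s ≤ F.ρw w := by
  induction w generalizing s with
  | nil => exact hs
  | cons i w ih =>
    have hi := F.ρ_pos i
    have h1 : F.ρmin * (s / F.ρ i) ≤ 1 := by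
      rw [← mul_div_assoc, div_le_one hi]
      have := F.ρmin_le i
      have := F.ρmin_pos
      nlinarith [h.1]
    have := ih h.2 h1
    rw [← mul_div_assoc, div_le_iff₀ hi] at this
    rw [ρw_cons]; linarith

theorem IsCut.length_le {r : ℝ} (hr0 : 0 < r) (hr : ∀ i, F.ρ i ≤ r) {n : ℕ} {s : ℝ} {w : List S}
    (h : F.IsCut s w) (hs : r ^ n ≤ s) : w.length ≤ n := by
  induction n generalizing s w with
  | zero =>
    cases w with
    | nil => simp
    | cons i w => have := h.1; simp at hs; linarith
  | succ n ih =>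
    cases w with
    | nil => simp
    | cons i w =>
      have h2 := ih h.2 (by
        rw [le_div_iff₀ (F.ρ_pos i)]
        have : r ^ n * F.ρ i ≤ r ^ n * r := mul_le_mul_of_nonneg_left (hr i) (by positivity)
        rw [pow_succ] at hs; linarith)
      simpa using h2

theorem IsCut.pos {s : ℝ} {w : List S} (h : F.IsCut s w) : 0 < s :=
  (F.ρw_pos w).trans_le h.le

theorem finite_isCut (s : ℝ) : {w | F.IsCut s w}.Finite := by
  rcases le_or_gt s 0 with hs | hs
  · convert Set.finite_empty
    ext w
    simp only [Set.mem_ofPred_eq, Set.mem_empty_iff_false, iff_false]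
    intro h; exact absurd (IsCut.pos F h) (not_lt.2 hs)
  · obtain ⟨r, hr0, hr1, hr⟩ := F.exists_ratio_bound
    obtain ⟨n, hn⟩ := exists_pow_lt_of_lt_one hs hr1
    refine (List.finite_length_le S n).subset fun w hw => ?_
    exact IsCut.length_le F hr0 hr hw hn.le

/-- The partition of `K` into cells of size comparable with `s`: the stopping words at scale `s`. -/
def cut (s : ℝ) : Finset (List S) := (F.finite_isCut s).toFinset

theorem mem_cut {s : ℝ} {w : List S} : w ∈ F.cut s ↔ F.IsCut s w := by simp [cut]

theorem isCut_append_iff {s : ℝ} {u v : List S} (hs : s ≤ F.ρw u) :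
    F.IsCut s (u ++ v) ↔ F.IsCut (s / F.ρw u) v := by
  induction u generalizing s with
  | nil => simp [ρw_nil]
  | cons i u ih =>
    have hi := F.ρ_pos i
    rw [ρw_cons] at hs
    have h1 : s < 1 := by
      have := F.ρ_lt_one i
      have := F.ρw_le_one u
      nlinarith
    have h2 : s / F.ρ i ≤ F.ρw u := by rw [div_le_iff₀ hi]; linarith
    rw [List.cons_append, isCut_cons, ih h2, ρw_cons, div_div]
    simp [h1]

theorem IsCut.of_append {s : ℝ} {u v : List S} (h : F.IsCut s (u ++ v)) :
    F.IsCut (s / F.ρw u) v := by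
  induction u generalizing s with
  | nil => simpa [ρw_nil] using h
  | cons i u ih => rw [ρw_cons, ← div_div]; exact ih h.2

theorem tr_prefix (s : ℝ) (w : List S) : F.tr s w <+: w := by
  induction w generalizing s with
  | nil => exact List.prefix_rfl
  | cons i w ih =>
    rw [tr]; split_ifs
    · exact List.nil_prefix
    · exact List.cons_prefix_cons.2 ⟨rfl, ih _⟩

theorem isCut_tr {s : ℝ} {w : List S} (h : F.ρw w ≤ s) : F.IsCut s (F.tr s w) := by
  induction w generalizing s with
  | nil => exact h
  | cons i w ih =>
    rw [tr]; split_ifs with h1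
    · exact h1
    · refine ⟨not_le.1 h1, ih ?_⟩
      rw [le_div_iff₀ (F.ρ_pos i)]
      rw [ρw_cons] at h; linarith

theorem tr_append_of_isCut {s : ℝ} {w : List S} (h : F.IsCut s w) (v : List S) :
    F.tr s (w ++ v) = w := by
  induction w generalizing s with
  | nil => cases v with
    | nil => rfl
    | cons i v => exact if_pos h
  | cons i w ih =>
    rw [List.cons_append, tr, if_neg (not_le.2 h.1), ih h.2]

theorem tr_append {s : ℝ} {u v : List S} (hs : s ≤ F.ρw u) :
    F.tr s (u ++ v) = u ++ F.tr (s / F.ρw u) v := by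
  induction u generalizing s with
  | nil => simp [ρw_nil]
  | cons i u ih =>
    have hi := F.ρ_pos i
    rw [ρw_cons] at hs
    have h1 : s < 1 := by
      have := F.ρ_lt_one i
      have := F.ρw_le_one u
      nlinarith
    rw [List.cons_append, tr, if_neg (not_le.2 h1), ih (by rw [div_le_iff₀ hi]; linarith),
      ρw_cons, div_div, List.cons_append]

theorem exists_isCut_of_mem_K {s : ℝ} (hs : 0 < s) {x : ℂ} (hx : x ∈ F.K) :
    ∃ w, F.IsCut s w ∧ x ∈ F.cell w := by
  obtain ⟨r, hr0, hr1, hr⟩ := F.exists_ratio_bound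
  obtain ⟨n, hn⟩ := exists_pow_lt_of_lt_one hs hr1
  replace hn := hn.le
  clear hs
  induction n generalizing s x with
  | zero => exact ⟨[], by simpa [isCut_nil] using hn, by rwa [cell_nil]⟩
  | succ n ih =>
    rcases le_or_gt 1 s with h1 | h1
    · exact ⟨[], h1, by rwa [cell_nil]⟩
    rw [K_eq] at hx
    obtain ⟨i, y, hy, rfl⟩ := Set.mem_iUnion.1 hx
    obtain ⟨w, hw, hyw⟩ := ih hy (s := s / F.ρ i) (by
      rw [le_div_iff₀ (F.ρ_pos i)]
      have : r ^ n * F.ρ i ≤ r ^ n * r := mul_le_mul_of_nonneg_left (hr i) (by positivity)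
      rw [pow_succ] at hn; linarith)
    refine ⟨i :: w, ⟨h1, hw⟩, ?_⟩
    have := F.cell_append [i] w
    rw [List.singleton_append] at this
    rw [this]; exact ⟨y, hyw, rfl⟩

theorem exists_isCut_of_mem_cell {s : ℝ} (hs : 0 < s) {u : List S} {x : ℂ} (hx : x ∈ F.cell u) :
    ∃ v, F.IsCut (s / F.ρw u) v ∧ x ∈ F.cell (u ++ v) := by
  obtain ⟨y, hy, rfl⟩ := hx
  obtain ⟨v, hv, hyv⟩ := F.exists_isCut_of_mem_K (div_pos hs (F.ρw_pos u)) hy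
  exact ⟨v, hv, by rw [cell_append]; exact ⟨y, hyv, rfl⟩⟩

theorem isCut_iff {s : ℝ} {w : List S} :
    F.IsCut s w ↔ F.ρw w ≤ s ∧ (w = [] ∨ s < F.ρw w.dropLast) := by
  induction w generalizing s with
  | nil => simp [isCut_nil, ρw_nil]
  | cons i w ih =>
    have hi := F.ρ_pos i
    rw [isCut_cons, ih, ρw_cons, le_div_iff₀ hi, mul_comm (F.ρw w)]
    rcases w with _ | ⟨j, w⟩
    · simp [ρw_nil]; tauto
    · rw [List.dropLast_cons_cons, ρw_cons F i, div_lt_iff₀ hi, mul_comm (F.ρw _) (F.ρ i)]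
      simp only [reduceCtorEq, false_or]
      constructor
      · rintro ⟨-, h⟩; exact h
      · rintro ⟨h1, h2⟩
        refine ⟨h2.trans ?_, h1, h2⟩
        have := F.ρ_lt_one i
        have := F.ρw_le_one (j :: w).dropLast
        have := F.ρw_pos (j :: w).dropLast
        nlinarith

theorem Λ_eq_cut {m : ℕ} (hm : 1 ≤ m) : F.Λ m = F.cut (F.ρmin ^ m) := by
  ext w
  rw [mem_cut, isCut_iff]
  have h1 : F.ρmin ^ m < 1 := pow_lt_one₀ F.ρmin_pos.le F.ρmin_lt_one (by omega)
  simp only [Λ, Set.Finite.mem_toFinset, wordSet, if_neg (show m ≠ 0 by omega)]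
  refine and_congr_right fun h => ?_
  rcases eq_or_ne w [] with rfl | hw
  · rw [ρw_nil] at h; linarith
  · simp [hw]

/-! ### The open set condition -/

theorem disjoint_interior (hF : F.IsBorderedCarpet) {i j : S} (hij : i ≠ j) :
    Disjoint (F.Ψ i '' interior F.poly.body) (F.Ψ j '' interior F.poly.body) := by
  rw [← F.poly.inside_eq]; exact hF.open_set i j hij

/-- Different stopping words at one scale have no common extension, so the open set condition
separates their polygons. -/
theorem disjoint_interior_cut (hF : F.IsBorderedCarpet) {s : ℝ} {w v : List S}
    (hw : F.IsCut s w) (hv : F.IsCut s v) (hwv : w ≠ v) :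
    Disjoint (F.Ψw w '' interior F.poly.body) (F.Ψw v '' interior F.poly.body) := by
  induction w generalizing s v with
  | nil =>
    cases v with
    | nil => exact absurd rfl hwv
    | cons j v => exact absurd hv.1 (not_lt.2 hw)
  | cons i w ih =>
    cases v with
    | nil => exact absurd hw.1 (not_lt.2 hv)
    | cons j v =>
      rw [Ψw_cons, Ψw_cons, Set.image_comp, Set.image_comp]
      rcases eq_or_ne i j with rfl | hij
      · exact (Set.disjoint_image_iff (F.injective_Ψ i)).2
          (ih hw.2 hv.2 fun h => hwv (by rw [h]))
      · refine (F.disjoint_interior hF hij).mono (Set.image_mono ?_) (Set.image_mono ?_)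
        · rintro _ ⟨z, hz, rfl⟩; exact F.Ψw_mem_interior w hz
        · rintro _ ⟨z, hz, rfl⟩; exact F.Ψw_mem_interior v hz

theorem closure_interior_body : closure (interior F.poly.body) = F.poly.body := by
  rw [F.poly.convex_body.closure_interior_eq_closure_of_nonempty_interior
    ⟨_, F.poly.ctr_mem_interior⟩, F.poly.isCompact_body.isClosed.closure_eq]

/-- Two polygons with disjoint interiors meet only along their boundaries. -/
theorem mem_image_bdry_of_disjoint {w v : List S}
    (h : Disjoint (F.Ψw w '' interior F.poly.body) (F.Ψw v '' interior F.poly.body)) {x : ℂ}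
    (hx : x ∈ F.Ψw w '' F.poly.body) (hx' : x ∈ F.Ψw v '' F.poly.body) :
    x ∈ F.Ψw w '' F.poly.bdry := by
  obtain ⟨y, hy, rfl⟩ := hx
  refine ⟨y, ?_, rfl⟩
  rw [UnitPolygon.bdry_eq]
  refine ⟨hy, fun hyi => ?_⟩
  rw [← F.closure_interior_body, image_closure_Ψw] at hx'
  have ho : IsOpen (F.Ψw w '' interior F.poly.body) := by
    rw [image_interior_Ψw]; exact isOpen_interior
  obtain ⟨z, hz1, hz2⟩ := mem_closure_iff.1 hx' _ ho ⟨y, hyi, rfl⟩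
  exact Set.disjoint_left.1 h hz1 hz2

theorem mem_image_bdry_of_ne (hF : F.IsBorderedCarpet) {i j : S} (hij : i ≠ j) {x : ℂ}
    (hx : x ∈ F.Ψ i '' F.poly.body) (hx' : x ∈ F.Ψ j '' F.poly.body) :
    x ∈ F.Ψ i '' F.poly.bdry :=
  F.mem_image_bdry_of_disjoint (w := [i]) (v := [j]) (F.disjoint_interior hF hij) hx hx'

/-! ### The action of the dihedral group on words -/

/-- A symmetry of the polygon carries a first-level cell to a first-level cell of the same size. -/
theorem exists_symm_Ψ (hF : F.IsBorderedCarpet) {g : ℂ ≃ᵢ ℂ} (hg : g ∈ F.poly.symmetries) (i : S) :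
    ∃ j, ∃ h ∈ F.poly.symmetries, F.ρ j = F.ρ i ∧ (∀ z, F.Ψ j (h z) = g (F.Ψ i z)) ∧
      g '' (F.Ψ i '' F.poly.body) = F.Ψ j '' F.poly.body := by
  obtain ⟨j, hj⟩ := hF.symm_cells g hg i
  -- the two polygons are isometric, so their diameters give equal ratios
  have hdiam : ∀ k, Metric.diam (F.Ψ k '' F.poly.body) = F.ρ k * Metric.diam F.poly.body := by
    intro k
    have hle : Metric.diam (F.Ψ k '' F.poly.body) ≤ F.ρ k * Metric.diam F.poly.body := by
      refine Metric.diam_le_of_forall_dist_le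
        (mul_nonneg (F.ρ_pos k).le Metric.diam_nonneg) ?_
      rintro _ ⟨x, hx, rfl⟩ _ ⟨y, hy, rfl⟩
      rw [dist_Ψ]
      exact mul_le_mul_of_nonneg_left
        (Metric.dist_le_diam_of_mem F.poly.isCompact_body.isBounded hx hy) (F.ρ_pos k).le
    refine le_antisymm hle ?_
    rw [mul_comm, ← le_div_iff₀ (F.ρ_pos k)]
    refine Metric.diam_le_of_forall_dist_le (div_nonneg Metric.diam_nonneg (F.ρ_pos k).le) ?_
    intro x hx y hy
    rw [le_div_iff₀ (F.ρ_pos k), mul_comm, ← dist_Ψ]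
    exact Metric.dist_le_diam_of_mem (F.poly.isCompact_body.image (F.continuous_Ψ k)).isBounded
      ⟨x, hx, rfl⟩ ⟨y, hy, rfl⟩
  have hd0 : 0 < Metric.diam F.poly.body := by
    have h1 := Metric.dist_le_diam_of_mem F.poly.isCompact_body.isBounded (F.poly.q_mem_body 1)
      (F.poly.q_mem_body 2)
    have h2 : dist (F.poly.q 1) (F.poly.q 2) = 1 := F.poly.side_length
    linarith
  have hρ : F.ρ j = F.ρ i := by
    have h1 : Metric.diam (g '' (F.Ψ i '' F.poly.body)) = Metric.diam (F.Ψ i '' F.poly.body) :=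
      g.isometry.diam_image _
    rw [hj, hdiam, hdiam] at h1
    exact mul_right_cancel₀ hd0.ne' h1
  have hρj := F.ρ_pos j
  -- the conjugate `Ψ_j⁻¹ g Ψ_i` is again a symmetry of the polygon
  let h : ℂ ≃ᵢ ℂ := IsometryEquiv.mk' (fun z => (F.ψ j).symm (g (F.Ψ i z)))
    (fun z => (F.ψ i).symm (g.symm (F.Ψ j z)))
    (fun z => by
      have : F.Ψ i ((F.ψ i).symm (g.symm (F.Ψ j z))) = g.symm (F.Ψ j z) :=
        (F.ψ i).apply_symm_apply _
      rw [this, g.apply_symm_apply]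
      exact (F.ψ j).symm_apply_apply z)
    (Isometry.of_dist_eq fun x y => by
      have h1 := F.dist_Ψ j ((F.ψ j).symm (g (F.Ψ i x))) ((F.ψ j).symm (g (F.Ψ i y)))
      rw [← coe_ψ, (F.ψ j).apply_symm_apply, (F.ψ j).apply_symm_apply, g.dist_eq, dist_Ψ, hρ] at h1
      exact (mul_left_cancel₀ (F.ρ_pos i).ne' h1).symm)
  have hh : ∀ z, F.Ψ j (h z) = g (F.Ψ i z) := fun z => (F.ψ j).apply_symm_apply _
  refine ⟨j, h, ?_, hρ, hh, hj⟩
  rw [UnitPolygon.mem_symmetries_iff]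
  apply (F.injective_Ψ j).image_injective
  rw [← hj, ← Set.image_comp, ← Set.image_comp]
  congr 1
  ext z; exact hh z

/-- The union of the images of `K` under the symmetries is covered by its own images under the maps
`Ψ_i`, so it lies in the attractor. -/
theorem image_K_of_mem (hF : F.IsBorderedCarpet) {g : ℂ ≃ᵢ ℂ} (hg : g ∈ F.poly.symmetries) :
    g '' F.K = F.K := by
  set X : Set ℂ := ⋃ g ∈ F.poly.symmetries, g '' F.K with hX
  have hXK : X ⊆ F.K := by
    apply F.subset_K
    · refine F.poly.isCompact_body.isBounded.subset ?_
      simp only [hX, Set.iUnion_subset_iff]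
      intro g hg
      rw [← F.poly.image_body_of_mem hg]
      exact Set.image_mono F.K_subset_body
    · simp only [hX, Set.iUnion_subset_iff]
      rintro g hg _ ⟨z, hz, rfl⟩
      rw [K_eq] at hz
      obtain ⟨i, y, hy, rfl⟩ := Set.mem_iUnion.1 hz
      obtain ⟨j, h, hh, -, hjh, -⟩ := F.exists_symm_Ψ hF hg i
      rw [← hjh]
      refine Set.mem_iUnion.2 ⟨j, h y, ?_, rfl⟩
      exact Set.mem_biUnion hh ⟨y, hy, rfl⟩
  have hsub : ∀ g ∈ F.poly.symmetries, g '' F.K ⊆ F.K := fun g hg =>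
    (Set.subset_biUnion_of_mem (u := fun g : ℂ ≃ᵢ ℂ => g '' F.K) hg).trans hXK
  refine Set.Subset.antisymm (hsub g hg) fun z hz => ?_
  exact ⟨g.symm z, hsub _ (F.poly.symm_symm hg) ⟨z, hz, rfl⟩, g.apply_symm_apply z⟩

/-- A symmetry carries the cell of `w` onto the cell of a word with the same ratios letter by letter,
up to a symmetry inside the cell. -/
theorem exists_symm_Ψw (hF : F.IsBorderedCarpet) {g : ℂ ≃ᵢ ℂ} (hg : g ∈ F.poly.symmetries)
    (w : List S) : ∃ v, ∃ h ∈ F.poly.symmetries, (∀ s, F.IsCut s w → F.IsCut s v) ∧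
      ∀ z, F.Ψw v (h z) = g (F.Ψw w z) := by
  induction w generalizing g with
  | nil => exact ⟨[], g, hg, fun _ h => h, fun _ => rfl⟩
  | cons i w ih =>
    obtain ⟨j, h, hh, hρ, hj, -⟩ := F.exists_symm_Ψ hF hg i
    obtain ⟨v, h', hh', hcut, hv⟩ := ih hh
    refine ⟨j :: v, h', hh', fun s hs => ⟨hs.1, ?_⟩, fun z => ?_⟩
    · rw [hρ]; exact hcut _ hs.2
    · simp only [Ψw_cons, Function.comp_apply]
      rw [hv, hj]

/-- For a stopping word `w` and a symmetry `g` there is a stopping word whose cell is the image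
under `g` of the cell of `w`. -/
theorem exists_act (hF : F.IsBorderedCarpet) {g : ℂ ≃ᵢ ℂ} (hg : g ∈ F.poly.symmetries)
    (w : List S) : ∃ v, (∀ s, F.IsCut s w → F.IsCut s v) ∧
      (∀ X : Set ℂ, (∀ h ∈ F.poly.symmetries, h '' X = X) → F.Ψw v '' X = g '' (F.Ψw w '' X)) := by
  obtain ⟨v, h, hh, hcut, hv⟩ := F.exists_symm_Ψw hF hg w
  refine ⟨v, hcut, fun X hX => ?_⟩
  nth_rw 1 [← hX h hh]
  rw [← Set.image_comp, ← Set.image_comp]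
  congr 1
  ext z; exact hv z

theorem eq_of_image_body_eq (hF : F.IsBorderedCarpet) {s : ℝ} {w v : List S}
    (hw : F.IsCut s w) (hv : F.IsCut s v)
    (h : F.Ψw w '' F.poly.body = F.Ψw v '' F.poly.body) : w = v := by
  by_contra hne
  have h1 := F.disjoint_interior_cut hF hw hv hne
  rw [image_interior_Ψw, image_interior_Ψw, h, ← image_interior_Ψw, disjoint_self] at h1
  have : F.Ψw v F.poly.ctr ∈ F.Ψw v '' interior F.poly.body := ⟨_, F.poly.ctr_mem_interior, rfl⟩
  rw [h1] at this
  exact this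

open scoped Classical in
/-- The action of the symmetries of the polygon on words: on a stopping word it is determined by
`cell (act g w) = g '' cell w`, see `cell_act`. An isometry that is not a symmetry fixes all
words. -/
def act (hF : F.IsBorderedCarpet) (g : ℂ ≃ᵢ ℂ) (w : List S) : List S :=
  if hg : g ∈ F.poly.symmetries then (F.exists_act hF hg w).choose else w

variable {F}

theorem isCut_act (hF : F.IsBorderedCarpet) {g : ℂ ≃ᵢ ℂ} {s : ℝ} {w : List S}
    (hw : F.IsCut s w) : F.IsCut s (F.act hF g w) := by
  unfold act
  split_ifs with hg
  · exact (F.exists_act hF hg w).choose_spec.1 s hw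
  · exact hw

theorem act_mem_cut (hF : F.IsBorderedCarpet) {g : ℂ ≃ᵢ ℂ} {s : ℝ} {w : List S}
    (hw : w ∈ F.cut s) : F.act hF g w ∈ F.cut s :=
  F.mem_cut.2 (isCut_act hF (F.mem_cut.1 hw))

theorem image_act (hF : F.IsBorderedCarpet) {g : ℂ ≃ᵢ ℂ} (hg : g ∈ F.poly.symmetries)
    (w : List S) {X : Set ℂ} (hX : ∀ h ∈ F.poly.symmetries, h '' X = X) :
    F.Ψw (F.act hF g w) '' X = g '' (F.Ψw w '' X) := by
  unfold act
  rw [dif_pos hg]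
  exact (F.exists_act hF hg w).choose_spec.2 X hX

theorem cell_act (hF : F.IsBorderedCarpet) {g : ℂ ≃ᵢ ℂ} (hg : g ∈ F.poly.symmetries)
    (w : List S) : F.cell (F.act hF g w) = g '' F.cell w :=
  image_act hF hg w fun _ hh => F.image_K_of_mem hF hh

theorem image_body_act (hF : F.IsBorderedCarpet) {g : ℂ ≃ᵢ ℂ} (hg : g ∈ F.poly.symmetries)
    (w : List S) : F.Ψw (F.act hF g w) '' F.poly.body = g '' (F.Ψw w '' F.poly.body) :=
  image_act hF hg w fun _ hh => F.poly.image_body_of_mem hh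

theorem act_inj (hF : F.IsBorderedCarpet) {g : ℂ ≃ᵢ ℂ} (hg : g ∈ F.poly.symmetries) {s : ℝ}
    {w v : List S} (hw : F.IsCut s w) (hv : F.IsCut s v)
    (h : F.act hF g w = F.act hF g v) : w = v := by
  refine F.eq_of_image_body_eq hF hw hv (g.injective.image_injective ?_)
  rw [← image_body_act hF hg, ← image_body_act hF hg, h]

end PolygonIFS

namespace PolygonIFS

variable {S : Type*} [Fintype S] (F : PolygonIFS S)

/-! ### Counting cells -/

/-- The centre of the polygon `Ψ_w 𝒜`. -/
def pt (w : List S) : ℂ := F.Ψw w F.poly.ctr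

/-- The circumradius of the polygon. -/
def rad : ℝ := ‖F.poly.arm‖

theorem rad_pos : 0 < F.rad := norm_pos_iff.2 F.poly.arm_ne_zero

theorem dist_pt_le {w : List S} {x : ℂ} (hx : x ∈ F.Ψw w '' F.poly.body) :
    dist x (F.pt w) ≤ F.ρw w * F.rad := by
  obtain ⟨y, hy, rfl⟩ := hx
  rw [pt, dist_Ψw]
  exact mul_le_mul_of_nonneg_left (F.poly.body_subset_closedBall hy) (F.ρw_pos w).le

theorem pt_mem (w v : List S) : F.pt (w ++ v) ∈ F.Ψw w '' F.poly.body := by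
  rw [pt, Ψw_append]
  exact ⟨_, F.Ψw_mem_body v F.poly.ctr_mem_body, rfl⟩

theorem cut_of_one_le {s : ℝ} (hs : 1 ≤ s) : F.cut s = {[]} := by
  ext w
  rw [mem_cut, Finset.mem_singleton]
  cases w with
  | nil => simp [isCut_nil, hs]
  | cons i w => simp [isCut_cons, not_lt.2 hs]

theorem volume_real_closedBall (z : ℂ) {r : ℝ} (hr : 0 ≤ r) :
    MeasureTheory.volume.real (Metric.closedBall z r) = r ^ 2 * Real.pi := by
  rw [MeasureTheory.measureReal_def, Complex.volume_closedBall, ENNReal.toReal_mul,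
    ENNReal.toReal_pow, ENNReal.toReal_ofReal hr]
  rfl

theorem volume_real_ball (z : ℂ) {r : ℝ} (hr : 0 ≤ r) :
    MeasureTheory.volume.real (Metric.ball z r) = r ^ 2 * Real.pi := by
  rw [MeasureTheory.measureReal_def, Complex.volume_ball, ENNReal.toReal_mul,
    ENNReal.toReal_pow, ENNReal.toReal_ofReal hr]
  rfl

open scoped Classical in
/-- A disc of radius comparable with `s` meets a bounded number of cells at scale `s`. -/
theorem exists_card_le (hF : F.IsBorderedCarpet) {c : ℝ} (hc : 0 ≤ c) :
    ∃ n : ℕ, 1 ≤ n ∧ ∀ (s : ℝ) (z : ℂ),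
      ((F.cut s).filter fun w => dist (F.pt w) z ≤ c * s).card ≤ n := by
  obtain ⟨r₀, hr₀, hball⟩ := F.poly.exists_ball
  have hρ := F.ρmin_pos
  set a := r₀ * F.ρmin with ha
  have ha0 : 0 < a := mul_pos hr₀ hρ
  refine ⟨⌈((c + a) / a) ^ 2⌉₊ + 1, by omega, fun s z => ?_⟩
  -- at scales above `1 / ρ_*` there is only the empty word, whose ratio is not comparable with `s`
  rcases le_or_gt (F.ρmin * s) 1 with h1 | h1
  swap
  · have : 1 ≤ s := by have := F.ρmin_lt_one; nlinarith
    rw [F.cut_of_one_le this]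
    exact (Finset.card_filter_le _ _).trans (by simp)
  rcases le_or_gt s 0 with hs | hs
  · have : F.cut s = ∅ := by
      refine Finset.eq_empty_of_forall_notMem fun w hw => ?_
      exact absurd (IsCut.pos F (F.mem_cut.1 hw)) (not_lt.2 hs)
    simp [this]
  set A := (F.cut s).filter fun w => dist (F.pt w) z ≤ c * s with hA
  have hAs : ∀ w ∈ A, F.IsCut s w ∧ dist (F.pt w) z ≤ c * s := by
    intro w hw; rw [hA, Finset.mem_filter, mem_cut] at hw; exact hw
  -- the polygons of the cells contain disjoint discs of radius `a s`, all inside a disc of radius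
  -- `(c + a) s`: compare areas
  have hsub : ∀ w ∈ A, Metric.ball (F.pt w) (a * s) ⊆ F.Ψw w '' interior F.poly.body := by
    intro w hw x hx
    have hge := IsCut.ge F (hAs w hw).1 h1
    have h2 : F.Ψw w ((F.ψw w).symm x) = x := by
      rw [← coe_ψw]; exact (F.ψw w).apply_symm_apply x
    refine ⟨(F.ψw w).symm x, hball ?_, h2⟩
    rw [Metric.mem_ball] at hx ⊢
    rw [← h2, pt, dist_Ψw] at hx
    have hw0 := F.ρw_pos w
    have : F.ρw w * dist ((F.ψw w).symm x) F.poly.ctr < F.ρw w * r₀ := by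
      refine hx.trans_le ?_
      rw [ha, mul_assoc, mul_comm]
      exact mul_le_mul_of_nonneg_right hge hr₀.le
    exact lt_of_mul_lt_mul_left this hw0.le
  have hdisj : (A : Set (List S)).PairwiseDisjoint fun w => Metric.ball (F.pt w) (a * s) := by
    intro w hw v hv hwv
    exact (F.disjoint_interior_cut hF (hAs w hw).1 (hAs v hv).1 hwv).mono (hsub w hw) (hsub v hv)
  have hvol := MeasureTheory.measureReal_biUnion_finset (μ := MeasureTheory.volume) hdisj
    (fun w _ => measurableSet_ball) (fun w _ => MeasureTheory.measure_ball_lt_top.ne)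
  have hle : MeasureTheory.volume.real (⋃ w ∈ A, Metric.ball (F.pt w) (a * s)) ≤
      MeasureTheory.volume.real (Metric.closedBall z ((c + a) * s)) := by
    refine MeasureTheory.measureReal_mono ?_ MeasureTheory.measure_closedBall_lt_top.ne
    simp only [Set.iUnion_subset_iff]
    intro w hw x hx
    rw [Metric.mem_ball] at hx
    rw [Metric.mem_closedBall]
    have := (hAs w hw).2
    have := dist_triangle x (F.pt w) z
    linarith
  rw [hvol, volume_real_closedBall _ (by positivity)] at hle
  simp_rw [volume_real_ball _ (show 0 ≤ a * s by positivity)] at hle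
  rw [Finset.sum_const, nsmul_eq_mul] at hle
  have h3 : (A.card : ℝ) ≤ ((c + a) / a) ^ 2 := by
    rw [div_pow, le_div_iff₀ (by positivity)]
    have hp : 0 < s ^ 2 * Real.pi := by positivity
    refine le_of_mul_le_mul_right ?_ hp
    calc (A.card : ℝ) * a ^ 2 * (s ^ 2 * Real.pi) = A.card * ((a * s) ^ 2 * Real.pi) := by ring
      _ ≤ ((c + a) * s) ^ 2 * Real.pi := hle
      _ = (c + a) ^ 2 * (s ^ 2 * Real.pi) := by ring
  have h4 : (A.card : ℝ) ≤ ⌈((c + a) / a) ^ 2⌉₊ := h3.trans (Nat.le_ceil _)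
  have : A.card ≤ ⌈((c + a) / a) ^ 2⌉₊ := by exact_mod_cast h4
  omega

/-- The ratio `∑ ρ_i ^ 2` of the area of the first-level cells to that of the polygon. -/
def areaRatio : ℝ := ∑ i, F.ρ i ^ 2

theorem areaRatio_pos : 0 < F.areaRatio := by
  have := F.nonempty_index
  exact Finset.sum_pos (fun i _ => pow_pos (F.ρ_pos i) 2) Finset.univ_nonempty

open scoped Pointwise in
theorem volume_image_Ψ (i : S) (X : Set ℂ) :
    MeasureTheory.volume (F.Ψ i '' X) = ENNReal.ofReal (F.ρ i ^ 2) * MeasureTheory.volume X := by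
  have h1 : F.Ψ i '' X = F.shift i +ᵥ ((((F.sgn i : ℤ) : ℝ) * F.ρ i) • X) := by
    ext z
    simp only [Set.mem_image, Set.mem_vadd_set, Set.mem_smul_set, Complex.real_smul, vadd_eq_add,
      exists_exists_and_eq_and, Ψ]
    push_cast
    constructor <;> rintro ⟨x, hx, rfl⟩ <;> exact ⟨x, hx, by ring⟩
  rw [h1, MeasureTheory.measure_vadd, MeasureTheory.Measure.addHaar_smul,
    Complex.finrank_real_complex]
  congr 2
  rw [abs_of_nonneg (sq_nonneg _), mul_pow]
  rcases Int.units_eq_one_or (F.sgn i) with h | h <;> simp [h]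

/-- The first-level cells do not fill the polygon. -/
theorem areaRatio_lt_one (hF : F.IsBorderedCarpet) : F.areaRatio < 1 := by
  set O := interior F.poly.body with hO
  set U := ⋃ i, F.Ψ i '' F.poly.body with hU
  have hUc : IsClosed U :=
    (isCompact_iUnion fun i => F.poly.isCompact_body.image (F.continuous_Ψ i)).isClosed
  have hUb : U ⊆ F.poly.body := by
    simp only [hU, Set.iUnion_subset_iff]
    rintro i _ ⟨z, hz, rfl⟩
    exact F.Ψ_mem_body i hz
  -- the part of the interior that the cells leave out is open and not empty, so it has positive area
  have hG : (O \ U).Nonempty := by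
    by_contra hne
    rw [Set.not_nonempty_iff_eq_empty, Set.sdiff_eq_empty] at hne
    refine hF.nontrivial (Set.Subset.antisymm hUb ?_)
    have := closure_minimal hne hUc
    rwa [hO, closure_interior_body] at this
  have hGo : IsOpen (O \ U) := isOpen_interior.sdiff hUc
  have hGpos := hGo.measure_pos MeasureTheory.volume hG
  have hOo : ∀ i, IsOpen (F.Ψ i '' O) := fun i => by
    have := F.image_interior_Ψw [i] F.poly.body
    rw [Ψw_singleton] at this
    rw [hO, this]; exact isOpen_interior
  have hsum : MeasureTheory.volume (⋃ i, F.Ψ i '' O) =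
      ∑ i, ENNReal.ofReal (F.ρ i ^ 2) * MeasureTheory.volume O := by
    rw [MeasureTheory.measure_iUnion (fun i j hij => F.disjoint_interior hF hij)
      fun i => (hOo i).measurableSet, tsum_fintype]
    exact Finset.sum_congr rfl fun i _ => F.volume_image_Ψ i O
  have hle : MeasureTheory.volume (⋃ i, F.Ψ i '' O) + MeasureTheory.volume (O \ U) ≤
      MeasureTheory.volume O := by
    rw [← MeasureTheory.measure_union _ hGo.measurableSet]
    · refine MeasureTheory.measure_mono (Set.union_subset ?_ Set.sdiff_subset)
      simp only [Set.iUnion_subset_iff]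
      rintro i _ ⟨z, hz, rfl⟩
      exact F.Ψ_mem_interior i hz
    · refine Set.disjoint_left.2 fun z hz hz' => hz'.2 ?_
      obtain ⟨i, y, hy, rfl⟩ := Set.mem_iUnion.1 hz
      exact Set.mem_iUnion.2 ⟨i, y, interior_subset hy, rfl⟩
  have hfin : MeasureTheory.volume O ≠ ⊤ :=
    ((MeasureTheory.measure_mono interior_subset).trans_lt F.poly.isCompact_body.measure_lt_top).ne
  rw [hsum, ← Finset.sum_mul, ← ENNReal.ofReal_sum_of_nonneg (fun i _ => sq_nonneg _)] at hle
  by_contra hge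
  rw [not_lt] at hge
  have h1 : MeasureTheory.volume O ≤ ENNReal.ofReal F.areaRatio * MeasureTheory.volume O := by
    have : (1 : ℝ≥0∞) ≤ ENNReal.ofReal F.areaRatio := ENNReal.one_le_ofReal.2 hge
    calc MeasureTheory.volume O = 1 * MeasureTheory.volume O := (one_mul _).symm
      _ ≤ _ := mul_le_mul_left this _
  have h2 : MeasureTheory.volume O + MeasureTheory.volume (O \ U) ≤ MeasureTheory.volume O + 0 := by
    rw [add_zero]; exact (add_le_add_left h1 _).trans hle
  have h3 := (ENNReal.add_le_add_iff_left hfin).1 h2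
  exact absurd (le_antisymm h3 bot_le) hGpos.ne'

/-- A stopping word at scale `s < 1` is a letter `i` followed by a stopping word at scale `s / ρ_i`. -/
theorem sum_cut {s : ℝ} (hs : s < 1) (f : List S → ℝ) :
    ∑ w ∈ F.cut s, f w = ∑ i, ∑ v ∈ F.cut (s / F.ρ i), f (i :: v) := by
  rw [Finset.sum_sigma']
  symm
  refine Finset.sum_bij (fun p _ => p.1 :: p.2) ?_ ?_ ?_ ?_
  · rintro ⟨i, v⟩ h
    simp only [Finset.mem_sigma, Finset.mem_univ, true_and, mem_cut] at h ⊢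
    exact ⟨hs, h⟩
  · rintro ⟨i, v⟩ - ⟨j, u⟩ - h
    simp only [List.cons.injEq] at h
    obtain ⟨rfl, rfl⟩ := h
    rfl
  · intro w hw
    rw [mem_cut] at hw
    cases w with
    | nil => exact absurd hs (not_lt.2 hw)
    | cons i v => exact ⟨⟨i, v⟩, by simpa [mem_cut] using hw.2, rfl⟩
  · intros; rfl

/-- The total area of the cells at scale `s ≤ ρ_* ^ k`, in units of the area of the polygon: each of
their words has at least `k` letters, and each of the first `k` subdivisions costs a factor
`areaRatio`. -/
theorem sum_ρw_sq_le (hF : F.IsBorderedCarpet) {s : ℝ} (hs : 0 < s) {k : ℕ}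
    (hk : k = 0 ∨ s ≤ F.ρmin ^ k) : ∑ w ∈ F.cut s, F.ρw w ^ 2 ≤ F.areaRatio ^ k := by
  obtain ⟨r, hr0, hr1, hr⟩ := F.exists_ratio_bound
  obtain ⟨n, hn⟩ := exists_pow_lt_of_lt_one hs hr1
  replace hn := hn.le
  have hρ := F.ρmin_pos
  have hbase : ∀ s : ℝ, 1 ≤ s → ∀ k : ℕ, (k = 0 ∨ s ≤ F.ρmin ^ k) →
      ∑ w ∈ F.cut s, F.ρw w ^ 2 ≤ F.areaRatio ^ k := by
    intro s hs k hk
    have hk0 : k = 0 := by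
      by_contra h0
      have := pow_lt_one₀ hρ.le F.ρmin_lt_one h0
      rcases hk with h | h
      · exact h0 h
      · linarith
    rw [hk0, F.cut_of_one_le hs]; simp [ρw_nil]
  -- induction on a bound for the length of the stopping words
  induction n generalizing s k with
  | zero => exact hbase s (by simpa using hn) k hk
  | succ n ih =>
    rcases le_or_gt 1 s with h1 | h1
    · exact hbase s h1 k hk
    have key : ∀ j : ℕ, (∀ i, j = 0 ∨ s / F.ρ i ≤ F.ρmin ^ j) →
        ∑ w ∈ F.cut s, F.ρw w ^ 2 ≤ F.areaRatio * F.areaRatio ^ j := by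
      intro j hj
      rw [F.sum_cut h1, areaRatio, Finset.sum_mul]
      refine Finset.sum_le_sum fun i _ => ?_
      have hi := F.ρ_pos i
      simp_rw [ρw_cons, mul_pow]
      rw [← Finset.mul_sum]
      refine mul_le_mul_of_nonneg_left (ih (div_pos hs hi) (hj i) ?_) (sq_nonneg _)
      rw [le_div_iff₀ hi]
      have : r ^ n * F.ρ i ≤ r ^ n * r := mul_le_mul_of_nonneg_left (hr i) (by positivity)
      rw [pow_succ] at hn; linarith
    cases k with
    | zero =>
      have := key 0 fun i => Or.inl rfl
      have := F.areaRatio_lt_one hF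
      simp at *; linarith
    | succ k =>
      rw [pow_succ']
      refine key k fun i => Or.inr ?_
      have hk' : s ≤ F.ρmin ^ (k + 1) := by simpa using hk
      rw [div_le_iff₀ (F.ρ_pos i)]
      rw [pow_succ] at hk'
      exact hk'.trans (mul_le_mul_of_nonneg_left (F.ρmin_le i) (by positivity))

/-- The cells at scale `s` have area at least of the order of `s ^ 2`. -/
theorem card_cut_le (hF : F.IsBorderedCarpet) {s : ℝ} (hs : 0 < s) (hs1 : F.ρmin * s ≤ 1) {k : ℕ}
    (hk : k = 0 ∨ s ≤ F.ρmin ^ k) : (F.cut s).card * (F.ρmin * s) ^ 2 ≤ F.areaRatio ^ k := by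
  refine le_trans ?_ (F.sum_ρw_sq_le hF hs hk)
  rw [← nsmul_eq_mul, ← Finset.sum_const]
  refine Finset.sum_le_sum fun w hw => ?_
  have := IsCut.ge F (F.mem_cut.1 hw) hs1
  have := F.ρmin_pos
  gcongr

end PolygonIFS

namespace PolygonIFS

open scoped Classical

variable {S : Type*} [Fintype S] (F : PolygonIFS S)

/-! ### Energies -/

theorem Adj.symm' {w v : List S} (h : F.Adj w v) : F.Adj v w :=
  ⟨h.1.symm, by rw [Set.inter_comm]; exact h.2⟩

/-- The contribution of an ordered pair of words to (twice) the energy. -/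
def pairEnergy (f : List S → ℝ) (p : List S × List S) : ℝ :=
  if F.Adj p.1 p.2 then (f p.1 - f p.2) ^ 2 else 0

theorem pairEnergy_nonneg (f : List S → ℝ) (p : List S × List S) : 0 ≤ F.pairEnergy f p := by
  unfold pairEnergy; split_ifs <;> positivity

theorem energy_eq (A : Finset (List S)) (f : List S → ℝ) :
    F.energy A f = (1 / 2) * ∑ p ∈ A ×ˢ A, F.pairEnergy f p := by
  rw [energy, Finset.sum_product]; rfl

theorem energy_nonneg (A : Finset (List S)) (f : List S → ℝ) : 0 ≤ F.energy A f := by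
  rw [energy_eq]
  exact mul_nonneg (by norm_num) (Finset.sum_nonneg fun p _ => F.pairEnergy_nonneg f p)

theorem energy_mono {A B : Finset (List S)} (h : A ⊆ B) (f : List S → ℝ) :
    F.energy A f ≤ F.energy B f := by
  rw [energy_eq, energy_eq]
  refine mul_le_mul_of_nonneg_left ?_ (by norm_num)
  exact Finset.sum_le_sum_of_subset_of_nonneg (Finset.product_subset_product h h)
    fun p _ _ => F.pairEnergy_nonneg f p

theorem energy_smul (A : Finset (List S)) (c : ℝ) (f : List S → ℝ) :
    F.energy A (fun w => c * f w) = c ^ 2 * F.energy A f := by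
  rw [energy_eq, energy_eq, mul_left_comm]
  congr 1
  rw [Finset.mul_sum]
  refine Finset.sum_congr rfl fun p _ => ?_
  unfold pairEnergy; split_ifs <;> ring

theorem energy_le_of_le {A : Finset (List S)} {f g : List S → ℝ}
    (h : ∀ w ∈ A, ∀ v ∈ A, F.Adj w v → |f w - f v| ≤ |g w - g v|) :
    F.energy A f ≤ F.energy A g := by
  rw [energy_eq, energy_eq]
  refine mul_le_mul_of_nonneg_left (Finset.sum_le_sum fun p hp => ?_) (by norm_num)
  rw [Finset.mem_product] at hp
  unfold pairEnergy
  split_ifs with ha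
  · exact sq_le_sq.2 (h _ hp.1 _ hp.2 ha)
  · exact le_rfl

/-- A finite sum of functions: the energy form is dominated by a multiple of the sum of the
energies. -/
theorem energy_sum_abs_le {ι : Type*} (I : Finset ι) (A : Finset (List S))
    (f : ι → List S → ℝ) (c : ι → ℝ) :
    F.energy A (fun w => ∑ i ∈ I, |f i w - c i|) ≤ I.card * ∑ i ∈ I, F.energy A (f i) := by
  simp_rw [energy_eq]
  rw [← Finset.mul_sum, mul_left_comm, Finset.sum_comm]
  refine mul_le_mul_of_nonneg_left ?_ (by norm_num)
  rw [Finset.mul_sum]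
  refine Finset.sum_le_sum fun p _ => ?_
  unfold pairEnergy
  split_ifs with ha
  · rw [← Finset.sum_sub_distrib]
    refine (sq_sum_le_card_mul_sum_sq).trans ?_
    refine mul_le_mul_of_nonneg_left (Finset.sum_le_sum fun i _ => ?_) (Nat.cast_nonneg _)
    refine sq_le_sq.2 ((abs_abs_sub_abs_le _ _).trans ?_)
    ring_nf; exact le_rfl
  · simp

/-- Pulling a function back along a map with small fibres which does not separate neighbours. -/
theorem energy_comp_le {A B : Finset (List S)} {φ : List S → List S} (hφ : ∀ w ∈ A, φ w ∈ B)
    (hadj : ∀ w ∈ A, ∀ v ∈ A, F.Adj w v → φ w = φ v ∨ F.Adj (φ w) (φ v)) {n : ℝ}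
    (hn : ∀ b ∈ B, ((A.filter fun a => φ a = b).card : ℝ) ≤ n) (f : List S → ℝ) :
    F.energy A (f ∘ φ) ≤ n ^ 2 * F.energy B f := by
  rw [energy_eq, energy_eq, mul_left_comm]
  refine mul_le_mul_of_nonneg_left ?_ (by norm_num)
  calc ∑ p ∈ A ×ˢ A, F.pairEnergy (f ∘ φ) p
      ≤ ∑ p ∈ A ×ˢ A, F.pairEnergy f (Prod.map φ φ p) := by
        refine Finset.sum_le_sum fun p hp => ?_
        rw [Finset.mem_product] at hp
        unfold pairEnergy
        simp only [Function.comp_apply, Prod.map_fst, Prod.map_snd]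
        split_ifs with h1 h2 h2
        · exact le_rfl
        · rcases hadj _ hp.1 _ hp.2 h1 with h3 | h3
          · rw [h3]; simp
          · exact absurd h3 h2
        · positivity
        · exact le_rfl
    _ = ∑ q ∈ B ×ˢ B, ∑ p ∈ (A ×ˢ A).filter (fun p => Prod.map φ φ p = q),
          F.pairEnergy f (Prod.map φ φ p) := by
        refine (Finset.sum_fiberwise_of_maps_to (fun p hp => ?_) _).symm
        rw [Finset.mem_product] at hp ⊢
        exact ⟨hφ _ hp.1, hφ _ hp.2⟩
    _ ≤ ∑ q ∈ B ×ˢ B, n ^ 2 * F.pairEnergy f q := by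
        refine Finset.sum_le_sum fun q hq => ?_
        rw [Finset.mem_product] at hq
        have h1 : ∑ p ∈ (A ×ˢ A).filter (fun p => Prod.map φ φ p = q),
            F.pairEnergy f (Prod.map φ φ p) =
            ((A ×ˢ A).filter (fun p => Prod.map φ φ p = q)).card * F.pairEnergy f q := by
          rw [← nsmul_eq_mul, ← Finset.sum_const]
          refine Finset.sum_congr rfl fun p hp => ?_
          rw [(Finset.mem_filter.1 hp).2]
        have h2 : (A ×ˢ A).filter (fun p => Prod.map φ φ p = q) =
            (A.filter fun a => φ a = q.1) ×ˢ (A.filter fun a => φ a = q.2) := by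
          ext p
          simp only [Finset.mem_filter, Finset.mem_product, Prod.ext_iff, Prod.map_fst,
            Prod.map_snd]
          tauto
        rw [h1, h2, Finset.card_product]
        refine mul_le_mul_of_nonneg_right ?_ (F.pairEnergy_nonneg f q)
        push_cast
        rw [sq]
        exact mul_le_mul (hn _ hq.1) (hn _ hq.2) (Nat.cast_nonneg _)
          ((Nat.cast_nonneg _).trans (hn _ hq.1))
    _ = n ^ 2 * ∑ q ∈ B ×ˢ B, F.pairEnergy f q := by rw [Finset.mul_sum]

theorem energy_comp_le_of_injOn {A B : Finset (List S)} {φ : List S → List S}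
    (hφ : ∀ w ∈ A, φ w ∈ B) (hinj : Set.InjOn φ A)
    (hadj : ∀ w ∈ A, ∀ v ∈ A, F.Adj w v → F.Adj (φ w) (φ v)) (f : List S → ℝ) :
    F.energy A (f ∘ φ) ≤ F.energy B f := by
  have := F.energy_comp_le hφ (fun w hw v hv h => Or.inr (hadj w hw v hv h)) (n := 1) (fun b _ => by
    have : (A.filter fun a => φ a = b).card ≤ 1 := by
      rw [Finset.card_le_one]
      intro a ha c hc
      rw [Finset.mem_filter] at ha hc
      exact hinj ha.1 hc.1 (ha.2.trans hc.2.symm)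
    exact_mod_cast this) f
  simpa using this

theorem sq_sub_le_energy {A : Finset (List S)} {w v : List S} (hw : w ∈ A) (hv : v ∈ A)
    (h : (F.cell w ∩ F.cell v).Nonempty) (f : List S → ℝ) : (f w - f v) ^ 2 ≤ F.energy A f := by
  rcases eq_or_ne w v with rfl | hne
  · simpa using F.energy_nonneg A f
  have ha : F.Adj w v := ⟨hne, h⟩
  have hsub : ({(w, v), (v, w)} : Finset (List S × List S)) ⊆ A ×ˢ A := by
    intro p hp
    simp only [Finset.mem_insert, Finset.mem_singleton] at hp
    rcases hp with rfl | rfl <;> simp [hw, hv]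
  have h1 := Finset.sum_le_sum_of_subset_of_nonneg hsub fun p _ _ => F.pairEnergy_nonneg f p
  rw [Finset.sum_pair (by simp [hne])] at h1
  rw [energy_eq]
  have h2 : F.pairEnergy f (w, v) = (f w - f v) ^ 2 := if_pos ha
  have h3 : F.pairEnergy f (v, w) = (f w - f v) ^ 2 := by
    have : F.pairEnergy f (v, w) = (f v - f w) ^ 2 := if_pos (Adj.symm' F ha)
    rw [this]; ring
  rw [h2, h3] at h1
  linarith

theorem abs_sub_le_sqrt_energy {A : Finset (List S)} {w v : List S} (hw : w ∈ A) (hv : v ∈ A)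
    (h : (F.cell w ∩ F.cell v).Nonempty) (f : List S → ℝ) :
    |f w - f v| ≤ √(F.energy A f) :=
  Real.abs_le_sqrt (F.sq_sub_le_energy hw hv h f)

/-- The adjacency graph on a set of words. -/
def graph (A : Set (List S)) : SimpleGraph (List S) where
  Adj w v := w ∈ A ∧ v ∈ A ∧ F.Adj w v
  symm := ⟨fun _ _ h => ⟨h.2.1, h.1, Adj.symm' F h.2.2⟩⟩
  loopless := ⟨fun _ h => h.2.2.1 rfl⟩

theorem graph_mono {A B : Set (List S)} (h : A ⊆ B) : F.graph A ≤ F.graph B :=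
  fun _ _ ha => ⟨h ha.1, h ha.2.1, ha.2.2⟩

theorem abs_sub_le_of_walk {A : Finset (List S)} (f : List S → ℝ) {w v : List S}
    (p : (F.graph (A : Set (List S))).Walk w v) :
    |f w - f v| ≤ p.length * √(F.energy A f) := by
  induction p with
  | nil => simp
  | cons h p ih =>
    have h1 := F.abs_sub_le_sqrt_energy (A := A) h.1 h.2.1 h.2.2.2 f
    rw [SimpleGraph.Walk.length_cons]
    push_cast
    have := abs_sub_le (f _) (f _) (f _) |>.trans (add_le_add h1 ih)
    linarith

theorem abs_sub_le_of_reachable {A : Finset (List S)} (f : List S → ℝ) {w v : List S}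
    (h : (F.graph (A : Set (List S))).Reachable w v) :
    |f w - f v| ≤ A.card * √(F.energy A f) := by
  classical
  -- a path visits each word of `A` at most once
  obtain ⟨p, hp⟩ := h.exists_isPath
  refine (F.abs_sub_le_of_walk f p).trans (mul_le_mul_of_nonneg_right ?_ (Real.sqrt_nonneg _))
  have hsub : p.support.tail.toFinset ⊆ A := by
    clear hp
    induction p with
    | nil => simp
    | cons h p ih =>
      intro x hx
      simp only [SimpleGraph.Walk.support_cons, List.tail_cons, List.mem_toFinset] at hx
      rw [SimpleGraph.Walk.mem_support_iff] at hx
      rcases hx with rfl | hx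
      · exact h.2.1
      · exact ih ⟨p⟩ (List.mem_toFinset.2 hx)
  have h1 := Finset.card_le_card hsub
  rw [List.toFinset_card_of_nodup hp.support_nodup.tail] at h1
  simp only [List.length_tail, SimpleGraph.Walk.length_support, Nat.add_sub_cancel] at h1
  exact_mod_cast h1

theorem sq_sub_le_of_reachable {A : Finset (List S)} (f : List S → ℝ) {w v : List S}
    (h : (F.graph (A : Set (List S))).Reachable w v) :
    (f w - f v) ^ 2 ≤ A.card ^ 2 * F.energy A f := by
  have h1 := F.abs_sub_le_of_reachable f h
  rw [← sq_abs, ← Real.sq_sqrt (F.energy_nonneg A f), ← mul_pow]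
  exact pow_le_pow_left₀ (abs_nonneg _) h1 2

/-- The graph of the cells at a given scale is connected. -/
theorem reachable_cut (hF : F.IsBorderedCarpet) {s : ℝ} {w v : List S} (hw : w ∈ F.cut s)
    (hv : v ∈ F.cut s) : (F.graph (F.cut s : Set (List S))).Reachable w v := by
  classical
  by_contra hne
  have hs : 0 < s := IsCut.pos F (F.mem_cut.1 hw)
  -- the cells of a component and the remaining cells would split `K` into two closed parts
  set A := (F.cut s).filter fun u => (F.graph (F.cut s : Set (List S))).Reachable w u with hA
  set B := (F.cut s).filter fun u => ¬ (F.graph (F.cut s : Set (List S))).Reachable w u with hB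
  have hcl : ∀ X : Finset (List S), IsClosed (⋃ u ∈ X, F.cell u) := fun X =>
    (X.isCompact_biUnion fun u _ => F.isCompact_cell u).isClosed
  have hpre := hF.connected.isPreconnected
  rw [isPreconnected_closed_iff] at hpre
  have hAB := hpre _ _ (hcl A) (hcl B) ?_ ?_ ?_
  · obtain ⟨x, -, hx1, hx2⟩ := hAB
    simp only [Set.mem_iUnion] at hx1 hx2
    obtain ⟨a, ha, hxa⟩ := hx1
    obtain ⟨b, hb, hxb⟩ := hx2
    rw [hA, Finset.mem_filter] at ha
    rw [hB, Finset.mem_filter] at hb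
    refine hb.2 (ha.2.trans (SimpleGraph.Adj.reachable ⟨ha.1, hb.1, ?_, ⟨x, hxa, hxb⟩⟩))
    rintro rfl
    exact hb.2 ha.2
  · intro x hx
    obtain ⟨u, hu, hxu⟩ := F.exists_isCut_of_mem_K hs hx
    rw [← mem_cut] at hu
    by_cases h : (F.graph (F.cut s : Set (List S))).Reachable w u
    · exact Or.inl (Set.mem_biUnion (Finset.mem_coe.2 (Finset.mem_filter.2 ⟨hu, h⟩)) hxu)
    · exact Or.inr (Set.mem_biUnion (Finset.mem_coe.2 (Finset.mem_filter.2 ⟨hu, h⟩)) hxu)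
  · obtain ⟨x, hx⟩ := F.cell_nonempty w
    have hxK : x ∈ F.K := by
      have := F.cell_append_subset [] w hx; rwa [cell_nil] at this
    exact ⟨x, hxK, Set.mem_biUnion (Finset.mem_coe.2 (Finset.mem_filter.2
      ⟨hw, SimpleGraph.Reachable.refl w⟩)) hx⟩
  · obtain ⟨x, hx⟩ := F.cell_nonempty v
    have hxK : x ∈ F.K := by
      have := F.cell_append_subset [] v hx; rwa [cell_nil] at this
    exact ⟨x, hxK, Set.mem_biUnion (Finset.mem_coe.2 (Finset.mem_filter.2 ⟨hv, hne⟩)) hx⟩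

/-! ### The maximal resistance at a given scale -/

/-- The squared oscillations of the functions of energy at most `1` at scale `s`. -/
def oscSet (s : ℝ) : Set ℝ :=
  {x | ∃ f : List S → ℝ, F.energy (F.cut s) f ≤ 1 ∧ ∃ w ∈ F.cut s, ∃ v ∈ F.cut s,
    x = (f w - f v) ^ 2}

/-- The largest effective resistance between two cells at scale `s`: the supremum of
`(f w - f v) ^ 2` over the functions `f` of energy at most `1`. -/
def maxRes (s : ℝ) : ℝ := sSup (F.oscSet s)

theorem bddAbove_oscSet (hF : F.IsBorderedCarpet) (s : ℝ) : BddAbove (F.oscSet s) := by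
  refine ⟨(F.cut s).card ^ 2, ?_⟩
  rintro _ ⟨f, hf, w, hw, v, hv, rfl⟩
  refine (F.sq_sub_le_of_reachable f (F.reachable_cut hF hw hv)).trans ?_
  exact mul_le_of_le_one_right (by positivity) hf

theorem maxRes_nonneg (s : ℝ) : 0 ≤ F.maxRes s := by
  apply Real.sSup_nonneg
  rintro _ ⟨f, -, w, -, v, -, rfl⟩
  positivity

theorem sq_sub_le_maxRes (hF : F.IsBorderedCarpet) {s : ℝ} (f : List S → ℝ) {w v : List S}
    (hw : w ∈ F.cut s) (hv : v ∈ F.cut s) :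
    (f w - f v) ^ 2 ≤ F.maxRes s * F.energy (F.cut s) f := by
  -- a function of energy `0` cannot be normalized, but it is constant by connectedness
  rcases (F.energy_nonneg (F.cut s) f).eq_or_lt with h0 | h0
  · have := F.sq_sub_le_of_reachable f (F.reachable_cut hF hw hv)
    rw [← h0] at this ⊢
    simpa using this
  set e := F.energy (F.cut s) f with he
  have h1 : ((√e)⁻¹ * f w - (√e)⁻¹ * f v) ^ 2 ≤ F.maxRes s := by
    refine le_csSup (F.bddAbove_oscSet hF s) ⟨fun u => (√e)⁻¹ * f u, ?_, w, hw, v, hv, rfl⟩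
    rw [energy_smul, inv_pow, Real.sq_sqrt h0.le, ← he, inv_mul_cancel₀ h0.ne']
  have h2 : ((√e)⁻¹ * f w - (√e)⁻¹ * f v) ^ 2 = e⁻¹ * (f w - f v) ^ 2 := by
    rw [← mul_sub, mul_pow, inv_pow, Real.sq_sqrt h0.le]
  rw [h2, inv_mul_le_iff₀ h0] at h1
  linarith

theorem abs_sub_le_maxRes (hF : F.IsBorderedCarpet) {s : ℝ} {f : List S → ℝ}
    (hf : F.energy (F.cut s) f ≤ 1) {w v : List S}
    (hw : w ∈ F.cut s) (hv : v ∈ F.cut s) : |f w - f v| ≤ √(F.maxRes s) := by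
  refine Real.abs_le_sqrt ((F.sq_sub_le_maxRes hF f hw hv).trans ?_)
  exact mul_le_of_le_one_right (F.maxRes_nonneg s) hf

theorem exists_lt_maxRes {s c : ℝ} (hc : c < F.maxRes s) (hc0 : 0 ≤ c) :
    ∃ f : List S → ℝ, F.energy (F.cut s) f ≤ 1 ∧ ∃ w ∈ F.cut s, ∃ v ∈ F.cut s,
      c < (f w - f v) ^ 2 := by
  -- the supremum of the empty set would be `0`
  have hne : (F.oscSet s).Nonempty := by
    by_contra h
    rw [Set.not_nonempty_iff_eq_empty] at h
    rw [maxRes, h, Real.sSup_empty] at hc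
    linarith
  obtain ⟨_, ⟨f, hf, w, hw, v, hv, rfl⟩, h⟩ := exists_lt_of_lt_csSup hne hc
  exact ⟨f, hf, w, hw, v, hv, h⟩

end PolygonIFS

namespace PolygonIFS

open scoped Classical

variable {S : Type*} [Fintype S] (F : PolygonIFS S)

/-! ### Extending a function from a coarse scale to a fine scale -/

/-- The largest value of `f` at the words of `A` which can be reached from `x` in at most `j` steps
between neighbours. -/
def spread (A : Finset (List S)) (f : List S → ℝ) : ℕ → List S → ℝ
  | 0, x => f x
  | j + 1, x => (insert x (A.filter fun y => F.Adj x y)).sup' (Finset.insert_nonempty _ _)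
      (spread A f j)

variable {F} in
theorem spread_le_succ (A : Finset (List S)) (f : List S → ℝ) (j : ℕ) (x : List S) :
    F.spread A f j x ≤ F.spread A f (j + 1) x :=
  Finset.le_sup' (F.spread A f j) (Finset.mem_insert_self _ _)

theorem spread_le_of_adj {A : Finset (List S)} (f : List S → ℝ) (j : ℕ) {x y : List S}
    (hy : y ∈ A) (h : F.Adj x y) : F.spread A f j y ≤ F.spread A f (j + 1) x :=
  Finset.le_sup' (F.spread A f j)
    (Finset.mem_insert_of_mem (Finset.mem_filter.2 ⟨hy, h⟩))

theorem spread_mono (A : Finset (List S)) (f : List S → ℝ) (x : List S) :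
    Monotone fun j => F.spread A f j x :=
  monotone_nat_of_le_succ fun j => spread_le_succ A f j x

/-- The average of the first `n` functions `spread`. If `f` is constant on coarse cells that are about
`n` fine cells wide, it interpolates between the values of `f` in small steps. -/
def smooth (A : Finset (List S)) (f : List S → ℝ) (n : ℕ) (x : List S) : ℝ :=
  (n : ℝ)⁻¹ * ∑ j ∈ Finset.range n, F.spread A f j x

/-- The oscillation seen by `smooth` near `x`. -/
def rise (A : Finset (List S)) (f : List S → ℝ) (n : ℕ) (x : List S) : ℝ :=
  F.spread A f n x - f x

theorem rise_nonneg (A : Finset (List S)) (f : List S → ℝ) (n : ℕ) (x : List S) :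
    0 ≤ F.rise A f n x := sub_nonneg.2 (F.spread_mono A f x (Nat.zero_le n))

theorem le_smooth (A : Finset (List S)) (f : List S → ℝ) {n : ℕ} (hn : 1 ≤ n) (x : List S) :
    f x ≤ F.smooth A f n x := by
  have hn' : (0 : ℝ) < n := by exact_mod_cast hn
  rw [smooth, le_inv_mul_iff₀ hn']
  have := Finset.card_nsmul_le_sum (Finset.range n) (fun j => F.spread A f j x) (f x)
    fun j _ => F.spread_mono A f x (Nat.zero_le j)
  simpa using this

theorem smooth_le (A : Finset (List S)) (f : List S → ℝ) {n : ℕ} (hn : 1 ≤ n) (x : List S) :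
    F.smooth A f n x ≤ f x + F.rise A f n x := by
  have hn' : (0 : ℝ) < n := by exact_mod_cast hn
  rw [smooth, inv_mul_le_iff₀ hn', rise, add_sub_cancel]
  have := Finset.sum_le_card_nsmul (Finset.range n) (fun j => F.spread A f j x)
    (F.spread A f n x) fun j hj => F.spread_mono A f x (Finset.mem_range.1 hj).le
  simpa using this

/-- The sum telescopes: a step to a neighbour is absorbed by a shift of the number of steps. -/
theorem smooth_sub_le {A : Finset (List S)} (f : List S → ℝ) {n : ℕ} (hn : 1 ≤ n) {x y : List S}
    (hy : y ∈ A) (h : F.Adj x y) : F.smooth A f n y - F.smooth A f n x ≤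
      (n : ℝ)⁻¹ * F.rise A f n x := by
  rw [smooth, smooth, ← mul_sub]
  refine mul_le_mul_of_nonneg_left ?_ (by positivity)
  rw [← Finset.sum_sub_distrib]
  calc ∑ j ∈ Finset.range n, (F.spread A f j y - F.spread A f j x)
      ≤ ∑ j ∈ Finset.range n, (F.spread A f (j + 1) x - F.spread A f j x) :=
        Finset.sum_le_sum fun j _ => sub_le_sub_right (F.spread_le_of_adj f j hy h) _
    _ = F.rise A f n x := Finset.sum_range_sub (fun j => F.spread A f j x) n

/-- Neighbours differ by at most `1 / n` times the larger of their rises, and each cell has at most `d`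
neighbours. -/
theorem energy_smooth_le {A : Finset (List S)} (f : List S → ℝ) {n d : ℕ} (hn : 1 ≤ n)
    (hd : ∀ x ∈ A, (A.filter fun y => F.Adj x y).card ≤ d) :
    F.energy A (F.smooth A f n) ≤ d * ((n : ℝ)⁻¹) ^ 2 * ∑ x ∈ A, F.rise A f n x ^ 2 := by
  set c := ((n : ℝ)⁻¹) ^ 2 with hc
  have hpair : ∀ x ∈ A, ∀ y ∈ A, (if F.Adj x y then
      (F.smooth A f n x - F.smooth A f n y) ^ 2 else 0) ≤
      (if F.Adj x y then c * F.rise A f n x ^ 2 else 0) +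
      (if F.Adj x y then c * F.rise A f n y ^ 2 else 0) := by
    intro x hx y hy
    split_ifs with h
    · have h1 := F.smooth_sub_le f hn hy h
      have h2 := F.smooth_sub_le f hn hx (Adj.symm' F h)
      rw [hc, ← mul_pow, ← mul_pow]
      rcases le_total (F.smooth A f n x) (F.smooth A f n y) with h3 | h3
      · nlinarith [sq_nonneg ((n : ℝ)⁻¹ * F.rise A f n y)]
      · nlinarith [sq_nonneg ((n : ℝ)⁻¹ * F.rise A f n x)]
    · simp
  have h1 : ∑ x ∈ A, ∑ y ∈ A, (if F.Adj x y then c * F.rise A f n x ^ 2 else 0) ≤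
      ∑ x ∈ A, d * (c * F.rise A f n x ^ 2) := by
    refine Finset.sum_le_sum fun x hx => ?_
    rw [← Finset.sum_filter, Finset.sum_const, nsmul_eq_mul]
    refine mul_le_mul_of_nonneg_right ?_ (by positivity)
    exact_mod_cast hd x hx
  have h2 : ∑ x ∈ A, ∑ y ∈ A, (if F.Adj x y then c * F.rise A f n y ^ 2 else 0) =
      ∑ x ∈ A, ∑ y ∈ A, (if F.Adj x y then c * F.rise A f n x ^ 2 else 0) := by
    rw [Finset.sum_comm]
    refine Finset.sum_congr rfl fun x _ => Finset.sum_congr rfl fun y _ => ?_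
    have : F.Adj x y ↔ F.Adj y x := ⟨fun h => Adj.symm' F h, fun h => Adj.symm' F h⟩
    simp only [this]
  have h3 : ∑ x ∈ A, ∑ y ∈ A, (if F.Adj x y then
      (F.smooth A f n x - F.smooth A f n y) ^ 2 else 0) ≤
      2 * ∑ x ∈ A, d * (c * F.rise A f n x ^ 2) := by
    calc _ ≤ ∑ x ∈ A, ∑ y ∈ A, ((if F.Adj x y then c * F.rise A f n x ^ 2 else 0) +
      (if F.Adj x y then c * F.rise A f n y ^ 2 else 0)) :=
          Finset.sum_le_sum fun x hx => Finset.sum_le_sum fun y hy => hpair x hx y hy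
      _ ≤ _ := by
        simp_rw [Finset.sum_add_distrib]
        rw [h2]; linarith
  have h4 : ∑ x ∈ A, d * (c * F.rise A f n x ^ 2) =
      d * c * ∑ x ∈ A, F.rise A f n x ^ 2 := by
    rw [Finset.mul_sum]; exact Finset.sum_congr rfl fun x _ => by ring
  rw [h4] at h3
  rw [energy]
  linarith

/-! ### Comparison of scales -/

theorem isCut_tr_of_le {s s' : ℝ} (hs : s ≤ s') {x : List S} (hx : F.IsCut s x) :
    F.IsCut s' (F.tr s' x) := F.isCut_tr ((IsCut.le F hx).trans hs)

theorem tr_mem_cut {s s' : ℝ} (hs : s ≤ s') {x : List S} (hx : x ∈ F.cut s) :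
    F.tr s' x ∈ F.cut s' := F.mem_cut.2 (F.isCut_tr_of_le hs (F.mem_cut.1 hx))

theorem cell_subset_tr (s : ℝ) (x : List S) : F.cell x ⊆ F.cell (F.tr s x) :=
  F.cell_subset_of_prefix (F.tr_prefix s x)

theorem tr_inter_nonempty (s : ℝ) {x y : List S} (h : (F.cell x ∩ F.cell y).Nonempty) :
    (F.cell (F.tr s x) ∩ F.cell (F.tr s y)).Nonempty :=
  h.mono (Set.inter_subset_inter (F.cell_subset_tr s x) (F.cell_subset_tr s y))

theorem tr_eq_or_adj (s : ℝ) {x y : List S} (h : F.Adj x y) :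
    F.tr s x = F.tr s y ∨ F.Adj (F.tr s x) (F.tr s y) := by
  by_cases he : F.tr s x = F.tr s y
  · exact Or.inl he
  · exact Or.inr ⟨he, F.tr_inter_nonempty s h.2⟩

theorem tr_append_of_le {s : ℝ} {x : List S} (hx : F.ρw x ≤ s) (y : List S) :
    F.tr s (x ++ y) = F.tr s x := by
  obtain ⟨z, hz⟩ := F.tr_prefix s x
  have h := F.isCut_tr hx
  conv_lhs => rw [← hz, List.append_assoc]
  exact F.tr_append_of_isCut h _

theorem exists_ρw_le {t : ℝ} (ht : 0 < t) : ∃ u : List S, F.ρw u ≤ t := by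
  obtain ⟨i⟩ := F.nonempty_index
  obtain ⟨n, hn⟩ := exists_pow_lt_of_lt_one ht (F.ρ_lt_one i)
  refine ⟨List.replicate n i, ?_⟩
  simp only [ρw, List.map_replicate, List.prod_replicate]
  exact hn.le

/-- Every coarse cell contains a fine cell. -/
theorem exists_mem_cut_tr_eq {s s' : ℝ} (hs : 0 < s) (hss : s ≤ s') {w : List S}
    (hw : w ∈ F.cut s') : ∃ x ∈ F.cut s, F.tr s' x = w := by
  obtain ⟨u, hu⟩ := F.exists_ρw_le (div_pos hs (F.ρw_pos w))
  have h1 : F.ρw (w ++ u) ≤ s := by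
    rw [ρw_append]
    rw [le_div_iff₀ (F.ρw_pos w)] at hu; linarith
  have h2 := F.isCut_tr h1
  refine ⟨_, F.mem_cut.2 h2, ?_⟩
  obtain ⟨y, hy⟩ := F.tr_prefix s (w ++ u)
  have h3 := F.tr_append_of_le ((IsCut.le F h2).trans hss) y
  rw [hy, F.tr_append_of_isCut (F.mem_cut.1 hw)] at h3
  exact h3.symm

theorem pt_dist_tr_le {s s' : ℝ} (hs : s ≤ s') {x : List S} (hx : x ∈ F.cut s) :
    dist (F.pt x) (F.pt (F.tr s' x)) ≤ s' * F.rad := by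
  obtain ⟨y, hy⟩ := F.tr_prefix s' x
  have h1 := F.dist_pt_le (F.pt_mem (F.tr s' x) y)
  rw [hy] at h1
  refine h1.trans (mul_le_mul_of_nonneg_right ?_ F.rad_pos.le)
  exact IsCut.le F (F.mem_cut.1 (F.tr_mem_cut hs hx))

theorem dist_pt_le_of_inter {s : ℝ} {x y : List S} (hx : x ∈ F.cut s) (hy : y ∈ F.cut s)
    (h : (F.cell x ∩ F.cell y).Nonempty) : dist (F.pt x) (F.pt y) ≤ 2 * F.rad * s := by
  obtain ⟨z, hzx, hzy⟩ := h
  have h1 := F.dist_pt_le (F.cell_subset_body x hzx)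
  have h2 := F.dist_pt_le (F.cell_subset_body y hzy)
  have h3 := mul_le_mul_of_nonneg_right (IsCut.le F (F.mem_cut.1 hx)) F.rad_pos.le
  have h4 := mul_le_mul_of_nonneg_right (IsCut.le F (F.mem_cut.1 hy)) F.rad_pos.le
  have h5 := dist_triangle_left (F.pt x) (F.pt y) z
  linarith

theorem exists_degree_bound (hF : F.IsBorderedCarpet) : ∃ d : ℕ, 1 ≤ d ∧ ∀ (s : ℝ),
    ∀ x ∈ F.cut s, ((F.cut s).filter fun y => F.Adj x y).card ≤ d := by
  have := F.rad_pos
  obtain ⟨d, hd, h⟩ := F.exists_card_le hF (c := 2 * F.rad) (by positivity)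
  refine ⟨d, hd, fun s x hx => (Finset.card_le_card fun y hy => ?_).trans (h s (F.pt x))⟩
  rw [Finset.mem_filter] at hy ⊢
  refine ⟨hy.1, ?_⟩
  rw [dist_comm]
  exact F.dist_pt_le_of_inter hx hy.1 hy.2.2

/-- The words at scale `s'` near the word `w`. -/
def near (s' : ℝ) (w : List S) : Finset (List S) :=
  (F.cut s').filter fun v => dist (F.pt v) (F.pt w) ≤ 6 * F.rad * s'

/-- A short walk at the fine scale gives a walk at the coarse scale between nearby words. -/
theorem spread_eq {s s' : ℝ} (hss : s ≤ s') (f : List S → ℝ) (j : ℕ) {x : List S}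
    (hx : x ∈ F.cut s) {V : Finset (List S)} (hV : ∀ w ∈ F.cut s',
      dist (F.pt w) (F.pt x) ≤ s' * F.rad + 2 * F.rad * s * j → w ∈ V) :
    ∃ z, F.spread (F.cut s) (fun y => f (F.tr s' y)) j x = f z ∧
      (F.graph (V : Set (List S))).Reachable (F.tr s' x) z := by
  induction j generalizing x with
  | zero => exact ⟨_, rfl, SimpleGraph.Reachable.refl _⟩
  | succ j ih =>
    have hr := F.rad_pos
    have hs0 : 0 < s := IsCut.pos F (F.mem_cut.1 hx)
    obtain ⟨y, hy, hyx⟩ := Finset.exists_mem_eq_sup' (Finset.insert_nonempty x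
      ((F.cut s).filter fun y => F.Adj x y)) (F.spread (F.cut s) (fun y => f (F.tr s' y)) j)
    have hxV : F.tr s' x ∈ V := by
      refine hV _ (F.tr_mem_cut hss hx) ?_
      rw [dist_comm]
      have := F.pt_dist_tr_le hss hx
      have : 0 ≤ 2 * F.rad * s * ((j + 1 : ℕ) : ℝ) := by positivity
      linarith
    rw [spread, hyx]
    rw [Finset.mem_insert, Finset.mem_filter] at hy
    rcases hy with rfl | ⟨hy, hadj⟩
    · refine ih hx fun w hw hd => hV w hw (hd.trans ?_)
      push_cast
      nlinarith [mul_pos hr hs0]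
    · have hd := F.dist_pt_le_of_inter hx hy hadj.2
      have hyV : F.tr s' y ∈ V := by
        refine hV _ (F.tr_mem_cut hss hy) ?_
        have h1 := F.pt_dist_tr_le hss hy
        have h2 := dist_triangle (F.pt (F.tr s' y)) (F.pt y) (F.pt x)
        rw [dist_comm (F.pt (F.tr s' y)) (F.pt y), dist_comm (F.pt y) (F.pt x)] at h2
        push_cast
        have : 0 ≤ 2 * F.rad * s * (j : ℝ) := by positivity
        linarith
      obtain ⟨z, hz, hreach⟩ := ih hy fun w hw hd' => hV w hw (by
        have h2 := dist_triangle (F.pt w) (F.pt y) (F.pt x)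
        rw [dist_comm (F.pt y) (F.pt x)] at h2
        push_cast
        linarith)
      refine ⟨z, hz, ?_⟩
      rcases F.tr_eq_or_adj s' hadj with he | ha
      · rw [he]; exact hreach
      · have hG : (F.graph (V : Set (List S))).Adj (F.tr s' x) (F.tr s' y) := ⟨hxV, hyV, ha⟩
        exact hG.reachable.trans hreach

/-- The rise of a function pulled back from the coarse scale `s'` is controlled by the energy near the
coarse cell: `n` fine steps stay within distance `O(s')`. -/
theorem rise_le {s s' : ℝ} (hss : s ≤ s') (f : List S → ℝ) {n : ℕ} (hn : n * s ≤ 2 * s')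
    {x : List S} (hx : x ∈ F.cut s) :
    F.rise (F.cut s) (fun y => f (F.tr s' y)) n x ≤
      (F.near s' (F.tr s' x)).card * √(F.energy (F.near s' (F.tr s' x)) f) := by
  have hr := F.rad_pos
  obtain ⟨z, hz, hreach⟩ := F.spread_eq hss f n hx (V := F.near s' (F.tr s' x)) (by
    intro w hw hd
    rw [near, Finset.mem_filter]
    refine ⟨hw, ?_⟩
    have h1 := F.pt_dist_tr_le hss hx
    have h2 := dist_triangle (F.pt w) (F.pt x) (F.pt (F.tr s' x))
    have h3 : F.rad * (n * s) ≤ F.rad * (2 * s') := mul_le_mul_of_nonneg_left hn hr.le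
    nlinarith)
  rw [rise, hz]
  refine (le_abs_self _).trans ?_
  exact F.abs_sub_le_of_reachable f hreach.symm

/-- The number of fine cells in a coarse cell. -/
theorem card_fiber_le (hF : F.IsBorderedCarpet) {s s' : ℝ} (hs : 0 < s) (hss : s ≤ s')
    (hs' : s' ≤ 1) {k : ℕ} (hk : s ≤ F.ρmin ^ k * s') {w : List S} (hw : w ∈ F.cut s') :
    (((F.cut s).filter fun x => F.tr s' x = w).card : ℝ) * (F.ρmin * (s / s')) ^ 2 ≤
      F.areaRatio ^ k / F.areaRatio := by
  have hρ := F.ρmin_pos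
  have hq := F.areaRatio_pos
  have hq1 := F.areaRatio_lt_one hF
  have hs'0 : 0 < s' := hs.trans_le hss
  have hw' := F.mem_cut.1 hw
  have hw0 := F.ρw_pos w
  have hge := IsCut.ge F hw' (by have := F.ρmin_lt_one; nlinarith)
  have hle := IsCut.le F hw'
  -- the fine cells inside `w` are the cells of the whole carpet at scale `s / ρ_w`
  have hcard : ((F.cut s).filter fun x => F.tr s' x = w).card ≤ (F.cut (s / F.ρw w)).card := by
    have hsub : ((F.cut s).filter fun x => F.tr s' x = w) ⊆
        (F.cut (s / F.ρw w)).image fun y => w ++ y := by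
      intro x hx
      rw [Finset.mem_filter, mem_cut] at hx
      obtain ⟨y, hy⟩ := F.tr_prefix s' x
      rw [hx.2] at hy
      rw [Finset.mem_image]
      refine ⟨y, F.mem_cut.2 ?_, hy⟩
      rw [← hy] at hx
      exact IsCut.of_append F hx.1
    exact (Finset.card_le_card hsub).trans Finset.card_image_le
  have hcard' : (((F.cut s).filter fun x => F.tr s' x = w).card : ℝ) ≤
      (F.cut (s / F.ρw w)).card := by exact_mod_cast hcard
  have ht : s / s' ≤ s / F.ρw w := div_le_div_of_nonneg_left hs.le hw0 hle
  have h1 : (((F.cut s).filter fun x => F.tr s' x = w).card : ℝ) * (F.ρmin * (s / s')) ^ 2 ≤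
      (F.cut (s / F.ρw w)).card * (F.ρmin * (s / F.ρw w)) ^ 2 := by
    have : 0 ≤ F.ρmin * (s / s') := by positivity
    gcongr
  have h2 : F.ρmin * (s / F.ρw w) ≤ 1 := by
    rw [← mul_div_assoc, div_le_one hw0]
    nlinarith
  refine h1.trans ?_
  -- `s ≤ ρ_* ^ k s'` only gives `s / ρ_w ≤ ρ_* ^ (k - 1)`, whence the division by `areaRatio`
  cases k with
  | zero =>
    refine (F.card_cut_le hF (div_pos hs hw0) h2 (k := 0) (Or.inl rfl)).trans ?_
    rw [pow_zero, one_div]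
    exact (one_le_inv₀ hq).2 hq1.le
  | succ k =>
    rw [pow_succ F.areaRatio, mul_div_assoc, div_self hq.ne', mul_one]
    refine F.card_cut_le hF (div_pos hs hw0) h2 (Or.inr ?_)
    rw [div_le_iff₀ hw0]
    rw [pow_succ, mul_assoc] at hk
    exact hk.trans (mul_le_mul_of_nonneg_left hge (by positivity))

/-- A coarse cell is near at most `N₁` others, so each edge is counted at most `N₁` times. -/
theorem sum_energy_near_le {s' : ℝ} {N₁ : ℕ}
    (hN : ∀ w, (F.near s' w).card ≤ N₁) (f : List S → ℝ) :
    ∑ w ∈ F.cut s', F.energy (F.near s' w) f ≤ N₁ * F.energy (F.cut s') f := by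
  simp_rw [energy_eq]
  rw [← Finset.mul_sum, mul_left_comm]
  refine mul_le_mul_of_nonneg_left ?_ (by norm_num)
  set E := F.cut s' ×ˢ F.cut s' with hE
  have h1 : ∀ w, ∑ p ∈ F.near s' w ×ˢ F.near s' w, F.pairEnergy f p ≤
      ∑ p ∈ E, if p.1 ∈ F.near s' w then F.pairEnergy f p else 0 := by
    intro w
    rw [← Finset.sum_filter]
    refine Finset.sum_le_sum_of_subset_of_nonneg (fun p hp => ?_)
      fun p _ _ => F.pairEnergy_nonneg f p
    rw [Finset.mem_product] at hp
    rw [Finset.mem_filter, hE, Finset.mem_product]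
    exact ⟨⟨(Finset.mem_filter.1 hp.1).1, (Finset.mem_filter.1 hp.2).1⟩, hp.1⟩
  refine (Finset.sum_le_sum fun w _ => h1 w).trans ?_
  rw [Finset.sum_comm, Finset.mul_sum]
  refine Finset.sum_le_sum fun p hp => ?_
  rw [← Finset.sum_filter, Finset.sum_const, nsmul_eq_mul]
  refine mul_le_mul_of_nonneg_right ?_ (F.pairEnergy_nonneg f p)
  have h2 : ((F.cut s').filter fun w => p.1 ∈ F.near s' w) ⊆ F.near s' p.1 := by
    intro w hw
    rw [Finset.mem_filter, near, Finset.mem_filter] at hw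
    rw [near, Finset.mem_filter]
    exact ⟨hw.1, by rw [dist_comm]; exact hw.2.2⟩
  exact_mod_cast (Finset.card_le_card h2).trans (hN _)

/-- The smoothed extension to the fine scale loses energy: a coarse cell has about
`areaRatio ^ k (s' / s) ^ 2` fine cells, and the steps between these are of the order of `s / s'`
times the coarse oscillation. -/
theorem energy_smooth_tr_le (hF : F.IsBorderedCarpet) {d N₁ : ℕ}
    (hd : ∀ (s : ℝ), ∀ x ∈ F.cut s, ((F.cut s).filter fun y => F.Adj x y).card ≤ d)
    (hN : ∀ s' w, (F.near s' w).card ≤ N₁) {s s' : ℝ} (hs : 0 < s) (hss : s ≤ s')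
    (hs' : s' ≤ 1) {k : ℕ} (hk : s ≤ F.ρmin ^ k * s') {n : ℕ} (hn1 : 1 ≤ n) (hn : s' ≤ n * s)
    (hn2 : n * s ≤ 2 * s') (f : List S → ℝ) :
    F.energy (F.cut s) (F.smooth (F.cut s) (fun y => f (F.tr s' y)) n) ≤
      (d * N₁ ^ 3 / (F.ρmin ^ 2 * F.areaRatio)) * F.areaRatio ^ k * F.energy (F.cut s') f := by
  have hρ := F.ρmin_pos
  have hq := F.areaRatio_pos
  have hs'0 : 0 < s' := hs.trans_le hss
  set q := F.areaRatio with hqdef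
  refine (F.energy_smooth_le _ hn1 (hd s)).trans ?_
  set c : ℝ := q ^ k / q / (F.ρmin * (s / s')) ^ 2 with hc
  have hc0 : 0 ≤ c := by positivity
  have hE0 := F.energy_nonneg (F.cut s') f
  have h1 : ∑ x ∈ F.cut s, F.rise (F.cut s) (fun y => f (F.tr s' y)) n x ^ 2 ≤
      c * (N₁ ^ 3 * F.energy (F.cut s') f) := by
    -- group the fine cells by the coarse cells that contain them
    calc ∑ x ∈ F.cut s, F.rise (F.cut s) (fun y => f (F.tr s' y)) n x ^ 2
        ≤ ∑ x ∈ F.cut s, (N₁ : ℝ) ^ 2 * F.energy (F.near s' (F.tr s' x)) f := by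
          refine Finset.sum_le_sum fun x hx => ?_
          have h2 := F.rise_le hss f hn2 hx
          have h3 : ((F.near s' (F.tr s' x)).card : ℝ) ≤ N₁ := by exact_mod_cast hN s' _
          have h4 := h2.trans (mul_le_mul_of_nonneg_right h3 (Real.sqrt_nonneg _))
          refine (pow_le_pow_left₀ (F.rise_nonneg _ _ _ _) h4 2).trans ?_
          rw [mul_pow, Real.sq_sqrt (F.energy_nonneg _ _)]
      _ = ∑ w ∈ F.cut s', ∑ x ∈ (F.cut s).filter (fun x => F.tr s' x = w),
            (N₁ : ℝ) ^ 2 * F.energy (F.near s' (F.tr s' x)) f :=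
          (Finset.sum_fiberwise_of_maps_to (fun x hx => F.tr_mem_cut hss hx) _).symm
      _ ≤ ∑ w ∈ F.cut s', c * ((N₁ : ℝ) ^ 2 * F.energy (F.near s' w) f) := by
          refine Finset.sum_le_sum fun w hw => ?_
          have h2 : ∑ x ∈ (F.cut s).filter (fun x => F.tr s' x = w),
              (N₁ : ℝ) ^ 2 * F.energy (F.near s' (F.tr s' x)) f =
              ((F.cut s).filter (fun x => F.tr s' x = w)).card *
                ((N₁ : ℝ) ^ 2 * F.energy (F.near s' w) f) := by
            rw [← nsmul_eq_mul, ← Finset.sum_const]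
            refine Finset.sum_congr rfl fun x hx => ?_
            rw [(Finset.mem_filter.1 hx).2]
          rw [h2]
          refine mul_le_mul_of_nonneg_right ?_
            (mul_nonneg (by positivity) (F.energy_nonneg _ _))
          rw [hc, le_div_iff₀ (by positivity)]
          exact F.card_fiber_le hF hs hss hs' hk hw
      _ = c * (N₁ ^ 2 * ∑ w ∈ F.cut s', F.energy (F.near s' w) f) := by
          rw [Finset.mul_sum, Finset.mul_sum]
      _ ≤ c * (N₁ ^ 2 * (N₁ * F.energy (F.cut s') f)) := by
          gcongr
          exact F.sum_energy_near_le (hN s') f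
      _ = c * (N₁ ^ 3 * F.energy (F.cut s') f) := by ring
  have h5 : ((n : ℝ)⁻¹) ^ 2 ≤ (s / s') ^ 2 := by
    refine pow_le_pow_left₀ (by positivity) ?_ 2
    have hn0 : (0 : ℝ) < n := by exact_mod_cast hn1
    rw [le_div_iff₀ hs'0, inv_mul_le_iff₀ hn0]
    exact hn
  calc d * ((n : ℝ)⁻¹) ^ 2 * ∑ x ∈ F.cut s, F.rise (F.cut s) (fun y => f (F.tr s' y)) n x ^ 2
      ≤ d * (s / s') ^ 2 * (c * (N₁ ^ 3 * F.energy (F.cut s') f)) := by gcongr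
    _ = _ := by
      rw [hc]; field_simp

/-- A lower bound for the maximal resistance from one test function, the distance to `q_1` of the
centres of the cells: its steps are of the order of `s`, and there are at most about
`areaRatio ^ k s ^ (-2)` of them. -/
theorem exists_mul_energy_le (hF : F.IsBorderedCarpet) : ∃ C : ℝ, 0 < C ∧ ∃ s₀ : ℝ, 0 < s₀ ∧
    ∀ (s : ℝ) (k : ℕ), 0 < s → s ≤ s₀ → s ≤ F.ρmin ^ k →
      1 ≤ C * F.areaRatio ^ k * F.maxRes s := by
  have hρ := F.ρmin_pos
  have hr := F.rad_pos
  have hq := F.areaRatio_pos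
  obtain ⟨d, hd1, hd⟩ := F.exists_degree_bound hF
  have hd0 : (0 : ℝ) < d := by exact_mod_cast hd1
  refine ⟨8 * d * F.rad ^ 2 / F.ρmin ^ 2, by positivity, min 1 (1 / (4 * F.rad)), by positivity,
    fun s k hs hs0 hk => ?_⟩
  have hs1 : s ≤ 1 := hs0.trans (min_le_left _ _)
  have hs2 : s * F.rad ≤ 1 / 4 := by
    have := hs0.trans (min_le_right _ _)
    rw [le_div_iff₀ (by positivity)] at this; linarith
  set f : List S → ℝ := fun w => dist (F.pt w) (F.poly.q 1) with hf
  have hE : F.energy (F.cut s) f ≤ 2 * d * F.rad ^ 2 / F.ρmin ^ 2 * F.areaRatio ^ k := by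
    have h1 : ∑ w ∈ F.cut s, ∑ v ∈ F.cut s, (if F.Adj w v then (f w - f v) ^ 2 else 0) ≤
        ∑ w ∈ F.cut s, (d : ℝ) * (2 * F.rad * s) ^ 2 := by
      refine Finset.sum_le_sum fun w hw => ?_
      rw [← Finset.sum_filter]
      refine (Finset.sum_le_card_nsmul _ _ ((2 * F.rad * s) ^ 2) fun v hv => ?_).trans ?_
      · rw [Finset.mem_filter] at hv
        refine sq_le_sq' ?_ ?_
        · have := dist_triangle (F.pt v) (F.pt w) (F.poly.q 1)
          have h2 := F.dist_pt_le_of_inter hw hv.1 hv.2.2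
          rw [dist_comm] at h2
          simp only [hf]; linarith
        · have := dist_triangle (F.pt w) (F.pt v) (F.poly.q 1)
          have h2 := F.dist_pt_le_of_inter hw hv.1 hv.2.2
          simp only [hf]; linarith
      · rw [nsmul_eq_mul]
        refine mul_le_mul_of_nonneg_right ?_ (by positivity)
        exact_mod_cast hd s w hw
    have h2 := F.card_cut_le hF hs (by have := F.ρmin_lt_one; nlinarith) (Or.inr hk)
    rw [Finset.sum_const, nsmul_eq_mul] at h1
    rw [energy]
    calc _ ≤ 1 / 2 * ((F.cut s).card * (d * (2 * F.rad * s) ^ 2)) := by gcongr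
      _ = 2 * d * F.rad ^ 2 / F.ρmin ^ 2 * ((F.cut s).card * (F.ρmin * s) ^ 2) := by
        field_simp
      _ ≤ _ := by gcongr
  -- the cells at `q_1` and `q_2` have centres within `1 / 4` of these points, which have distance `1`
  have hmem : ∀ j, ∃ w ∈ F.cut s, dist (F.poly.q j) (F.pt w) ≤ 1 / 4 := by
    intro j
    obtain ⟨w, hw, hj⟩ := F.exists_isCut_of_mem_K hs (F.bdry_subset_K hF (F.poly.q_mem_bdry j))
    refine ⟨w, F.mem_cut.2 hw, (F.dist_pt_le (F.cell_subset_body w hj)).trans ?_⟩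
    exact (mul_le_mul_of_nonneg_right (IsCut.le F hw) hr.le).trans hs2
  obtain ⟨w, hw, hw1⟩ := hmem 1
  obtain ⟨v, hv, hv2⟩ := hmem 2
  have hside : dist (F.poly.q 1) (F.poly.q 2) = 1 := F.poly.side_length
  have hdiff : 1 / 2 ≤ f v - f w := by
    have h1 := dist_triangle (F.poly.q 1) (F.pt v) (F.poly.q 2)
    rw [dist_comm (F.poly.q 1) (F.pt v), dist_comm (F.pt v) (F.poly.q 2)] at h1
    rw [dist_comm] at hw1
    simp only [hf]; linarith
  have h3 := F.sq_sub_le_maxRes hF f hv hw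
  have h4 : (1 / 4 : ℝ) ≤ (f v - f w) ^ 2 := by nlinarith
  have h5 : F.maxRes s * F.energy (F.cut s) f ≤
      F.maxRes s * (2 * d * F.rad ^ 2 / F.ρmin ^ 2 * F.areaRatio ^ k) :=
    mul_le_mul_of_nonneg_left hE (F.maxRes_nonneg s)
  calc (1 : ℝ) = 4 * (1 / 4) := by norm_num
    _ ≤ 4 * (F.maxRes s * (2 * d * F.rad ^ 2 / F.ρmin ^ 2 * F.areaRatio ^ k)) := by linarith
    _ = _ := by ring

/-- The maximal resistance grows geometrically when the scale is refined: a function of unit energy at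
the coarse scale with a large oscillation is extended to the fine scale by smoothing. -/
theorem exists_maxRes_le (hF : F.IsBorderedCarpet) : ∃ C : ℝ, 0 < C ∧ ∃ s₀ : ℝ, 0 < s₀ ∧
    ∀ (s s' : ℝ) (k : ℕ), 0 < s → s ≤ s₀ → s ≤ s' → s' ≤ 1 → s ≤ F.ρmin ^ k * s' →
      F.maxRes s' ≤ C * F.areaRatio ^ k * F.maxRes s := by
  have hρ := F.ρmin_pos
  have hr := F.rad_pos
  have hq := F.areaRatio_pos
  obtain ⟨d, hd1, hd⟩ := F.exists_degree_bound hF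
  obtain ⟨N₁, hN1, hN⟩ := F.exists_card_le hF (c := 6 * F.rad) (by positivity)
  have hN' : ∀ s' w, (F.near s' w).card ≤ N₁ := fun s' w => hN s' (F.pt w)
  obtain ⟨C₀, hC₀, s₀, hs₀, hlow⟩ := F.exists_mul_energy_le hF
  set C₁ : ℝ := d * N₁ ^ 3 / (F.ρmin ^ 2 * F.areaRatio) with hC₁
  have hd0 : (0 : ℝ) < d := by exact_mod_cast hd1
  have hN0 : (0 : ℝ) < N₁ := by exact_mod_cast hN1
  have hC₁0 : 0 < C₁ := by positivity
  refine ⟨2 * C₁ + 8 * N₁ ^ 2 * C₀, by positivity, s₀, hs₀, fun s s' k hs hs0 hss hs' hk => ?_⟩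
  have hs'0 : 0 < s' := hs.trans_le hss
  have hlow := hlow s k hs hs0 (hk.trans (mul_le_of_le_one_right (by positivity) hs'))
  refine Real.sSup_le ?_ (mul_nonneg (by positivity) (F.maxRes_nonneg s))
  rintro _ ⟨f, hf, w, hw, v, hv, rfl⟩
  -- a coarse cell is about `n` fine cells wide
  set n := ⌈s' / s⌉₊ with hn
  have h1s : 1 ≤ s' / s := (one_le_div hs).2 hss
  have hn1 : 1 ≤ n := Nat.one_le_ceil_iff.2 (by positivity)
  have hna : s' ≤ n * s := by
    rw [← div_le_iff₀ hs]; exact Nat.le_ceil _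
  have hnb : n * s ≤ 2 * s' := by
    have h1 : (n : ℝ) < s' / s + 1 := Nat.ceil_lt_add_one (by positivity)
    have h2 : (n : ℝ) ≤ 2 * (s' / s) := by linarith
    calc n * s ≤ 2 * (s' / s) * s := by gcongr
      _ = 2 * s' := by field_simp
  set g : List S → ℝ := fun y => f (F.tr s' y) with hg
  have hE := F.energy_smooth_tr_le hF hd hN' hs hss hs' hk hn1 hna hnb f
  have hE' : F.energy (F.cut s) (F.smooth (F.cut s) g n) ≤ C₁ * F.areaRatio ^ k :=
    hE.trans (mul_le_of_le_one_right (by positivity) hf)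
  have happ : ∀ u ∈ F.cut s', ∃ x ∈ F.cut s, f u ≤ F.smooth (F.cut s) g n x ∧
      F.smooth (F.cut s) g n x ≤ f u + N₁ := by
    intro u hu
    obtain ⟨x, hx, hxu⟩ := F.exists_mem_cut_tr_eq hs hss hu
    have hgx : g x = f u := by simp only [hg, hxu]
    refine ⟨x, hx, hgx ▸ F.le_smooth (F.cut s) g hn1 x, ?_⟩
    have h1 := F.smooth_le (F.cut s) g hn1 x
    rw [hgx] at h1
    refine h1.trans (add_le_add_right ?_ _)
    refine (F.rise_le hss f hnb hx).trans ?_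
    have h2 : F.energy (F.near s' (F.tr s' x)) f ≤ 1 :=
      (F.energy_mono (Finset.filter_subset _ _) f).trans hf
    have h3 : √(F.energy (F.near s' (F.tr s' x)) f) ≤ 1 := Real.sqrt_le_one.2 h2
    have h4 : ((F.near s' (F.tr s' x)).card : ℝ) ≤ N₁ := by exact_mod_cast hN' s' _
    calc _ ≤ (N₁ : ℝ) * 1 := mul_le_mul h4 h3 (Real.sqrt_nonneg _) hN0.le
      _ = N₁ := mul_one _
  obtain ⟨x, hx, hx1, hx2⟩ := happ w hw
  obtain ⟨y, hy, hy1, hy2⟩ := happ v hv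
  have hM := F.sq_sub_le_maxRes hF (F.smooth (F.cut s) g n) hx hy
  have hM' := hM.trans (mul_le_mul_of_nonneg_left hE' (F.maxRes_nonneg s))
  set a := F.smooth (F.cut s) g n x - F.smooth (F.cut s) g n y with ha
  have hab : |f w - f v - a| ≤ 2 * N₁ := by
    rw [abs_le]; constructor <;> linarith
  have h5 : (f w - f v) ^ 2 ≤ 2 * a ^ 2 + 8 * N₁ ^ 2 := by
    have h6 : (f w - f v - a) ^ 2 ≤ (2 * N₁) ^ 2 := sq_le_sq' (abs_le.1 hab).1 (abs_le.1 hab).2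
    nlinarith [sq_nonneg (f w - f v - 2 * a)]
  -- the additive error of the smoothing is absorbed by the lower bound for the maximal resistance
  have h7 : 8 * (N₁ : ℝ) ^ 2 * 1 ≤ 8 * (N₁ : ℝ) ^ 2 * (C₀ * F.areaRatio ^ k * F.maxRes s) :=
    mul_le_mul_of_nonneg_left hlow (by positivity)
  calc (f w - f v) ^ 2 ≤ 2 * a ^ 2 + 8 * N₁ ^ 2 := h5
    _ ≤ 2 * (F.maxRes s * (C₁ * F.areaRatio ^ k)) +
        8 * (N₁ : ℝ) ^ 2 * (C₀ * F.areaRatio ^ k * F.maxRes s) := by linarith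
    _ = _ := by ring

end PolygonIFS

namespace UnitPolygon

variable (P : UnitPolygon)

/-! ### First-level cells along a side -/

theorem q_ne_q_succ (k : ℕ) : P.q k ≠ P.q (k + 1) := by
  intro h
  have h1 : P.root k = P.root k * P.root 1 := by
    rw [← root_add, ← coord_q', ← coord_q', h]
  have h2 : P.root 1 = 1 := by
    have := P.root_ne_zero k
    field_simp at h1
    exact h1.symm
  have h3 : dist (P.q 1) (P.q 2) = 1 := P.side_length
  rw [q_eq', q_eq', show (2 : ℕ) = 1 + 1 from rfl, root_add, h2] at h3
  simp at h3

/-- The affine parametrisation of the side `L_k` by `[0, 1]`. -/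
def along (k : ℕ) (t : ℝ) : ℂ := AffineMap.lineMap (P.q k) (P.q (k + 1)) t

theorem along_eq (k : ℕ) (t : ℝ) : P.along k t = P.q k + t * (P.q (k + 1) - P.q k) := by
  rw [along, AffineMap.lineMap_apply]
  simp only [vsub_eq_sub, vadd_eq_add, Complex.real_smul]
  ring

theorem along_zero (k : ℕ) : P.along k 0 = P.q k := by rw [along_eq]; simp

theorem continuous_along (k : ℕ) : Continuous (P.along k) := by
  have : P.along k = fun t : ℝ => P.q k + t * (P.q (k + 1) - P.q k) := funext (P.along_eq k)
  rw [this]; fun_prop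

theorem side_eq (k : ℕ) : P.side k = P.along k '' Set.Icc 0 1 := segment_eq_image_lineMap _ _ _

theorem along_mem_side {k : ℕ} {t : ℝ} (ht : t ∈ Set.Icc (0 : ℝ) 1) : P.along k t ∈ P.side k := by
  rw [side_eq]; exact ⟨t, ht, rfl⟩

theorem along_injective (k : ℕ) : Function.Injective (P.along k) := by
  intro a b h
  rw [along_eq, along_eq] at h
  have h1 : P.q (k + 1) - P.q k ≠ 0 := sub_ne_zero.2 (P.q_ne_q_succ k).symm
  have h2 := mul_right_cancel₀ h1 (add_left_cancel h)
  exact_mod_cast h2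

theorem along_comb (k : ℕ) {a b : ℝ} (hab : a + b = 1) (t t' : ℝ) :
    P.along k (a * t + b * t') = a • P.along k t + b • P.along k t' := by
  have h : (a : ℂ) + b = 1 := by exact_mod_cast hab
  simp only [along_eq, Complex.real_smul]
  push_cast
  linear_combination (-P.q k) * h

/-- A vector of height `0` in the direction of the normal of a side is parallel to that side. -/
theorem exists_eq_smul_of_height {k : ℕ} {v : ℂ} (hv : P.heightLin (P.normal k) v = 0) :
    ∃ β : ℝ, v = β * (P.q (k + 1) - P.q k) := by
  set κ := P.arm⁻¹ * Complex.exp (-(P.normal k * Complex.I)) with hκ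
  have hκ0 : κ ≠ 0 := mul_ne_zero (inv_ne_zero P.arm_ne_zero) (Complex.exp_ne_zero _)
  have happ : ∀ z, P.heightLin (P.normal k) z = (z * κ).re := fun z => rfl
  set e := P.q (k + 1) - P.q k with he
  have he0 : e ≠ 0 := sub_ne_zero.2 (P.q_ne_q_succ k).symm
  have hee : (e * κ).re = 0 := by
    rw [← happ, he, map_sub]
    have h1 := P.height_normal_self k
    have h2 := P.height_normal_succ k
    rw [height_eq] at h1 h2
    linarith
  rw [happ] at hv
  have h1 : (e * κ).im ≠ 0 := fun h => mul_ne_zero he0 hκ0 (Complex.ext hee h)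
  refine ⟨(v * κ).im / (e * κ).im, ?_⟩
  apply mul_right_cancel₀ hκ0
  rw [mul_assoc]
  apply Complex.ext
  · rw [Complex.re_ofReal_mul, hee, hv, mul_zero]
  · rw [Complex.im_ofReal_mul, div_mul_cancel₀ _ h1]

end UnitPolygon

namespace PolygonIFS

open scoped Classical

variable {S : Type*} [Fintype S] (F : PolygonIFS S)

/-- The parameters of the points of the side `L_k` which lie in `Ψ_b 𝒜`. -/
def trace (k : ℕ) (b : S) : Set ℝ :=
  {t | t ∈ Set.Icc (0 : ℝ) 1 ∧ F.poly.along k t ∈ F.Ψ b '' F.poly.body}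

variable {F}

theorem convex_image_body (b : S) : Convex ℝ (F.Ψ b '' F.poly.body) := by
  rintro _ ⟨x, hx, rfl⟩ _ ⟨y, hy, rfl⟩ a c ha hc hac
  rw [← F.Ψ_comb b hac]
  exact ⟨_, F.poly.convex_body hx hy ha hc hac, rfl⟩

theorem convex_trace (k : ℕ) (b : S) : Convex ℝ (F.trace k b) := by
  rintro x ⟨hx, hx'⟩ y ⟨hy, hy'⟩ a c ha hc hac
  refine ⟨convex_Icc _ _ hx hy ha hc hac, ?_⟩
  simp only [smul_eq_mul]
  rw [F.poly.along_comb k hac]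
  exact convex_image_body b hx' hy' ha hc hac

theorem isCompact_trace (k : ℕ) (b : S) : IsCompact (F.trace k b) := by
  refine (isCompact_Icc (a := (0 : ℝ)) (b := 1)).inter_right ?_
  exact (F.poly.isCompact_body.image (F.continuous_Ψ b)).isClosed.preimage
    (F.poly.continuous_along k)

theorem exists_mem_trace (hF : F.IsBorderedCarpet) (k : ℕ) {t : ℝ} (ht : t ∈ Set.Icc (0 : ℝ) 1) :
    ∃ b, t ∈ F.trace k b := by
  have := hF.bordered (F.poly.side_subset_bdry k (F.poly.along_mem_side ht))
  obtain ⟨b, hb⟩ := Set.mem_iUnion.1 this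
  exact ⟨b, ht, hb⟩

/-- The endpoints of the trace of a cell on a side are vertices of the cell. -/
theorem exists_vertex_of_endpoint {k : ℕ} {b : S} {t : ℝ} (ht : t ∈ F.trace k b)
    (hend : (∀ t' ∈ F.trace k b, t ≤ t') ∨ ∀ t' ∈ F.trace k b, t' ≤ t) :
    ∃ j, F.Ψ b (F.poly.q j) = F.poly.along k t := by
  obtain ⟨ht01, y, hy, hyt⟩ := ht
  -- it suffices that the preimage of the endpoint is an extreme point of the polygon: a segment
  -- through the endpoint inside the cell would have to lie in `L_k`, a face of the polygon
  have hext : y ∈ Set.extremePoints ℝ F.poly.body := by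
    refine mem_extremePoints_iff_left.2 ⟨hy, ?_⟩
    rintro y₁ hy₁ y₂ hy₂ ⟨a, c, ha, hc, hac, rfl⟩
    have hh := F.poly.height_normal_side (F.poly.along_mem_side (k := k) ht01)
    have h1 := F.poly.height_normal_le k (F.Ψ_mem_body b hy₁)
    have h2 := F.poly.height_normal_le k (F.Ψ_mem_body b hy₂)
    have hyt' := hyt
    rw [F.Ψ_comb b hac] at hyt'
    rw [← hyt', F.poly.height_comb _ hac] at hh
    have h3 : F.poly.height (F.poly.normal k) (F.Ψ b y₁) = F.poly.apothem := by
      have : a * F.poly.apothem + c * F.poly.apothem = F.poly.apothem := by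
        rw [← add_mul, hac, one_mul]
      have := mul_le_mul_of_nonneg_left h2 hc.le
      exact le_antisymm h1 (le_of_mul_le_mul_left (by linarith) ha)
    have h4 : F.poly.height (F.poly.normal k) (F.Ψ b y₂) = F.poly.apothem := by
      have : a * F.poly.apothem + c * F.poly.apothem = F.poly.apothem := by
        rw [← add_mul, hac, one_mul]
      have := mul_le_mul_of_nonneg_left h1 ha.le
      exact le_antisymm h2 (le_of_mul_le_mul_left (by linarith) hc)
    have h5 := F.poly.mem_side_of_height (F.Ψ_mem_body b hy₁) h3
    have h6 := F.poly.mem_side_of_height (F.Ψ_mem_body b hy₂) h4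
    rw [UnitPolygon.side_eq] at h5 h6
    obtain ⟨t₁, ht₁, e₁⟩ := h5
    obtain ⟨t₂, ht₂, e₂⟩ := h6
    have ht₁' : t₁ ∈ F.trace k b := ⟨ht₁, y₁, hy₁, e₁.symm⟩
    have ht₂' : t₂ ∈ F.trace k b := ⟨ht₂, y₂, hy₂, e₂.symm⟩
    have ht : t = a * t₁ + c * t₂ := by
      apply F.poly.along_injective k
      rw [F.poly.along_comb k hac, e₁, e₂, hyt']
    have hct : t = a * t + c * t := by rw [← add_mul, hac, one_mul]
    have : t₁ = t := by
      rcases hend with he | he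
      · have g1 := he _ ht₁'
        have g2 := mul_le_mul_of_nonneg_left (he _ ht₂') hc.le
        exact le_antisymm (le_of_mul_le_mul_left (by linarith) ha) g1
      · have g1 := he _ ht₁'
        have g2 := mul_le_mul_of_nonneg_left (he _ ht₂') hc.le
        exact le_antisymm g1 (le_of_mul_le_mul_left (by linarith) ha)
    apply F.injective_Ψ b
    rw [hyt, ← e₁, this]
  have h7 := extremePoints_convexHull_subset hext
  obtain ⟨j, -, rfl⟩ := h7
  exact ⟨j, hyt⟩

/-- Near an inner point of the trace of a cell on a side, the points on the way to the centre lie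
inside the cell. -/
theorem eventually_mem_interior {k : ℕ} {b : S} {t t₁ t₂ : ℝ} (ht₁ : t₁ ∈ F.trace k b)
    (ht₂ : t₂ ∈ F.trace k b) (h1 : t₁ < t) (h2 : t < t₂) :
    ∀ᶠ ε : ℝ in nhdsWithin (0 : ℝ) (Set.Ioi 0),
      F.poly.along k t + (ε : ℂ) * (F.poly.ctr - F.poly.along k t) ∈
        F.Ψ b '' interior F.poly.body := by
  set x := F.poly.along k t with hx
  set p := F.Ψ b F.poly.ctr with hp
  have ht : t ∈ F.trace k b := (convex_trace k b).ordConnected.out ht₁ ht₂ ⟨h1.le, h2.le⟩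
  have hpi : p ∈ interior F.poly.body := F.Ψ_mem_interior b F.poly.ctr_mem_interior
  set φ := F.poly.normal k with hφ
  have hhp := F.poly.height_lt_of_mem_interior k hpi
  have hhx := F.poly.height_normal_side (F.poly.along_mem_side (k := k) ht.1)
  have hhc := F.poly.height_ctr φ
  have hap := F.poly.apothem_pos
  rw [UnitPolygon.height_eq] at hhp hhx hhc
  -- the direction from `x` to the centre is `α (p - x)`, with `p` the centre of the cell, plus a
  -- vector parallel to the side; the first part points into the cell, the second is compensated by
  -- moving `x` along the side
  set α := F.poly.apothem / (F.poly.apothem -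
    (F.poly.heightLin φ p - F.poly.heightLin φ F.poly.ctr)) with hα
  have hden : 0 < F.poly.apothem - (F.poly.heightLin φ p - F.poly.heightLin φ F.poly.ctr) := by
    linarith
  have hα0 : 0 < α := div_pos hap hden
  have hαe : α * (F.poly.apothem - (F.poly.heightLin φ p - F.poly.heightLin φ F.poly.ctr)) =
      F.poly.apothem := div_mul_cancel₀ _ hden.ne'
  obtain ⟨β, hβ⟩ := F.poly.exists_eq_smul_of_height (k := k)
    (v := (F.poly.ctr - x) - α • (p - x)) (by
      rw [map_sub, map_smul, map_sub, map_sub, smul_eq_mul]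
      linear_combination (α - 1) * hhx + hαe)
  have hc1 : Filter.Tendsto (fun ε : ℝ => ε * α) (nhdsWithin 0 (Set.Ioi 0)) (nhds 0) := by
    have : Continuous fun ε : ℝ => ε * α := by fun_prop
    have := (this.tendsto 0).mono_left (nhdsWithin_le_nhds (s := Set.Ioi 0))
    simpa using this
  have hc2 : Filter.Tendsto (fun ε : ℝ => t + ε * β / (1 - ε * α)) (nhdsWithin 0 (Set.Ioi 0))
      (nhds t) := by
    have : ContinuousAt (fun ε : ℝ => t + ε * β / (1 - ε * α)) 0 := by
      refine continuousAt_const.add (ContinuousAt.div (by fun_prop) (by fun_prop) (by simp))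
    have := this.tendsto.mono_left (nhdsWithin_le_nhds (s := Set.Ioi 0))
    simpa using this
  filter_upwards [self_mem_nhdsWithin, hc1.eventually (gt_mem_nhds one_pos),
    hc2.eventually (Ioo_mem_nhds h1 h2)] with ε hε hε1 hε2
  have hε0 : 0 < ε := hε
  have hmem : t + ε * β / (1 - ε * α) ∈ F.trace k b :=
    (convex_trace k b).ordConnected.out ht₁ ht₂ ⟨hε2.1.le, hε2.2.le⟩
  have hpi' : p ∈ interior (F.Ψ b '' F.poly.body) := by
    have := F.image_interior_Ψw [b] F.poly.body
    rw [Ψw_singleton] at this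
    rw [← this]; exact ⟨_, F.poly.ctr_mem_interior, rfl⟩
  have hcomb := (convex_image_body b).combo_self_interior_mem_interior hmem.2 hpi'
    (a := 1 - ε * α) (b := ε * α) (by linarith) (mul_pos hε0 hα0) (by ring)
  have himg := F.image_interior_Ψw [b] F.poly.body
  rw [Ψw_singleton] at himg
  rw [himg]
  convert hcomb using 1
  have h0 : (1 : ℂ) - ε * α ≠ 0 := by
    have : (1 : ℝ) - ε * α ≠ 0 := by linarith
    exact_mod_cast this
  rw [UnitPolygon.along_eq] at hx
  rw [UnitPolygon.along_eq]
  simp only [Complex.real_smul] at hβ ⊢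
  push_cast
  have e1 : (1 - (ε : ℂ) * α) * (F.poly.q k + (t + ε * β / (1 - ε * α)) *
      (F.poly.q (k + 1) - F.poly.q k)) = (1 - (ε : ℂ) * α) * x +
      ε * (β * (F.poly.q (k + 1) - F.poly.q k)) := by
    rw [hx]; field_simp; ring
  rw [e1, ← hβ]; ring

/-- Two different cells do not overlap along a side. -/
theorem not_overlap (hF : F.IsBorderedCarpet) {k : ℕ} {b b' : S} (hb : b ≠ b')
    {t t₁ t₂ t₁' t₂' : ℝ} (ht₁ : t₁ ∈ F.trace k b) (ht₂ : t₂ ∈ F.trace k b)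
    (ht₁' : t₁' ∈ F.trace k b') (ht₂' : t₂' ∈ F.trace k b') (h1 : t₁ < t) (h2 : t < t₂)
    (h1' : t₁' < t) (h2' : t < t₂') : False := by
  obtain ⟨ε, hε, hε'⟩ := ((eventually_mem_interior ht₁ ht₂ h1 h2).and
    (eventually_mem_interior ht₁' ht₂' h1' h2')).exists
  exact Set.disjoint_left.1 (F.disjoint_interior hF hb) hε hε'

/-- Immediately to the left of every point of a side there is a cell with that point. -/
theorem exists_trace_left (hF : F.IsBorderedCarpet) (k : ℕ) {t : ℝ} (ht0 : 0 < t) (ht1 : t ≤ 1) :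
    ∃ b, t ∈ F.trace k b ∧ ∃ t₁ ∈ F.trace k b, t₁ < t := by
  by_contra hne
  push Not at hne
  -- otherwise no cell would contain the points just to the left, since the traces are closed
  have hev : ∀ b : S, ∀ᶠ u in nhdsWithin t (Set.Iio t), u ∉ F.trace k b := by
    intro b
    by_cases hb : t ∈ F.trace k b
    · filter_upwards [self_mem_nhdsWithin] with u hu hub
      exact absurd (hne b hb u hub) (not_le.2 hu)
    · exact nhdsWithin_le_nhds ((isCompact_trace k b).isClosed.isOpen_compl.mem_nhds hb)
  have hev' : ∀ᶠ u in nhdsWithin t (Set.Iio t), u ∈ Set.Icc (0 : ℝ) 1 := by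
    filter_upwards [self_mem_nhdsWithin, nhdsWithin_le_nhds (Ioi_mem_nhds ht0)] with u hu hu'
    exact ⟨le_of_lt hu', (le_of_lt hu).trans ht1⟩
  obtain ⟨u, hu, hu'⟩ := ((Filter.eventually_all.2 hev).and hev').exists
  obtain ⟨b, hb⟩ := exists_mem_trace hF k hu'
  exact hu b hb

/-! ### Profiles and close words -/

variable (F)

/-- A corner cell contains a vertex of the polygon. -/
def IsCorner (c : S) : Prop := ∃ k, F.poly.q k ∈ F.Ψ c '' F.poly.body

/-- A profile of depth `L` assigns to each word a number which changes by at most `δ` on passing to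
a corner child, and by at most `δ + η k * μ` between intersecting cells of ratio `≤ ρ_* ^ k`. -/
structure IsProfile (η : ℕ → ℝ) (L : ℕ) (δ μ : ℝ) (a : List S → ℝ) : Prop where
  μ_nonneg : 0 ≤ μ
  corner : ∀ τ c, τ.length + 1 ≤ L → F.IsCorner c → |a τ - a (τ ++ [c])| ≤ δ
  meet : ∀ k τ τ', τ.length ≤ L → τ'.length ≤ L → F.ρw τ ≤ F.ρmin ^ k → F.ρw τ' ≤ F.ρmin ^ k →
    (F.cell τ ∩ F.cell τ').Nonempty → |a τ - a τ'| ≤ δ + η k * μ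

/-- Two words are close if every sufficiently deep profile takes nearly the same value on them: up
to a multiple of `δ` and an arbitrarily small multiple of `μ`. -/
def Close (η : ℕ → ℝ) (τ τ' : List S) : Prop :=
  ∀ ε > 0, ∃ C ≥ 0, ∃ L₀ : ℕ, ∀ L ≥ L₀, ∀ δ μ a, F.IsProfile η L δ μ a →
    |a τ - a τ'| ≤ C * δ + ε * μ

variable {F} {η : ℕ → ℝ}

theorem Close.refl (τ : List S) : F.Close η τ τ := fun ε hε =>
  ⟨0, le_rfl, 0, fun L _ δ μ a h => by
    have := mul_nonneg hε.le h.μ_nonneg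
    simpa using this⟩

theorem Close.trans {τ τ' τ'' : List S} (h : F.Close η τ τ') (h' : F.Close η τ' τ'') :
    F.Close η τ τ'' := fun ε hε => by
  obtain ⟨C, hC, L₀, hL⟩ := h (ε / 2) (by positivity)
  obtain ⟨C', hC', L₀', hL'⟩ := h' (ε / 2) (by positivity)
  refine ⟨C + C', by positivity, max L₀ L₀', fun L hl δ μ a ha => ?_⟩
  have h1 := hL L ((le_max_left _ _).trans hl) δ μ a ha
  have h2 := hL' L ((le_max_right _ _).trans hl) δ μ a ha
  have := abs_sub_le (a τ) (a τ') (a τ'')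
  linarith

theorem close_corner (τ : List S) {c : S} (hc : F.IsCorner c) : F.Close η τ (τ ++ [c]) :=
  fun ε hε => ⟨1, zero_le_one, τ.length + 1, fun L hL δ μ a ha => by
    have h1 := ha.corner τ c hL hc
    have h2 := mul_nonneg hε.le ha.μ_nonneg
    linarith⟩

theorem exists_length_ρw_le (F : PolygonIFS S) (k : ℕ) :
    ∃ n, ∀ w : List S, n ≤ w.length → F.ρw w ≤ F.ρmin ^ k := by
  obtain ⟨r, hr0, hr1, hr⟩ := F.exists_ratio_bound
  obtain ⟨n, hn⟩ := exists_pow_lt_of_lt_one (pow_pos F.ρmin_pos k) hr1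
  refine ⟨n, fun w hw => ?_⟩
  have h : F.ρw w ≤ r ^ w.length := by
    clear hw
    induction w with
    | nil => simp [ρw_nil]
    | cons i w ih =>
      rw [ρw_cons, List.length_cons, pow_succ']
      exact mul_le_mul (hr i) ih (F.ρw_pos w).le hr0.le
  exact (h.trans (pow_le_pow_of_le_one hr0.le hr1.le hw)).trans hn.le

/-- Words are close if they are close to arbitrarily small intersecting cells. -/
theorem close_of_meet (hη : ∀ ε > 0, ∃ k, η k ≤ ε) {τ τ' : List S}
    (h : ∀ n : ℕ, ∃ σ σ', F.Close η τ σ ∧ F.Close η τ' σ' ∧ n ≤ σ.length ∧ n ≤ σ'.length ∧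
      (F.cell σ ∩ F.cell σ').Nonempty) : F.Close η τ τ' := by
  intro ε hε
  obtain ⟨k, hk⟩ := hη (ε / 3) (by positivity)
  obtain ⟨n, hn⟩ := F.exists_length_ρw_le k
  obtain ⟨σ, σ', h1, h2, hσ, hσ', hm⟩ := h n
  obtain ⟨C, hC, L₀, hL⟩ := h1 (ε / 3) (by positivity)
  obtain ⟨C', hC', L₀', hL'⟩ := h2 (ε / 3) (by positivity)
  refine ⟨C + C' + 1, by positivity, max (max L₀ L₀') (max σ.length σ'.length),
    fun L hl δ μ a ha => ?_⟩
  simp only [ge_iff_le, max_le_iff] at hl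
  have e1 := hL L hl.1.1 δ μ a ha
  have e2 := hL' L hl.1.2 δ μ a ha
  have e3 := ha.meet k σ σ' hl.2.1 hl.2.2 (hn _ hσ) (hn _ hσ') hm
  have e4 := abs_sub_le (a τ) (a σ) (a τ')
  have e5 := abs_sub_le (a σ) (a σ') (a τ')
  rw [abs_sub_comm (a τ')] at e2
  have e6 := mul_le_mul_of_nonneg_right hk ha.μ_nonneg
  linarith

variable (F η) in
/-- The word `β` links every word `τ` to `τ β`. -/
def Link (β : List S) : Prop := ∀ τ, F.Close η τ (τ ++ β)

theorem Link.cons {b : S} {β : List S} (hb : F.Link η [b]) (hβ : F.Link η β) :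
    F.Link η (b :: β) := fun τ => by
  have := (hb τ).trans (hβ (τ ++ [b]))
  simpa using this

theorem Link.nil : F.Link η [] := fun τ => by simpa using Close.refl τ

theorem link_corner {c : S} (hc : F.IsCorner c) : F.Link η [c] := fun τ => close_corner τ hc

theorem exists_corner (hF : F.IsBorderedCarpet) (j : ℕ) :
    ∃ c, F.IsCorner c ∧ ∃ j', F.Ψ c (F.poly.q j') = F.poly.q j := by
  obtain ⟨c, hc⟩ := exists_mem_trace hF j (t := 0) (by simp)
  obtain ⟨j', hj'⟩ := exists_vertex_of_endpoint hc (Or.inl fun t' ht' => ht'.1.1)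
  rw [UnitPolygon.along_zero] at hj'
  exact ⟨c, ⟨j, _, F.poly.q_mem_body j', hj'⟩, j', hj'⟩

/-- Every vertex is a vertex of nested corner cells, to any depth. -/
theorem exists_link_vertex (hF : F.IsBorderedCarpet) (n : ℕ) (j : ℕ) :
    ∃ β : List S, β.length = n ∧ F.Link η β ∧ ∃ j', F.Ψw β (F.poly.q j') = F.poly.q j := by
  induction n generalizing j with
  | zero => exact ⟨[], rfl, Link.nil, j, rfl⟩
  | succ n ih =>
    obtain ⟨c, hc, j₁, hj₁⟩ := exists_corner hF j
    obtain ⟨β, hβ, hl, j₂, hj₂⟩ := ih j₁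
    refine ⟨c :: β, by simp [hβ], (link_corner hc).cons hl, j₂, ?_⟩
    rw [Ψw_cons, Function.comp_apply, hj₂, hj₁]

/-- Two extensions of a word meet if they have a common boundary point. -/
theorem cell_inter_of_eq (hF : F.IsBorderedCarpet) (τ : List S) {β β' : List S} {y y' : ℂ}
    (hy : y ∈ F.poly.bdry) (hy' : y' ∈ F.poly.bdry) (h : F.Ψw β y = F.Ψw β' y') :
    (F.cell (τ ++ β) ∩ F.cell (τ ++ β')).Nonempty := by
  refine ⟨F.Ψw τ (F.Ψw β y), ?_, ?_⟩
  · rw [cell_append]; exact ⟨_, ⟨y, F.bdry_subset_K hF hy, rfl⟩, rfl⟩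
  · rw [cell_append, h]; exact ⟨_, ⟨y', F.bdry_subset_K hF hy', rfl⟩, rfl⟩

/-- Two cells with a common point are close if the point is reached in either of them by linked words
of any length: then they contain small intersecting cells that are close to them. -/
theorem close_of_link_points (hF : F.IsBorderedCarpet) (hη : ∀ ε > 0, ∃ k, η k ≤ ε)
    {b b' : S} {x x' : ℂ} (hxx : F.Ψ b x = F.Ψ b' x')
    (hx : ∀ n : ℕ, ∃ β : List S, β.length = n ∧ F.Link η β ∧ ∃ y ∈ F.poly.bdry, F.Ψw β y = x)
    (hx' : ∀ n : ℕ, ∃ β : List S, β.length = n ∧ F.Link η β ∧ ∃ y ∈ F.poly.bdry, F.Ψw β y = x')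
    (τ : List S) : F.Close η (τ ++ [b]) (τ ++ [b']) := by
  refine close_of_meet hη fun n => ?_
  obtain ⟨β, hβ, hl, y, hy, e⟩ := hx n
  obtain ⟨β', hβ', hl', y', hy', e'⟩ := hx' n
  refine ⟨_, _, hl _, hl' _, by simp [hβ]; omega, by simp [hβ']; omega, ?_⟩
  rw [List.append_assoc, List.append_assoc]
  refine cell_inter_of_eq hF τ hy hy' ?_
  rw [Ψw_append, Ψw_append, Function.comp_apply, Function.comp_apply, e, e']
  exact hxx

theorem close_of_vertex (hF : F.IsBorderedCarpet) (hη : ∀ ε > 0, ∃ k, η k ≤ ε)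
    {b b' : S} {j j' : ℕ} (h : F.Ψ b (F.poly.q j) = F.Ψ b' (F.poly.q j')) (τ : List S) :
    F.Close η (τ ++ [b]) (τ ++ [b']) := by
  refine close_of_link_points hF hη h (fun n => ?_) (fun n => ?_) τ
  · obtain ⟨β, hβ, hl, i, hi⟩ := exists_link_vertex (η := η) hF n j
    exact ⟨β, hβ, hl, _, F.poly.q_mem_bdry i, hi⟩
  · obtain ⟨β, hβ, hl, i, hi⟩ := exists_link_vertex (η := η) hF n j'
    exact ⟨β, hβ, hl, _, F.poly.q_mem_bdry i, hi⟩

/-- A cell with a side along `L_k` is linked to its parent: it is the last one of a chain of cells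
along `L_k`, each sharing a vertex with the next one, that starts with a corner cell. -/
theorem link_side (hF : F.IsBorderedCarpet) (hη : ∀ ε > 0, ∃ k, η k ≤ ε) (k : ℕ) {b : S}
    (hb : ∃ t₁ ∈ F.trace k b, ∃ t₂ ∈ F.trace k b, t₁ < t₂) : F.Link η [b] := by
  by_contra hne
  set T : Set S := {b | (∃ t₁ ∈ F.trace k b, ∃ t₂ ∈ F.trace k b, t₁ < t₂) ∧ ¬ F.Link η [b]}
    with hT
  -- take the leftmost cell that is not linked to its parent; its left neighbour is linked
  obtain ⟨b₀, ⟨⟨t₁, ht₁, t₂, ht₂, h12⟩, hnl⟩, hmin⟩ :=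
    Set.exists_min_image T (fun b => sInf (F.trace k b)) (Set.toFinite T) ⟨b, hb, hne⟩
  have hleast : ∀ c : S, (F.trace k c).Nonempty → IsLeast (F.trace k c) (sInf (F.trace k c)) :=
    fun c hc => (isCompact_trace k c).isLeast_sInf hc
  have hs := hleast b₀ ⟨t₁, ht₁⟩
  set s := sInf (F.trace k b₀) with hsdef
  have hst₂ : s < t₂ := (hs.2 ht₁).trans_lt h12
  rcases hs.1.1.1.eq_or_lt with h0 | h0
  · refine hnl (link_corner ⟨k, ?_⟩)
    have := hs.1.2
    rwa [← h0, UnitPolygon.along_zero] at this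
  obtain ⟨b', hsb', u, hu, hus⟩ := exists_trace_left hF k h0 hs.1.1.2
  have hs' := hleast b' ⟨u, hu⟩
  have hlt : sInf (F.trace k b') < s := (hs'.2 hu).trans_lt hus
  have hlink : F.Link η [b'] := by
    by_contra hn
    have := hmin b' ⟨⟨u, hu, s, hsb', hus⟩, hn⟩
    exact absurd this (not_le.2 hlt)
  have hbb : b₀ ≠ b' := by
    rintro rfl
    exact absurd hlt (lt_irrefl _)
  -- the left neighbour ends where the cell begins, so they share a vertex of both
  have hmax : ∀ t' ∈ F.trace k b', t' ≤ s := by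
    intro t' ht'
    by_contra hgt
    rw [not_le] at hgt
    have hm1 : s < min t₂ t' := lt_min hst₂ hgt
    refine not_overlap hF hbb hs.1 ht₂ hu ht' (t := (s + min t₂ t') / 2) ?_ ?_ ?_ ?_
    · linarith
    · have := min_le_left t₂ t'; linarith
    · linarith
    · have := min_le_right t₂ t'; linarith
  obtain ⟨j, hj⟩ := exists_vertex_of_endpoint hs.1 (Or.inl fun t' ht' => hs.2 ht')
  obtain ⟨j', hj'⟩ := exists_vertex_of_endpoint hsb' (Or.inr hmax)
  exact hnl fun τ => (hlink τ).trans (close_of_vertex hF hη (hj'.trans hj.symm) τ)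

/-- Every boundary point lies in a linked cell: in a corner cell, or in one that contains a piece of
the side to the left of the point. -/
theorem exists_link_of_mem_bdry (hF : F.IsBorderedCarpet) (hη : ∀ ε > 0, ∃ k, η k ≤ ε) {x : ℂ}
    (hx : x ∈ F.poly.bdry) : ∃ b, F.Link η [b] ∧ ∃ y ∈ F.poly.bdry, F.Ψ b y = x := by
  obtain ⟨k, -, hxk⟩ := F.poly.exists_mem_side hx
  rw [UnitPolygon.side_eq] at hxk
  obtain ⟨t, ht, rfl⟩ := hxk
  have key : ∀ b, F.Link η [b] → t ∈ F.trace k b →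
      ∃ b, F.Link η [b] ∧ ∃ y ∈ F.poly.bdry, F.Ψ b y = F.poly.along k t := by
    rintro b hb ⟨-, y, hy, hyt⟩
    exact ⟨b, hb, y, F.mem_bdry_of_Ψ_mem_bdry b hy (by rw [hyt]; exact hx), hyt⟩
  rcases ht.1.eq_or_lt with h0 | h0
  · obtain ⟨b, hb⟩ := exists_mem_trace hF k ht
    refine key b (link_corner ⟨k, ?_⟩) hb
    have := hb.2
    rwa [← h0, UnitPolygon.along_zero] at this
  · obtain ⟨b, hb, u, hu, hut⟩ := exists_trace_left hF k h0 ht.2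
    exact key b (link_side hF hη k ⟨u, hu, t, hb, hut⟩) hb

theorem exists_link_bdry (hF : F.IsBorderedCarpet) (hη : ∀ ε > 0, ∃ k, η k ≤ ε) (n : ℕ) {x : ℂ}
    (hx : x ∈ F.poly.bdry) :
    ∃ β : List S, β.length = n ∧ F.Link η β ∧ ∃ y ∈ F.poly.bdry, F.Ψw β y = x := by
  induction n generalizing x with
  | zero => exact ⟨[], rfl, Link.nil, x, hx, rfl⟩
  | succ n ih =>
    obtain ⟨b, hb, y, hy, rfl⟩ := exists_link_of_mem_bdry hF hη hx
    obtain ⟨β, hβ, hl, z, hz, rfl⟩ := ih hy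
    exact ⟨b :: β, by simp [hβ], hb.cons hl, z, hz, rfl⟩

/-- Intersecting cells with the same parent are close: the point where they meet lies on the boundary
of both, so it can be followed down by linked words. -/
theorem close_of_inter (hF : F.IsBorderedCarpet) (hη : ∀ ε > 0, ∃ k, η k ≤ ε) {i j : S}
    (h : (F.Ψ i '' F.K ∩ F.Ψ j '' F.K).Nonempty) (τ : List S) :
    F.Close η (τ ++ [i]) (τ ++ [j]) := by
  rcases eq_or_ne i j with rfl | hij
  · exact Close.refl _
  obtain ⟨x, hxi, hxj⟩ := h
  have hxi' := Set.image_mono F.K_subset_body hxi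
  have hxj' := Set.image_mono F.K_subset_body hxj
  obtain ⟨y, hy, hyx⟩ := F.mem_image_bdry_of_ne hF hij hxi' hxj'
  obtain ⟨y', hy', hyx'⟩ := F.mem_image_bdry_of_ne hF hij.symm hxj' hxi'
  exact close_of_link_points hF hη (hyx.trans hyx'.symm)
    (fun n => exists_link_bdry hF hη n hy) (fun n => exists_link_bdry hF hη n hy') τ

/-- The cells that are linked to their parent and the other ones would cover `K` by two closed sets.
As `K` is connected, cells of the two kinds would meet, and then be close. -/
theorem link_letter (hF : F.IsBorderedCarpet) (hη : ∀ ε > 0, ∃ k, η k ≤ ε) (i : S) :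
    F.Link η [i] := by
  by_contra hne
  have hcl : ∀ X : Set S, IsClosed (⋃ u ∈ X, F.Ψ u '' F.K) := fun X =>
    ((Set.toFinite X).isCompact_biUnion fun u _ => F.isCompact_K.image (F.continuous_Ψ u)).isClosed
  have hpre := hF.connected.isPreconnected
  rw [isPreconnected_closed_iff] at hpre
  obtain ⟨z, hz⟩ := F.K_nonempty
  have hmem : ∀ X : Set S, ∀ u ∈ X, (F.K ∩ ⋃ u ∈ X, F.Ψ u '' F.K).Nonempty := fun X u hu =>
    ⟨F.Ψ u z, F.Ψ_mem_K u hz, Set.mem_biUnion hu ⟨z, hz, rfl⟩⟩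
  obtain ⟨c, hc, -⟩ := exists_corner hF 1
  obtain ⟨x, -, hx1, hx2⟩ := hpre _ _ (hcl {i | F.Link η [i]}) (hcl {i | ¬ F.Link η [i]}) (by
      intro x hx
      rw [K_eq] at hx
      obtain ⟨u, hu⟩ := Set.mem_iUnion.1 hx
      by_cases h : F.Link η [u]
      · exact Or.inl (Set.mem_biUnion (show u ∈ {i | F.Link η [i]} from h) hu)
      · exact Or.inr (Set.mem_biUnion (show u ∈ {i | ¬ F.Link η [i]} from h) hu))
    (hmem _ c (link_corner hc)) (hmem _ i hne)
  simp only [Set.mem_iUnion] at hx1 hx2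
  obtain ⟨a, ha, hxa⟩ := hx1
  obtain ⟨b, hb, hxb⟩ := hx2
  exact hb fun τ => (ha τ).trans (close_of_inter hF hη ⟨x, hxa, hxb⟩ τ)

/-- Every word is close to the empty word. -/
theorem close_nil (hF : F.IsBorderedCarpet) (hη : ∀ ε > 0, ∃ k, η k ≤ ε) (w : List S) :
    F.Close η [] w := by
  have : F.Link η w := by
    induction w with
    | nil => exact Link.nil
    | cons i w ih => exact (link_letter hF hη i).cons ih
  simpa using this []

end PolygonIFS

namespace PolygonIFS

open scoped Classical

variable {S : Type*} [Fintype S] (F : PolygonIFS S)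

/-! ### Comparison of `σ_m` with the maximal resistance -/

/-- An average deviates from `c` by no more than the values do. -/
theorem abs_avg_sub_le {A : Finset (List S)} (hA : A.Nonempty) {f : List S → ℝ} {c D : ℝ}
    (h : ∀ u ∈ A, |f u - c| ≤ D) : |F.avg A f - c| ≤ D := by
  have hpos : ∀ u : List S, 0 < F.ρw u ^ F.dH := fun u => Real.rpow_pos_of_pos (F.ρw_pos u) _
  set W := ∑ u ∈ A, F.ρw u ^ F.dH with hW
  have hW0 : 0 < W := Finset.sum_pos (fun u _ => hpos u) hA
  have h1 : F.avg A f - c = W⁻¹ * ∑ u ∈ A, F.ρw u ^ F.dH * (f u - c) := by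
    simp_rw [mul_sub]
    rw [Finset.sum_sub_distrib, ← Finset.sum_mul, ← hW, mul_sub, ← mul_assoc,
      inv_mul_cancel₀ hW0.ne', one_mul, avg]
  rw [h1, abs_mul, abs_of_pos (inv_pos.2 hW0), inv_mul_le_iff₀ hW0]
  refine (Finset.abs_sum_le_sum_abs _ _).trans ?_
  rw [hW, Finset.sum_mul]
  refine Finset.sum_le_sum fun u hu => ?_
  rw [abs_mul, abs_of_pos (hpos u)]
  exact mul_le_mul_of_nonneg_left (h u hu) (hpos u).le

theorem append_mem_cut {s : ℝ} {τ v : List S} (hs : s ≤ F.ρw τ) (hv : v ∈ F.cut (s / F.ρw τ)) :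
    τ ++ v ∈ F.cut s :=
  F.mem_cut.2 ((F.isCut_append_iff hs).2 (F.mem_cut.1 hv))

theorem append_inter_nonempty (τ : List S) {v v' : List S}
    (h : (F.cell v ∩ F.cell v').Nonempty) : (F.cell (τ ++ v) ∩ F.cell (τ ++ v')).Nonempty := by
  rw [cell_append, cell_append]
  exact (h.image (F.Ψw τ)).mono (Set.image_inter_subset _ _ _)

/-- The energy of the restriction of a function to the cell of `τ`, read on the whole carpet. -/
theorem energy_append_le {s : ℝ} {A : Finset (List S)} {τ : List S}
    (hA : ∀ v ∈ F.cut (s / F.ρw τ), τ ++ v ∈ A) (f : List S → ℝ) :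
    F.energy (F.cut (s / F.ρw τ)) (fun v => f (τ ++ v)) ≤ F.energy A f :=
  F.energy_comp_le_of_injOn (φ := fun v => τ ++ v) hA (fun _ _ _ _ h => List.append_cancel_left h)
    (fun _ _ _ _ h => ⟨fun e => h.1 (List.append_cancel_left e), F.append_inter_nonempty τ h.2⟩) f

/-- The averages that define `σ_m` differ by no more than the oscillation of `f`. As `ℬ_m(w)` is defined
by inclusion of cells, its words need not extend `w`; each of them has a neighbour that does, and on
the words that extend `w` the oscillation is at most a maximal resistance. -/
theorem exists_sigma_le (hF : F.IsBorderedCarpet) : ∃ C : ℝ, 0 < C ∧ ∃ m₀ : ℕ, 1 ≤ m₀ ∧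
    ∀ m ≥ m₀, F.sigma m ≤ ENNReal.ofReal (C * F.maxRes (F.ρmin ^ m)) := by
  obtain ⟨C₁, hC₁, s₁, hs₁, h₁⟩ := F.exists_mul_energy_le hF
  obtain ⟨C₂, hC₂, s₂, hs₂, h₂⟩ := F.exists_maxRes_le hF
  have hρ := F.ρmin_pos
  obtain ⟨m₀, hm₀⟩ := exists_pow_lt_of_lt_one (lt_min hs₁ hs₂) F.ρmin_lt_one
  refine ⟨(3 * √C₁ + 2 * √C₂) ^ 2, by positivity, m₀ + 1, by omega, fun m hm => ?_⟩
  set s := F.ρmin ^ m with hs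
  have hs0 : 0 < s := pow_pos hρ m
  have hsm : s ≤ min s₁ s₂ :=
    (pow_le_pow_of_le_one hρ.le F.ρmin_lt_one.le (by omega)).trans hm₀.le
  have hs1 : s ≤ 1 := pow_le_one₀ hρ.le F.ρmin_lt_one.le
  set M := F.maxRes s with hM
  have hM0 : 0 ≤ M := F.maxRes_nonneg s
  -- the differences between neighbours are at most `1`, which the lower bound for `M` absorbs
  have hone : 1 ≤ √C₁ * √M := by
    rw [← Real.sqrt_mul hC₁.le, Real.one_le_sqrt]
    simpa using h₁ s 0 hs0 (hsm.trans (min_le_left _ _)) (by simpa using hs1)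
  have key : ∀ n : ℕ, 1 ≤ n → ∀ w ∈ F.Λ n, ∀ A : Finset (List S), F.B n m w ⊆ A →
      ∀ f, F.energy A f = 1 → F.Λ (n + m) = F.cut (F.ρmin ^ (n + m)) ∧
      (∀ v ∈ F.cut (F.ρmin ^ (n + m) / F.ρw w), w ++ v ∈ F.B n m w) ∧
      (∀ v ∈ F.cut (F.ρmin ^ (n + m) / F.ρw w), ∀ v' ∈ F.cut (F.ρmin ^ (n + m) / F.ρw w),
        |f (w ++ v) - f (w ++ v')| ≤ √C₂ * √M) ∧
      ∀ u ∈ F.B n m w, ∃ v ∈ F.cut (F.ρmin ^ (n + m) / F.ρw w), |f u - f (w ++ v)| ≤ 1 := by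
    intro n hn w hw A hA f hf
    rw [F.Λ_eq_cut hn] at hw
    have hΛ := F.Λ_eq_cut (m := n + m) (by omega)
    have hw' := F.mem_cut.1 hw
    have hwp := F.ρw_pos w
    have hle := IsCut.le F hw'
    have hge := IsCut.ge F hw' (by
      rw [← pow_succ']; exact pow_le_one₀ hρ.le F.ρmin_lt_one.le)
    have hsw : F.ρmin ^ (n + m) ≤ F.ρw w := by
      refine le_trans ?_ hge
      rw [← pow_succ']
      exact pow_le_pow_of_le_one hρ.le F.ρmin_lt_one.le (by omega)
    set t := F.ρmin ^ (n + m) / F.ρw w with ht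
    have hst : s ≤ t := by
      rw [ht, le_div_iff₀ hwp, pow_add, mul_comm]
      exact mul_le_mul_of_nonneg_right hle hs0.le
    have ht1 : t ≤ 1 := by rw [ht, div_le_one hwp]; exact hsw
    have hB : ∀ v ∈ F.cut t, w ++ v ∈ F.B n m w := fun v hv => by
      rw [B, Finset.mem_filter, hΛ]
      exact ⟨F.append_mem_cut hsw hv, F.cell_append_subset w v⟩
    refine ⟨hΛ, hB, fun v hv v' hv' => ?_, fun u hu => ?_⟩
    · have h3 := F.energy_append_le (fun v hv => hA (hB v hv)) f
      rw [hf] at h3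
      refine (F.abs_sub_le_maxRes hF h3 hv hv').trans ?_
      rw [← Real.sqrt_mul hC₂.le]
      refine Real.sqrt_le_sqrt ?_
      simpa using h₂ s t 0 hs0 (hsm.trans (min_le_right _ _)) hst ht1 (by simpa using hst)
    · have hu' := (Finset.mem_filter.1 hu).2
      obtain ⟨x, hx⟩ := F.cell_nonempty u
      obtain ⟨v, hv, hxv⟩ := F.exists_isCut_of_mem_cell (pow_pos hρ (n + m)) (hu' hx)
      refine ⟨v, F.mem_cut.2 hv, ?_⟩
      have := F.abs_sub_le_sqrt_energy (hA hu) (hA (hB v (F.mem_cut.2 hv))) ⟨x, hx, hxv⟩ f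
      rwa [hf, Real.sqrt_one] at this
  refine iSup_le fun n => iSup_le fun hn => iSup_le fun w => iSup_le fun hw => iSup_le fun w' =>
    iSup_le fun hw' => iSup_le fun hadj => iSup_le fun f => iSup_le fun hf => ?_
  obtain ⟨-, hB, hosc, hnear⟩ := key n hn w hw _ Finset.subset_union_left f hf
  obtain ⟨-, hB', hosc', hnear'⟩ := key n hn w' hw' _ Finset.subset_union_right f hf
  obtain ⟨x, hx, hx'⟩ := hadj.2
  obtain ⟨v, hv, hxv⟩ := F.exists_isCut_of_mem_cell (pow_pos hρ (n + m)) hx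
  obtain ⟨v', hv', hxv'⟩ := F.exists_isCut_of_mem_cell (pow_pos hρ (n + m)) hx'
  rw [← mem_cut] at hv hv'
  have hmid := F.abs_sub_le_sqrt_energy (Finset.mem_union_left _ (hB v hv))
    (Finset.mem_union_right _ (hB' v' hv')) ⟨x, hxv, hxv'⟩ f
  rw [hf, Real.sqrt_one] at hmid
  have hall : ∀ u ∈ F.B n m w, ∀ u' ∈ F.B n m w', |f u - f u'| ≤ (3 * √C₁ + 2 * √C₂) * √M := by
    intro u hu u' hu'
    obtain ⟨y, hy, h3⟩ := hnear u hu
    obtain ⟨y', hy', h3'⟩ := hnear' u' hu'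
    have h4 := hosc y hy v hv
    have h4' := hosc' v' hv' y' hy'
    have e : f u - f u' = (f u - f (w ++ y)) + (f (w ++ y) - f (w ++ v)) +
        (f (w ++ v) - f (w' ++ v')) + (f (w' ++ v') - f (w' ++ y')) + (f (w' ++ y') - f u') := by
      ring
    rw [abs_sub_comm] at h3'
    rw [abs_le] at *
    constructor <;> linarith [h3.1, h3.2, h3'.1, h3'.2, h4.1, h4.2, h4'.1, h4'.2, hmid.1, hmid.2]
  have hne : (F.B n m w).Nonempty := ⟨_, hB v hv⟩
  have hne' : (F.B n m w').Nonempty := ⟨_, hB' v' hv'⟩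
  have hfin : |F.avg (F.B n m w) f - F.avg (F.B n m w') f| ≤ (3 * √C₁ + 2 * √C₂) * √M := by
    refine F.abs_avg_sub_le hne fun u hu => ?_
    rw [abs_sub_comm]
    refine F.abs_avg_sub_le hne' fun u' hu' => ?_
    rw [abs_sub_comm]
    exact hall u hu u' hu'
  refine ENNReal.ofReal_le_ofReal ?_
  rw [← sq_abs]
  calc _ ≤ ((3 * √C₁ + 2 * √C₂) * √M) ^ 2 := pow_le_pow_left₀ (abs_nonneg _) hfin 2
    _ = _ := by rw [mul_pow, Real.sq_sqrt hM0]

end PolygonIFS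

namespace PolygonIFS

open scoped Classical

variable {S : Type*} [Fintype S] (F : PolygonIFS S)

/-! ### Chains of cells along which a function is nearly constant -/

/-- If the resistance between `w₀` and `v₀` is at most `R`, they cannot be separated within a
sublevel set of a function of small energy. -/
theorem reachable_sublevel {A : Finset (List S)} {R θ : ℝ} {w₀ v₀ : List S} (hw₀ : w₀ ∈ A)
    (hR : ∀ f : List S → ℝ, (f w₀ - f v₀) ^ 2 ≤ R * F.energy A f) (hR0 : 0 ≤ R)
    {φ : List S → ℝ} (hφ : φ w₀ = 0) (hθ : 0 ≤ θ) (hlt : R * F.energy A φ < θ ^ 2) :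
    (F.graph {v | v ∈ A ∧ φ v ≤ θ}).Reachable w₀ v₀ := by
  by_contra hne
  set G := F.graph {v | v ∈ A ∧ φ v ≤ θ} with hG
  have hsub : ∀ v, G.Reachable w₀ v → v ∈ A ∧ φ v ≤ θ := by
    intro v hv
    obtain ⟨p⟩ := hv.symm
    cases p with
    | nil => exact ⟨hw₀, by rw [hφ]; exact hθ⟩
    | cons h p => exact h.1
  have hstep : ∀ x y, G.Reachable w₀ x → ¬ G.Reachable w₀ y → y ∈ A → F.Adj x y →
      |φ x - θ| ≤ |φ x - φ y| := by
    intro x y hx hy hyA hxy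
    have h1 := (hsub x hx).2
    have h2 : θ < φ y := by
      by_contra hle
      have ha : G.Adj x y := ⟨hsub x hx, ⟨hyA, not_lt.1 hle⟩, hxy⟩
      exact hy (hx.trans ha.reachable)
    rw [abs_of_nonpos (by linarith), abs_of_nonpos (by linarith)]
    linarith
  -- cut `φ` off at height `θ` outside the component of `w₀`: this separates `w₀` and `v₀`, and it
  -- does not increase the energy
  set f : List S → ℝ := fun v => if G.Reachable w₀ v then φ v else θ with hf
  have hle : F.energy A f ≤ F.energy A φ := by
    refine F.energy_le_of_le fun x hx y hy hxy => ?_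
    simp only [hf]
    split_ifs with h1 h2 h2
    · exact le_rfl
    · exact hstep x y h1 h2 hy hxy
    · rw [abs_sub_comm, abs_sub_comm (φ x)]
      exact hstep y x h2 h1 hx (Adj.symm' F hxy)
    · simp
  have h3 := hR f
  have e1 : f w₀ = 0 := by simp only [hf]; rw [if_pos (SimpleGraph.Reachable.refl _), hφ]
  have e2 : f v₀ = θ := if_neg hne
  rw [e1, e2] at h3
  have := mul_le_mul_of_nonneg_left hle hR0
  nlinarith

/-- Resistances between different cells are bounded below. -/
theorem one_le_of_resistance {A : Finset (List S)} {d : ℕ}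
    (hd : ∀ x ∈ A, (A.filter fun y => F.Adj x y).card ≤ d) {R : ℝ} (hR0 : 0 ≤ R)
    {w₀ v₀ : List S} (hw₀ : w₀ ∈ A) (hne : w₀ ≠ v₀)
    (hR : ∀ f : List S → ℝ, (f w₀ - f v₀) ^ 2 ≤ R * F.energy A f) : 1 ≤ d * R := by
  -- test with the indicator function of `w₀`, whose energy is the degree of `w₀`
  set f : List S → ℝ := fun v => if v = w₀ then 1 else 0 with hf
  have h1 := hR f
  have e1 : f w₀ = 1 := if_pos rfl
  have e2 : f v₀ = 0 := if_neg hne.symm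
  rw [e1, e2] at h1
  have h2 : F.energy A f ≤ d := by
    have hdeg : ∑ y ∈ A, (if F.Adj w₀ y then (1 : ℝ) else 0) ≤ d := by
      rw [Finset.sum_boole]; exact_mod_cast hd w₀ hw₀
    have hb : ∀ x ∈ A, ∀ y ∈ A, (if F.Adj x y then (f x - f y) ^ 2 else 0) ≤
        (if x = w₀ then (if F.Adj w₀ y then (1 : ℝ) else 0) else 0) +
        (if y = w₀ then (if F.Adj w₀ x then (1 : ℝ) else 0) else 0) := by
      intro x _ y _
      have p1 : 0 ≤ (if x = w₀ then (if F.Adj w₀ y then (1 : ℝ) else 0) else 0) := by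
        split_ifs <;> norm_num
      have p2 : 0 ≤ (if y = w₀ then (if F.Adj w₀ x then (1 : ℝ) else 0) else 0) := by
        split_ifs <;> norm_num
      by_cases ha : F.Adj x y
      · rw [if_pos ha]
        by_cases hx : x = w₀
        · by_cases hy : y = w₀
          · exact absurd (hx.trans hy.symm) ha.1
          · subst hx
            simp [hf, hy, ha]
        · by_cases hy : y = w₀
          · subst hy
            simp [hf, hx, Adj.symm' F ha]
          · simp [hf, hx, hy]
      · rw [if_neg ha]; exact add_nonneg p1 p2
    have hs := Finset.sum_le_sum fun x hx => Finset.sum_le_sum fun y hy => hb x hx y hy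
    have hsum : ∑ x ∈ A, ∑ y ∈ A,
        ((if x = w₀ then (if F.Adj w₀ y then (1 : ℝ) else 0) else 0) +
        (if y = w₀ then (if F.Adj w₀ x then (1 : ℝ) else 0) else 0)) =
        2 * ∑ y ∈ A, (if F.Adj w₀ y then (1 : ℝ) else 0) := by
      simp_rw [Finset.sum_add_distrib]
      have a1 : ∑ x ∈ A, ∑ y ∈ A, (if x = w₀ then (if F.Adj w₀ y then (1 : ℝ) else 0) else 0) =
          ∑ y ∈ A, (if F.Adj w₀ y then (1 : ℝ) else 0) := by
        rw [Finset.sum_comm]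
        refine Finset.sum_congr rfl fun y _ => ?_
        rw [Finset.sum_ite_eq' A w₀, if_pos hw₀]
      have a2 : ∑ x ∈ A, ∑ y ∈ A, (if y = w₀ then (if F.Adj w₀ x then (1 : ℝ) else 0) else 0) =
          ∑ y ∈ A, (if F.Adj w₀ y then (1 : ℝ) else 0) := by
        refine Finset.sum_congr rfl fun y _ => ?_
        rw [Finset.sum_ite_eq' A w₀, if_pos hw₀]
      rw [a1, a2]; ring
    rw [hsum] at hs
    unfold energy
    linarith
  have h3 := mul_le_mul_of_nonneg_left h2 hR0
  linarith

/-- A function on the cells at scale `s`, restricted to the cell of `τ` and read at scale `s` on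
the whole carpet: `v` is replaced by its prefix at the coarser scale `s / ρ_τ`. -/
def zoom (s : ℝ) (u : List S → ℝ) (τ v : List S) : ℝ := u (τ ++ F.tr (s / F.ρw τ) v)

theorem pow_length_le_ρw (τ : List S) : F.ρmin ^ τ.length ≤ F.ρw τ := by
  induction τ with
  | nil => simp [ρw_nil]
  | cons i τ ih =>
    rw [List.length_cons, pow_succ', ρw_cons]
    exact mul_le_mul (F.ρmin_le i) ih (pow_pos F.ρmin_pos _).le (F.ρ_pos i).le

theorem le_ρw_of_length {s : ℝ} {L : ℕ} (hs : s ≤ F.ρmin ^ L) {τ : List S} (hτ : τ.length ≤ L) :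
    s ≤ F.ρw τ :=
  hs.trans ((pow_le_pow_of_le_one F.ρmin_pos.le F.ρmin_lt_one.le hτ).trans (F.pow_length_le_ρw τ))

/-- A zoom at bounded depth reads a part of `u` at a scale which is coarser by a bounded factor only,
so it has bounded energy. -/
theorem exists_energy_zoom_le (hF : F.IsBorderedCarpet) (L : ℕ) : ∃ C : ℝ, 0 ≤ C ∧
    ∀ s, 0 < s → s ≤ F.ρmin ^ L → ∀ u, F.energy (F.cut s) u ≤ 1 → ∀ τ : List S, τ.length ≤ L →
      F.energy (F.cut s) (F.zoom s u τ) ≤ C ^ 2 := by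
  have hρ := F.ρmin_pos
  have hq := F.areaRatio_pos
  refine ⟨1 / F.areaRatio / (F.ρmin ^ (L + 1)) ^ 2, by positivity, fun s hs hsL u hu τ hτ => ?_⟩
  have hsτ := F.le_ρw_of_length hsL hτ
  have hp := F.ρw_pos τ
  set t := s / F.ρw τ with ht
  have ht1 : t ≤ 1 := by rw [ht, div_le_one hp]; exact hsτ
  have hst : s ≤ t := by
    rw [ht, le_div_iff₀ hp]; exact mul_le_of_le_one_right hs.le (F.ρw_le_one τ)
  have hpow : F.ρmin ^ L ≤ F.ρw τ :=
    (pow_le_pow_of_le_one hρ.le F.ρmin_lt_one.le hτ).trans (F.pow_length_le_ρw τ)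
  have hpart := F.energy_append_le (s := s) (τ := τ) (fun v hv => F.append_mem_cut hsτ hv) u
  have hcomp := F.energy_comp_le (A := F.cut s) (B := F.cut t) (φ := F.tr t)
    (fun w hw => F.tr_mem_cut hst hw) (fun w _ v _ h => F.tr_eq_or_adj t h)
    (n := 1 / F.areaRatio / (F.ρmin ^ (L + 1)) ^ 2) (fun b hb => by
      have h1 := F.card_fiber_le hF hs hst ht1 (k := 0) (by simpa using hst) hb
      have h2 : s / t = F.ρw τ := by rw [ht]; field_simp
      rw [h2, pow_zero] at h1
      rw [le_div_iff₀ (by positivity)]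
      refine le_trans (mul_le_mul_of_nonneg_left ?_ (Nat.cast_nonneg _)) h1
      refine pow_le_pow_left₀ (by positivity) ?_ 2
      rw [pow_succ']
      exact mul_le_mul_of_nonneg_left hpow hρ.le) (fun v => u (τ ++ v))
  refine hcomp.trans ?_
  exact mul_le_of_le_one_right (by positivity) (hpart.trans hu)

theorem adj_act (hF : F.IsBorderedCarpet) {g : ℂ ≃ᵢ ℂ} (hg : g ∈ F.poly.symmetries) {s : ℝ}
    {w v : List S} (hw : w ∈ F.cut s) (hv : v ∈ F.cut s) (h : F.Adj w v) :
    F.Adj (F.act hF g w) (F.act hF g v) := by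
  refine ⟨fun e => h.1 (act_inj hF hg (F.mem_cut.1 hw) (F.mem_cut.1 hv) e), ?_⟩
  rw [cell_act hF hg, cell_act hF hg]
  exact (h.2.image g).mono (Set.image_inter_subset _ _ _)

theorem energy_act_le (hF : F.IsBorderedCarpet) {g : ℂ ≃ᵢ ℂ} (hg : g ∈ F.poly.symmetries)
    (s : ℝ) (f : List S → ℝ) :
    F.energy (F.cut s) (fun v => f (F.act hF g v)) ≤ F.energy (F.cut s) f :=
  F.energy_comp_le_of_injOn (φ := F.act hF g) (fun _ h => act_mem_cut hF h)
    (fun _ hw _ hv e => act_inj hF hg (F.mem_cut.1 hw) (F.mem_cut.1 hv) e)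
    (fun _ hw _ hv h => F.adj_act hF hg hw hv h) f

/-- Two cells of small resistance are joined by a chain of cells along which all the zooms, at
bounded depth, of a function of unit energy are nearly constant, also after a symmetry. -/
theorem exists_walk (hF : F.IsBorderedCarpet) (L : ℕ) : ∃ C : ℝ, 0 ≤ C ∧
    ∀ s, 0 < s → s ≤ F.ρmin ^ L → ∀ u, F.energy (F.cut s) u ≤ 1 → ∀ R : ℝ, 0 < R →
    ∀ w₀ ∈ F.cut s, ∀ v₀,
      (∀ f : List S → ℝ, (f w₀ - f v₀) ^ 2 ≤ R * F.energy (F.cut s) f) →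
      ∃ p : (F.graph (F.cut s : Set (List S))).Walk w₀ v₀, ∀ v ∈ p.support,
        ∀ g ∈ F.poly.symmetries, ∀ τ : List S, τ.length ≤ L →
          |F.zoom s u τ (F.act hF g v) - F.zoom s u τ (F.act hF g w₀)| ≤ C * √R := by
  obtain ⟨D, hD, hDe⟩ := F.exists_energy_zoom_le hF L
  set T : Finset (List S) := (List.finite_length_le S L).toFinset with hT
  set G : Finset (ℂ ≃ᵢ ℂ) := F.poly.finite_symmetries.toFinset with hG
  set I := T ×ˢ G with hI
  refine ⟨I.card * D + 1, by positivity, fun s hs hsL u hu R hR w₀ hw₀ v₀ hres => ?_⟩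
  -- one function controls all the zooms and symmetries at once
  set φ : List S → ℝ := fun v => ∑ i ∈ I,
    |F.zoom s u i.1 (F.act hF i.2 v) - F.zoom s u i.1 (F.act hF i.2 w₀)| with hφ
  have hE : F.energy (F.cut s) φ ≤ (I.card * D) ^ 2 := by
    refine (F.energy_sum_abs_le I (F.cut s) (fun i v => F.zoom s u i.1 (F.act hF i.2 v))
      (fun i => F.zoom s u i.1 (F.act hF i.2 w₀))).trans ?_
    have : ∑ i ∈ I, F.energy (F.cut s) (fun v => F.zoom s u i.1 (F.act hF i.2 v)) ≤
        I.card * D ^ 2 := by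
      rw [← nsmul_eq_mul]
      refine Finset.sum_le_card_nsmul _ _ _ fun i hi => ?_
      rw [hI, Finset.mem_product] at hi
      have h1 : i.1.length ≤ L := by simpa [hT] using hi.1
      have h2 : i.2 ∈ F.poly.symmetries := by simpa [hG] using hi.2
      exact (F.energy_act_le hF h2 s _).trans (hDe s hs hsL u hu _ h1)
    calc _ ≤ (I.card : ℝ) * (I.card * D ^ 2) := mul_le_mul_of_nonneg_left this (Nat.cast_nonneg _)
      _ = _ := by ring
  have hφ0 : φ w₀ = 0 := by simp [hφ]
  have hreach := F.reachable_sublevel hw₀ hres hR.le hφ0 (θ := (I.card * D + 1) * √R)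
    (by positivity) (by
      rw [mul_pow, Real.sq_sqrt hR.le, mul_comm]
      refine mul_lt_mul_of_pos_right (hE.trans_lt ?_) hR
      have : 0 ≤ I.card * D := by positivity
      nlinarith)
  set V : Set (List S) := {v | v ∈ F.cut s ∧ φ v ≤ (I.card * D + 1) * √R} with hV
  obtain ⟨p⟩ := hreach
  have hle : F.graph V ≤ F.graph (F.cut s : Set (List S)) := F.graph_mono fun v hv => hv.1
  refine ⟨p.mapLe hle, fun v hv g hg τ hτ => ?_⟩
  have hvV : φ v ≤ (I.card * D + 1) * √R := by
    have hv' : v ∈ p.support := by simpa using hv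
    obtain ⟨q⟩ : (F.graph V).Reachable v w₀ := ⟨(p.takeUntil v hv').reverse⟩
    cases q with
    | nil => rw [hφ0]; positivity
    | cons h q => exact h.1.2
  refine le_trans ?_ hvV
  exact Finset.single_le_sum (f := fun i : List S × (ℂ ≃ᵢ ℂ) =>
    |F.zoom s u i.1 (F.act hF i.2 v) - F.zoom s u i.1 (F.act hF i.2 w₀)|)
    (fun i _ => abs_nonneg _) (a := (τ, g)) (by
      rw [hI, Finset.mem_product]
      exact ⟨by simpa [hT] using hτ, by simpa [hG] using hg⟩)

end PolygonIFS

namespace UnitPolygon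

variable (P : UnitPolygon)

/-! ### The axes of symmetry -/

/-- The direction orthogonal to the axis of the reflection `q_j ↦ q_{k-j}`: the axis is the zero set
of the height in this direction. -/
def axis (k : ℕ) : ℝ := Real.pi * k / P.N + Real.pi / 2

theorem height_eq_cos_sin (φ : ℝ) (z : ℂ) :
    P.height φ z = (P.coord z).re * Real.cos φ + (P.coord z).im * Real.sin φ := by
  have h : Complex.exp (-(φ * Complex.I)) =
      ((Real.cos φ : ℝ) : ℂ) - (Real.sin φ : ℝ) * Complex.I := by
    have e : -((φ : ℂ) * Complex.I) = ((-φ : ℝ) : ℂ) * Complex.I := by push_cast; ring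
    rw [e, Complex.exp_mul_I, ← Complex.ofReal_cos, ← Complex.ofReal_sin, Real.cos_neg,
      Real.sin_neg]
    push_cast; ring
  rw [height, h]
  simp only [Complex.mul_re, Complex.sub_re, Complex.sub_im, Complex.ofReal_re, Complex.ofReal_im,
    Complex.mul_im, Complex.I_re, Complex.I_im]
  ring

theorem height_axis (k : ℕ) (z : ℂ) : P.height (P.axis k) z =
    (P.coord z).im * Real.cos (Real.pi * k / P.N) -
      (P.coord z).re * Real.sin (Real.pi * k / P.N) := by
  rw [height_eq_cos_sin, axis, Real.cos_add_pi_div_two, Real.sin_add_pi_div_two]; ring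

theorem height_axis_q (k j : ℕ) :
    P.height (P.axis k) (P.q j) = Real.sin (Real.pi * (2 * j - k) / P.N) := by
  rw [height_q, axis, ← Real.cos_sub_pi_div_two]
  congr 1; ring

theorem root_re_im (k : ℕ) : (P.root k).re = Real.cos (2 * Real.pi * k / P.N) ∧
    (P.root k).im = Real.sin (2 * Real.pi * k / P.N) := by
  rw [root]
  exact ⟨Complex.exp_ofReal_mul_I_re _, Complex.exp_ofReal_mul_I_im _⟩

/-- The reflection fixes the points of its axis. -/
theorem refl_eq_of_height {k : ℕ} {z : ℂ} (h : P.height (P.axis k) z = 0) : P.refl k z = z := by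
  apply P.coord_inj
  rw [coord_refl]
  rw [height_axis] at h
  obtain ⟨h1, h2⟩ := P.root_re_im k
  set γ := Real.pi * k / P.N with hγ
  have e : 2 * Real.pi * k / P.N = 2 * γ := by rw [hγ]; ring
  rw [e] at h1 h2
  rw [Real.cos_two_mul] at h1
  rw [Real.sin_two_mul] at h2
  have hs := Real.sin_sq_add_cos_sq γ
  apply Complex.ext
  · rw [Complex.mul_re, Complex.conj_re, Complex.conj_im, h1, h2]
    linear_combination 2 * Real.sin γ * h + 2 * (P.coord z).re * hs
  · rw [Complex.mul_im, Complex.conj_re, Complex.conj_im, h1, h2]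
    linear_combination (-2 * Real.cos γ) * h

theorem refl_refl_succ (k : ℕ) (z : ℂ) : P.refl (k + 1) (P.refl k z) = P.rot 1 z := by
  apply P.coord_inj
  rw [coord_refl, coord_refl, coord_rot, map_mul, Complex.conj_conj, add_comm k 1, root_add]
  linear_combination P.root 1 * P.coord z * P.conj_root_mul k

theorem refl_congr {k l : ℕ} (h : k ≡ l [MOD P.N]) : P.refl k = P.refl l := by
  ext z
  apply P.coord_inj
  rw [coord_refl, coord_refl, P.root_congr h]

/-- The reflections in two consecutive axes generate the dihedral group: a property of symmetries
that is kept when composing with these two reflections reaches every symmetry in boundedly many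
steps. -/
theorem exists_steps (k : ℕ) {Q : ℕ → (ℂ ≃ᵢ ℂ) → Prop} (h0 : Q 0 (IsometryEquiv.refl ℂ))
    (h1 : ∀ n, ∀ g ∈ P.symmetries, Q n g → Q (n + 1) ((P.refl k).trans g))
    (h2 : ∀ n, ∀ g ∈ P.symmetries, Q n g → Q (n + 1) ((P.refl (k + 1)).trans g))
    {g : ℂ ≃ᵢ ℂ} (hg : g ∈ P.symmetries) : ∃ n ≤ 2 * P.N + 1, Q n g := by
  -- the composition of the two reflections is the rotation by one vertex
  have hrot : ∀ j, Q (2 * j) (P.rot j) := by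
    intro j
    induction j with
    | zero =>
      have e : P.rot 0 = IsometryEquiv.refl ℂ := by
        ext z
        change P.rot 0 z = z
        rw [rot_apply, root_zero]; ring
      rw [e]; exact h0
    | succ j ih =>
      have e : (P.refl k).trans ((P.refl (k + 1)).trans (P.rot j)) = P.rot (j + 1) := by
        ext z
        rw [IsometryEquiv.trans_apply, IsometryEquiv.trans_apply, refl_refl_succ]
        apply P.coord_inj
        rw [coord_rot, coord_rot, coord_rot, root_add, mul_assoc]
      rw [← e]
      exact h1 _ _ (P.symm_trans (P.refl_mem _) (P.rot_mem _)) (h2 _ _ (P.rot_mem _) ih)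
  -- every symmetry is a rotation or a rotation after the first reflection
  obtain ⟨l, hl, rfl | rfl⟩ := P.exists_eq_rot_or_refl (P.image_body_of_mem hg)
  · exact ⟨2 * l, by have := hl.2; omega, hrot l⟩
  · obtain ⟨j', hj'⟩ := P.exists_add_modEq k l
    obtain ⟨j, hj, hjj⟩ := P.exists_index j'
    refine ⟨2 * j + 1, by have := hj.2; omega, ?_⟩
    have e : (P.refl k).trans (P.rot j) = P.refl l := by
      rw [← P.refl_congr ((hjj.symm.add_left k).trans hj')]
      ext z
      rw [IsometryEquiv.trans_apply]
      apply P.coord_inj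
      rw [coord_rot, coord_refl, coord_refl, root_add]; ring
    rw [← e]
    exact h1 _ _ (P.rot_mem _) (hrot j)

theorem dist_q (z : ℂ) (a : ℕ) : dist z (P.q a) = ‖P.arm‖ * ‖P.coord z - P.root a‖ := by
  rw [dist_eq_norm, ← norm_mul, q_eq']
  congr 1
  conv_lhs => rw [P.eq_coord z]
  ring

theorem sin_pi_div_pos : 0 < Real.sin (Real.pi / P.N) := by
  have h3 := P.three_le'
  have hpi := Real.pi_pos
  refine Real.sin_pos_of_pos_of_lt_pi (div_pos hpi P.N_pos') ?_
  rw [div_lt_iff₀ P.N_pos']; nlinarith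

/-- The axis `2a + 1` is the perpendicular bisector of the side `L_a`. -/
theorem height_axis_nonpos {z : ℂ} {a : ℕ} (h : dist z (P.q a) ≤ dist z (P.q (a + 1))) :
    P.height (P.axis (2 * a + 1)) z ≤ 0 := by
  rw [dist_q, dist_q] at h
  have h0 := le_of_mul_le_mul_left h (norm_pos_iff.2 P.arm_ne_zero)
  have h1 := pow_le_pow_left₀ (norm_nonneg _) h0 2
  rw [← Complex.normSq_eq_norm_sq, ← Complex.normSq_eq_norm_sq, Complex.normSq_apply,
    Complex.normSq_apply] at h1
  simp only [Complex.sub_re, Complex.sub_im] at h1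
  obtain ⟨a1, a2⟩ := P.root_re_im a
  obtain ⟨b1, b2⟩ := P.root_re_im (a + 1)
  rw [height_axis]
  set γ := Real.pi * ((2 * a + 1 : ℕ) : ℝ) / P.N with hγ
  set δ := Real.pi / P.N with hδ
  have e1 : 2 * Real.pi * a / P.N = γ - δ := by rw [hγ, hδ]; push_cast; ring
  have e2 : 2 * Real.pi * ((a + 1 : ℕ) : ℝ) / P.N = γ + δ := by rw [hγ, hδ]; push_cast; ring
  rw [e1, Real.cos_sub] at a1
  rw [e1, Real.sin_sub] at a2
  rw [e2, Real.cos_add] at b1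
  rw [e2, Real.sin_add] at b2
  rw [a1, a2, b1, b2] at h1
  have hs := P.sin_pi_div_pos
  rw [← hδ] at hs
  by_contra hc
  rw [not_le] at hc
  have := mul_pos hs hc
  have c1 := Real.sin_sq_add_cos_sq γ
  have c2 := Real.sin_sq_add_cos_sq δ
  nlinarith

theorem abs_height_sub_le (φ : ℝ) (z w : ℂ) :
    |P.height φ z - P.height φ w| ≤ dist z w / ‖P.arm‖ := by
  have h : P.height φ z - P.height φ w =
      ((P.coord z - P.coord w) * Complex.exp (-(φ * Complex.I))).re := by
    rw [height, height, sub_mul, Complex.sub_re]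
  have e : ‖Complex.exp (-(φ * Complex.I))‖ = 1 := by
    have : -((φ : ℂ) * Complex.I) = ((-φ : ℝ) : ℂ) * Complex.I := by push_cast; ring
    rw [this, Complex.norm_exp_ofReal_mul_I]
  rw [h]
  refine (Complex.abs_re_le_norm _).trans ?_
  rw [norm_mul, e, mul_one, coord, coord, ← sub_div, norm_div, dist_eq_norm]
  simp

/-- Two consecutive axes only meet in the centre. -/
theorem norm_coord_mul_sin_le (k : ℕ) (z : ℂ) : ‖P.coord z‖ * Real.sin (Real.pi / P.N) ≤
    2 * (|P.height (P.axis k) z| + |P.height (P.axis (k + 1)) z|) := by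
  set p := P.height (P.axis k) z with hp
  set r := P.height (P.axis (k + 1)) z with hr
  rw [height_axis] at hp hr
  set γ := Real.pi * k / P.N with hγ
  set δ := Real.pi / P.N with hδ
  have e : Real.pi * ((k + 1 : ℕ) : ℝ) / P.N = γ + δ := by rw [hγ, hδ]; push_cast; ring
  rw [e] at hr
  have hs := P.sin_pi_div_pos
  rw [← hδ] at hs
  have hd : Real.sin δ = Real.sin (γ + δ) * Real.cos γ - Real.cos (γ + δ) * Real.sin γ := by
    rw [← Real.sin_sub]; congr 1; ring
  have h1 : (P.coord z).re * Real.sin δ = p * Real.cos (γ + δ) - r * Real.cos γ := by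
    rw [hd, hp, hr]; ring
  have h2 : (P.coord z).im * Real.sin δ = p * Real.sin (γ + δ) - r * Real.sin γ := by
    rw [hd, hp, hr]; ring
  have key : ∀ a b : ℝ, |a| ≤ 1 → |b| ≤ 1 → |p * a - r * b| ≤ |p| + |r| := by
    intro a b ha hb
    refine (abs_sub _ _).trans ?_
    rw [abs_mul, abs_mul]
    exact add_le_add (mul_le_of_le_one_right (abs_nonneg _) ha)
      (mul_le_of_le_one_right (abs_nonneg _) hb)
  have h3 : |(P.coord z).re| * Real.sin δ ≤ |p| + |r| := by
    rw [← abs_of_pos hs, ← abs_mul, h1]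
    exact key _ _ (Real.abs_cos_le_one _) (Real.abs_cos_le_one _)
  have h4 : |(P.coord z).im| * Real.sin δ ≤ |p| + |r| := by
    rw [← abs_of_pos hs, ← abs_mul, h2]
    exact key _ _ (Real.abs_sin_le_one _) (Real.abs_sin_le_one _)
  have h5 := mul_le_mul_of_nonneg_right (Complex.norm_le_abs_re_add_abs_im (P.coord z)) hs.le
  linarith

theorem height_side_nonneg {φ : ℝ} {k : ℕ} {z : ℂ} (h1 : 0 ≤ P.height φ (P.q k))
    (h2 : 0 ≤ P.height φ (P.q (k + 1))) (hz : z ∈ P.side k) : 0 ≤ P.height φ z :=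
  (P.convex_height_ge φ 0).segment_subset h1 h2 hz

theorem height_side_nonpos {φ : ℝ} {k : ℕ} {z : ℂ} (h1 : P.height φ (P.q k) ≤ 0)
    (h2 : P.height φ (P.q (k + 1)) ≤ 0) (hz : z ∈ P.side k) : P.height φ z ≤ 0 :=
  (P.convex_height_le φ 0).segment_subset h1 h2 hz

theorem height_axis_q_nonneg {k j : ℕ} (h1 : k ≤ 2 * j) (h2 : 2 * j ≤ k + P.N) :
    0 ≤ P.height (P.axis k) (P.q j) := by
  have h1' : (k : ℝ) ≤ 2 * j := by exact_mod_cast h1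
  have h2' : (2 * j : ℝ) ≤ k + P.N := by exact_mod_cast h2
  have hpi := Real.pi_pos
  rw [height_axis_q]
  apply Real.sin_nonneg_of_nonneg_of_le_pi
  · exact div_nonneg (mul_nonneg hpi.le (by linarith)) P.N_pos'.le
  · rw [div_le_iff₀ P.N_pos']
    exact mul_le_mul_of_nonneg_left (by linarith) hpi.le

theorem height_axis_q_nonpos {k j : ℕ} (h1 : k + P.N ≤ 2 * j) (h2 : 2 * j ≤ k + 2 * P.N) :
    P.height (P.axis k) (P.q j) ≤ 0 := by
  have h1' : (k : ℝ) + P.N ≤ 2 * j := by exact_mod_cast h1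
  have h2' : (2 * j : ℝ) ≤ k + 2 * P.N := by exact_mod_cast h2
  have hpi := Real.pi_pos
  have hN := P.N_pos'
  rw [height_axis_q]
  have e : Real.pi * (2 * j - k) / P.N = Real.pi * (2 * j - k - P.N) / P.N + Real.pi := by
    field_simp; ring
  rw [e, Real.sin_add_pi, neg_nonpos]
  apply Real.sin_nonneg_of_nonneg_of_le_pi
  · exact div_nonneg (mul_nonneg hpi.le (by linarith)) hN.le
  · rw [div_le_iff₀ hN]
    exact mul_le_mul_of_nonneg_left (by linarith) hpi.le

theorem height_axis_add (k : ℕ) (z : ℂ) :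
    P.height (P.axis (2 * P.N + k)) z = P.height (P.axis k) z := by
  have hN := P.N_pos'
  have e : Real.pi * ((2 * P.N + k : ℕ) : ℝ) / P.N = Real.pi * k / P.N + 2 * Real.pi := by
    push_cast; field_simp; ring
  rw [height_axis, height_axis, e, Real.cos_add_two_pi, Real.sin_add_two_pi]

end UnitPolygon

namespace PolygonIFS

open scoped Classical

variable {S : Type*} [Fintype S] (F : PolygonIFS S)

/-- A half-plane that meets a cell contains one of its vertices, so it meets the boundary of the cell. -/
theorem exists_vertex_height_nonpos {w : List S} {φ : ℝ} {z : ℂ}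
    (hz : z ∈ F.Ψw w '' F.poly.body) (h : F.poly.height φ z ≤ 0) :
    ∃ x ∈ F.Ψw w '' F.poly.bdry, F.poly.height φ x ≤ 0 := by
  by_contra hne
  push Not at hne
  have hconv : Convex ℝ {y | 0 < F.poly.height φ (F.Ψw w y)} := by
    intro x hx y hy a b ha hb hab
    simp only [Set.mem_ofPred_eq] at hx hy ⊢
    rw [F.Ψw_comb w hab, F.poly.height_comb φ hab]
    rcases ha.eq_or_lt with rfl | ha'
    · have : b = 1 := by linarith
      subst this; linarith
    · have := mul_pos ha' hx
      have := mul_nonneg hb hy.le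
      linarith
  have hsub : F.poly.body ⊆ {y | 0 < F.poly.height φ (F.Ψw w y)} := by
    refine convexHull_min ?_ hconv
    rintro _ ⟨j, -, rfl⟩
    exact hne _ ⟨_, F.poly.q_mem_bdry j, rfl⟩
  obtain ⟨y, hy, rfl⟩ := hz
  exact absurd (hsub hy) (not_lt.2 h)

theorem mem_image_bdry {w : List S} {x : ℂ} (hx : x ∈ F.Ψw w '' F.poly.body)
    (hb : x ∈ F.poly.bdry) : x ∈ F.Ψw w '' F.poly.bdry := by
  obtain ⟨y, hy, rfl⟩ := hx
  refine ⟨y, ?_, rfl⟩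
  rw [UnitPolygon.bdry_eq] at hb ⊢
  exact ⟨hy, fun h => hb.2 (F.Ψw_mem_interior w h)⟩

/-- A cell closer to `q_a` than to `q_{a+1}` reaches over the bisector of `L_a`. -/
theorem exists_height_axis_nonpos {w : List S} {a : ℕ}
    (h : Metric.infDist (F.poly.q a) (F.cell w) ≤ Metric.infDist (F.poly.q (a + 1)) (F.cell w)) :
    ∃ x ∈ F.Ψw w '' F.poly.bdry, F.poly.height (F.poly.axis (2 * a + 1)) x ≤ 0 := by
  obtain ⟨z, hz, hzd⟩ := (F.isCompact_cell w).exists_infDist_eq_dist (F.cell_nonempty w)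
    (F.poly.q a)
  refine F.exists_vertex_height_nonpos (F.cell_subset_body w hz) (F.poly.height_axis_nonpos ?_)
  rw [dist_comm z, dist_comm z, ← hzd]
  exact h.trans (Metric.infDist_le_dist_of_mem hz)

theorem mem_halfSideCells_one {m : ℕ} {w : List S} (hw : w ∈ F.halfSideCells 1 m) :
    w ∈ F.sideCells 1 m ∧
      Metric.infDist (F.poly.q 1) (F.cell w) ≤ Metric.infDist (F.poly.q 2) (F.cell w) := by
  have e : ⌊(1 : ℚ)⌋₊ = 1 := Nat.floor_one
  unfold halfSideCells at hw
  rw [e, if_pos (by norm_num)] at hw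
  exact hw

/-- The half-sides at distance at least `1` from the first one lie on the sides `L_2, …, L_N`, and
on `L_N` only the half next to `q_N` is at that distance. -/
theorem mem_halfSideCells {m : ℕ} {i : ℚ} (hi : i ∈ F.poly.halfIndex)
    (hd : 1 ≤ F.poly.halfDist 1 i) {v : List S} (hv : v ∈ F.halfSideCells i m) :
    ∃ k, 2 ≤ k ∧ k ≤ F.poly.N ∧ v ∈ F.sideCells k m ∧ (k < F.poly.N ∨
      Metric.infDist (F.poly.q k) (F.cell v) ≤ Metric.infDist (F.poly.q (k + 1)) (F.cell v)) := by
  obtain ⟨k, hk1, hkN, rfl | rfl⟩ := hi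
  · unfold UnitPolygon.halfDist at hd
    rw [le_min_iff] at hd
    unfold halfSideCells at hv
    rw [Nat.floor_natCast, if_pos rfl] at hv
    refine ⟨k, ?_, hkN, hv.1, Or.inr hv.2⟩
    by_contra hlt
    have : k = 1 := by omega
    subst this
    norm_num at hd
  · have e : ⌊(k : ℚ) + 1 / 2⌋₊ = k := by
      rw [Nat.floor_eq_iff (by positivity)]
      constructor <;> linarith
    unfold UnitPolygon.halfDist at hd
    rw [le_min_iff] at hd
    unfold halfSideCells at hv
    rw [e, if_neg (by norm_num)] at hv
    have hk1' : (1 : ℚ) ≤ k := by exact_mod_cast hk1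
    rw [abs_of_nonpos (by linarith)] at hd
    refine ⟨k, ?_, hkN, hv.1, Or.inl ?_⟩
    · by_contra hlt
      have : k = 1 := by omega
      subst this
      norm_num at hd
    · have h2 : (k : ℚ) + 1 / 2 ≤ F.poly.N := by linarith [hd.2]
      have h3 : (k : ℚ) < F.poly.N := by linarith
      exact_mod_cast h3

/-- A connected set that contains the boundaries of a cell near the first half-side and of a cell
near another half-side at distance at least `1` crosses two consecutive axes of symmetry. -/
theorem exists_axes {m : ℕ} {i : ℚ} (hi : i ∈ F.poly.halfIndex) (hd : 1 ≤ F.poly.halfDist 1 i)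
    {w v : List S} (hw : w ∈ F.halfSideCells 1 m) (hv : v ∈ F.halfSideCells i m) {X : Set ℂ}
    (hX : IsPreconnected X) (hwX : F.Ψw w '' F.poly.bdry ⊆ X) (hvX : F.Ψw v '' F.poly.bdry ⊆ X) :
    ∃ k, (∃ x ∈ X, F.poly.height (F.poly.axis k) x = 0) ∧
      ∃ x ∈ X, F.poly.height (F.poly.axis (k + 1)) x = 0 := by
  have cross : ∀ k, (∃ x ∈ X, F.poly.height (F.poly.axis k) x ≤ 0) →
      (∃ x ∈ X, 0 ≤ F.poly.height (F.poly.axis k) x) →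
      ∃ x ∈ X, F.poly.height (F.poly.axis k) x = 0 := by
    rintro k ⟨x, hx, hx0⟩ ⟨y, hy, hy0⟩
    obtain ⟨z, hz, hz0⟩ := hX.intermediate_value hx hy
      (F.poly.continuous_height (F.poly.axis k)).continuousOn ⟨hx0, hy0⟩
    exact ⟨z, hz, hz0⟩
  have h3 := F.poly.three_le
  obtain ⟨⟨-, x, hxw, hxs⟩, hdw⟩ := F.mem_halfSideCells_one hw
  obtain ⟨k, hk2, hkN, ⟨-, y, hyv, hys⟩, hdv⟩ := F.mem_halfSideCells hi hd hv
  have hxX : x ∈ X := hwX (F.mem_image_bdry (F.cell_subset_body w hxw)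
    (F.poly.side_subset_bdry _ hxs))
  have hyX : y ∈ X := hvX (F.mem_image_bdry (F.cell_subset_body v hyv)
    (F.poly.side_subset_bdry _ hys))
  -- The axis `j` passes through `q_{j/2}`, the midpoint of `L_{(j-1)/2}` for odd `j`. If the second
  -- half-side lies on the near half of the polygon, use the bisector of `L_1` and the axis through
  -- `q_2`; otherwise use the bisector of `L_N` and the axis through `q_1`.
  by_cases hk : 2 * k - 1 ≤ F.poly.N
  · refine ⟨3, cross 3 ?_ ⟨y, hyX, ?_⟩, cross 4 ⟨x, hxX, ?_⟩ ⟨y, hyX, ?_⟩⟩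
    · obtain ⟨z, hz, hz0⟩ := F.exists_height_axis_nonpos hdw
      exact ⟨z, hwX hz, hz0⟩
    · exact F.poly.height_side_nonneg (F.poly.height_axis_q_nonneg (by omega) (by omega))
        (F.poly.height_axis_q_nonneg (by omega) (by omega)) hys
    · refine F.poly.height_side_nonpos ?_ ?_ hxs
      · rw [F.poly.q_congr (show 1 ≡ 1 + F.poly.N [MOD F.poly.N] by simp [Nat.ModEq])]
        exact F.poly.height_axis_q_nonpos (by omega) (by omega)
      · rw [UnitPolygon.height_axis_q]; norm_num
    · exact F.poly.height_side_nonneg (F.poly.height_axis_q_nonneg (by omega) (by omega))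
        (F.poly.height_axis_q_nonneg (by omega) (by omega)) hys
  · refine ⟨1, cross 1 ?_ ⟨x, hxX, ?_⟩, cross 2 ⟨y, hyX, ?_⟩ ⟨x, hxX, ?_⟩⟩
    · rcases hdv with hlt | hdv
      · exact ⟨y, hyX, F.poly.height_side_nonpos
          (F.poly.height_axis_q_nonpos (by omega) (by omega))
          (F.poly.height_axis_q_nonpos (by omega) (by omega)) hys⟩
      · by_cases hlt : k < F.poly.N
        · exact ⟨y, hyX, F.poly.height_side_nonpos
            (F.poly.height_axis_q_nonpos (by omega) (by omega))
            (F.poly.height_axis_q_nonpos (by omega) (by omega)) hys⟩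
        · obtain ⟨z, hz, hz0⟩ := F.exists_height_axis_nonpos hdv
          have : k = F.poly.N := by omega
          rw [this, F.poly.height_axis_add] at hz0
          exact ⟨z, hvX hz, hz0⟩
    · exact F.poly.height_side_nonneg (F.poly.height_axis_q_nonneg (by omega) (by omega))
        (F.poly.height_axis_q_nonneg (by omega) (by omega)) hxs
    · exact F.poly.height_side_nonpos (F.poly.height_axis_q_nonpos (by omega) (by omega))
        (F.poly.height_axis_q_nonpos (by omega) (by omega)) hys
    · exact F.poly.height_side_nonneg (F.poly.height_axis_q_nonneg (by omega) (by omega))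
        (F.poly.height_axis_q_nonneg (by omega) (by omega)) hxs

/-- At small scales a single cell cannot lie near both half-sides: it would be close to the
centre. -/
theorem exists_ne (F : PolygonIFS S) : ∃ m₀ : ℕ, ∀ m ≥ m₀, 1 ≤ m → ∀ i ∈ F.poly.halfIndex,
    1 ≤ F.poly.halfDist 1 i → ∀ w ∈ F.halfSideCells 1 m, ∀ v ∈ F.halfSideCells i m, w ≠ v := by
  have hsin := F.poly.sin_pi_div_pos
  have hap := F.poly.apothem_pos
  have harm : 0 < ‖F.poly.arm‖ := norm_pos_iff.2 F.poly.arm_ne_zero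
  obtain ⟨m₀, hm₀⟩ := exists_pow_lt_of_lt_one
    (show 0 < F.poly.apothem * Real.sin (Real.pi / F.poly.N) / 8 by positivity) F.ρmin_lt_one
  refine ⟨m₀, fun m hm hm1 i hi hd w hw v hv hwv => ?_⟩
  subst hwv
  have hwm : F.ρw w ≤ F.ρmin ^ m := by
    have h1 := (F.mem_halfSideCells_one hw).1.1
    rw [F.Λ_eq_cut hm1] at h1
    exact IsCut.le F (F.mem_cut.1 h1)
  have hsmall : F.ρw w < F.poly.apothem * Real.sin (Real.pi / F.poly.N) / 8 :=
    (hwm.trans (pow_le_pow_of_le_one F.ρmin_pos.le F.ρmin_lt_one.le hm)).trans_lt hm₀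
  have hdist : ∀ a ∈ F.Ψw w '' F.poly.body, ∀ b ∈ F.Ψw w '' F.poly.body,
      dist a b / ‖F.poly.arm‖ ≤ 2 * F.ρw w := by
    intro a ha b hb
    rw [div_le_iff₀ harm]
    have h1 := F.dist_pt_le ha
    have h2 := F.dist_pt_le hb
    have := dist_triangle_right a b (F.pt w)
    unfold rad at h1 h2
    linarith
  -- the boundary of such a cell would cross two consecutive axes, so the cell would be near the
  -- centre, but it also meets `L_1`
  obtain ⟨k, ⟨x, hx, hx0⟩, y, hy, hy0⟩ := F.exists_axes hi hd hw hv
    (F.poly.isPathConnected_bdry.image (F.continuous_Ψw w)).isConnected.isPreconnected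
    subset_rfl subset_rfl
  have hx' := Set.image_mono F.poly.bdry_subset_body hx
  have hy' := Set.image_mono F.poly.bdry_subset_body hy
  obtain ⟨⟨-, z, hzw, hzs⟩, -⟩ := F.mem_halfSideCells_one hw
  have hz' := F.cell_subset_body w hzw
  have h1 := F.poly.abs_height_sub_le (F.poly.axis k) z x
  have h2 := F.poly.abs_height_sub_le (F.poly.axis (k + 1)) z y
  rw [hx0, sub_zero] at h1
  rw [hy0, sub_zero] at h2
  have h3 := h1.trans (hdist z hz' x hx')
  have h4 := h2.trans (hdist z hz' y hy')
  have h5 := F.poly.norm_coord_mul_sin_le k z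
  have h6 : F.poly.apothem ≤ ‖F.poly.coord z‖ := by
    have e := F.poly.abs_height_sub_le (F.poly.normal 1) z F.poly.ctr
    rw [F.poly.height_ctr, sub_zero, F.poly.height_normal_side hzs, ← F.poly.norm_coord] at e
    exact (le_abs_self _).trans e
  have h7 := mul_le_mul_of_nonneg_right h6 hsin.le
  linarith

end PolygonIFS

namespace UnitPolygon

variable (P : UnitPolygon)

/-! ### Sets invariant under the dihedral group -/

/-- The union of the images of a set under the symmetries of the polygon. -/
def orbit (X : Set ℂ) : Set ℂ := ⋃ g ∈ P.symmetries, g '' X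

variable {P}

theorem mem_orbit {X : Set ℂ} {z : ℂ} : z ∈ P.orbit X ↔ ∃ g ∈ P.symmetries, ∃ x ∈ X, g x = z := by
  simp only [orbit, Set.mem_iUnion, Set.mem_image, exists_prop]

theorem subset_orbit (X : Set ℂ) : X ⊆ P.orbit X := fun x hx =>
  mem_orbit.2 ⟨_, P.symm_refl, x, hx, rfl⟩

theorem image_orbit {g : ℂ ≃ᵢ ℂ} (hg : g ∈ P.symmetries) (X : Set ℂ) :
    g '' P.orbit X = P.orbit X := by
  have h : ∀ g ∈ P.symmetries, g '' P.orbit X ⊆ P.orbit X := by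
    rintro g hg _ ⟨_, hz, rfl⟩
    obtain ⟨h, hh, x, hx, rfl⟩ := mem_orbit.1 hz
    exact mem_orbit.2 ⟨h.trans g, P.symm_trans hh hg, x, hx, rfl⟩
  refine (h g hg).antisymm fun z hz => ⟨g.symm z, ?_, g.apply_symm_apply z⟩
  exact h _ (P.symm_symm hg) ⟨z, hz, rfl⟩

theorem isCompact_orbit {X : Set ℂ} (hX : IsCompact X) : IsCompact (P.orbit X) :=
  P.finite_symmetries.isCompact_biUnion fun g _ => hX.image g.continuous

/-- A reflected copy of `X` meets `X` on the axis, and the reflections in two consecutive axes generate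
the dihedral group. -/
theorem isPathConnected_orbit {X : Set ℂ} (hX : IsPathConnected X) {k : ℕ}
    (h1 : ∃ x ∈ X, P.refl k x = x) (h2 : ∃ x ∈ X, P.refl (k + 1) x = x) :
    IsPathConnected (P.orbit X) := by
  obtain ⟨x₀, hx₀, -⟩ := id hX
  have himg : ∀ g ∈ P.symmetries, ∀ x ∈ X, ∀ y ∈ X, JoinedIn (P.orbit X) (g x) (g y) := by
    intro g hg x hx y hy
    refine ((hX.image g.continuous).joinedIn _ ⟨x, hx, rfl⟩ _ ⟨y, hy, rfl⟩).mono ?_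
    exact Set.subset_biUnion_of_mem (u := fun g : ℂ ≃ᵢ ℂ => g '' X) hg
  have hstep : ∀ l, (∃ x ∈ X, P.refl l x = x) → ∀ g ∈ P.symmetries,
      JoinedIn (P.orbit X) x₀ (g x₀) → JoinedIn (P.orbit X) x₀ ((P.refl l).trans g x₀) := by
    rintro l ⟨x, hx, hlx⟩ g hg hj
    refine (hj.trans (himg g hg x₀ hx₀ x hx)).trans ?_
    have := himg _ (P.symm_trans (P.refl_mem l) hg) x hx x₀ hx₀
    rwa [IsometryEquiv.trans_apply, hlx] at this
  refine ⟨x₀, subset_orbit X hx₀, fun {z} hz => ?_⟩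
  obtain ⟨g, hg, x, hx, rfl⟩ := mem_orbit.1 hz
  obtain ⟨n, -, hn⟩ := P.exists_steps k
    (Q := fun _ g => JoinedIn (P.orbit X) x₀ (g x₀)) (JoinedIn.refl (subset_orbit X hx₀))
    (fun _ g hg => hstep k h1 g hg) (fun _ g hg => hstep (k + 1) h2 g hg) hg
  exact hn.trans (himg g hg x₀ hx₀ x hx)

theorem coord_along (k : ℕ) (t : ℝ) :
    P.coord (P.along k t) = P.root k + t * (P.root (k + 1) - P.root k) := by
  rw [coord_eq_iff, along_eq, q_eq', q_eq']; ring

theorem rot_along (k j : ℕ) (t : ℝ) : P.rot j (P.along k t) = P.along (k + j) t := by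
  apply P.coord_inj
  rw [coord_rot, coord_along, coord_along, show k + j + 1 = k + 1 + j by ring, P.root_add k j,
    P.root_add (k + 1) j]
  ring

theorem refl_along (k : ℕ) (t : ℝ) : P.refl (2 * k + 1) (P.along k t) = P.along k (1 - t) := by
  apply P.coord_inj
  have h1 := P.conj_root_mul k
  have h2 := P.conj_root_mul (k + 1)
  rw [coord_refl, coord_along, coord_along, show 2 * k + 1 = k + 1 + k by ring, P.root_add (k + 1) k]
  simp only [map_add, map_mul, map_sub, Complex.conj_ofReal]
  push_cast
  linear_combination (1 - t) * P.root (k + 1) * h1 + t * P.root k * h2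

theorem along_mem_halfSide_nat {k : ℕ} {t : ℝ} (h0 : 0 ≤ t) (h1 : t ≤ 1 / 2) :
    P.along k t ∈ P.halfSide k := by
  unfold halfSide
  rw [Nat.floor_natCast, if_pos rfl, segment_eq_image_lineMap]
  refine ⟨2 * t, ⟨by linarith, by linarith⟩, ?_⟩
  rw [AffineMap.lineMap_apply_module, midpoint_eq_smul_add, along_eq]
  simp only [Complex.real_smul, invOf_eq_inv]
  push_cast
  ring

theorem along_mem_halfSide_half {k : ℕ} {t : ℝ} (h0 : 0 ≤ t) (h1 : t ≤ 1 / 2) :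
    P.along k (1 - t) ∈ P.halfSide (k + 1 / 2) := by
  unfold halfSide
  have e : ⌊(k : ℚ) + 1 / 2⌋₊ = k := by
    rw [Nat.floor_eq_iff (by positivity)]
    constructor <;> linarith
  rw [e, if_neg (by norm_num), segment_eq_image_lineMap]
  refine ⟨1 - 2 * t, ⟨by linarith, by linarith⟩, ?_⟩
  rw [AffineMap.lineMap_apply_module, midpoint_eq_smul_add, along_eq]
  simp only [Complex.real_smul, invOf_eq_inv]
  push_cast
  ring

/-- The rotations carry a point of `L_1` to all the sides, the reflection in the bisector of a side to
the other half of it. -/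
theorem inter_halfSide_nonempty {A : Set ℂ} (hA : ∀ g ∈ P.symmetries, g '' A = A)
    (h1 : (A ∩ P.side 1).Nonempty) {i : ℚ} (hi : i ∈ P.halfIndex) :
    (A ∩ P.halfSide i).Nonempty := by
  have hmem : ∀ g ∈ P.symmetries, ∀ z ∈ A, g z ∈ A := fun g hg z hz => by
    rw [← hA g hg]; exact ⟨z, hz, rfl⟩
  obtain ⟨x, hxA, hxs⟩ := h1
  rw [side_eq] at hxs
  obtain ⟨t, ht, rfl⟩ := hxs
  have key : ∀ k, 1 ≤ k → ∃ t : ℝ, 0 ≤ t ∧ t ≤ 1 / 2 ∧ P.along k t ∈ A ∧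
      P.along k (1 - t) ∈ A := by
    intro k hk
    have h2 := hmem _ (P.rot_mem (k - 1)) _ hxA
    rw [rot_along, show 1 + (k - 1) = k by omega] at h2
    have h3 := hmem _ (P.refl_mem (2 * k + 1)) _ h2
    rw [refl_along] at h3
    rcases le_total t (1 / 2) with h | h
    · exact ⟨t, ht.1, h, h2, h3⟩
    · refine ⟨1 - t, by linarith [ht.2], by linarith, h3, ?_⟩
      rwa [sub_sub_cancel]
  obtain ⟨k, hk, -, rfl | rfl⟩ := hi
  · obtain ⟨t, h0, h1, h2, -⟩ := key k hk
    exact ⟨_, h2, along_mem_halfSide_nat h0 h1⟩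
  · obtain ⟨t, h0, h1, -, h3⟩ := key k hk
    exact ⟨_, h3, along_mem_halfSide_half h0 h1⟩

end UnitPolygon

namespace PolygonIFS

open scoped Classical

variable {S : Type*} [Fintype S] {F : PolygonIFS S}

/-- The loop intersection condition, transported by the symmetries to all the corner cells. -/
theorem LoopIntersection.exists_Ψ_mem (hLI : F.LoopIntersection) (hF : F.IsBorderedCarpet)
    {A : Set ℂ} (hAK : A ⊆ F.K) (hAc : IsClosed A) (hAp : IsPathConnected A)
    (hAs : ∀ g ∈ F.poly.symmetries, g '' A = A) (h1 : (A ∩ F.poly.side 1).Nonempty) {c : S}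
    (hc : F.IsCorner c) : ∃ b ∈ A, F.Ψ c b ∈ A := by
  have hmem : ∀ g ∈ F.poly.symmetries, ∀ z, g z ∈ A → z ∈ A := fun g hg z hz => by
    rw [← hAs g hg] at hz
    obtain ⟨y, hy, hyz⟩ := hz
    rwa [← g.injective hyz]
  obtain ⟨k, hk⟩ := hc
  obtain ⟨j, hj⟩ := F.poly.exists_add_modEq k 1
  have hg := F.poly.rot_mem j
  obtain ⟨i, h, hh, -, hi, himg⟩ := F.exists_symm_Ψ hF hg c
  have hq : F.poly.q 1 ∈ F.Ψ i '' F.poly.body := by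
    rw [← himg, ← F.poly.q_congr hj, ← F.poly.rot_q]
    exact ⟨_, hk, rfl⟩
  obtain ⟨a, haA, b, hb, rfl⟩ := hLI i hq A hAK hAc hAp hAs
    fun h hh => UnitPolygon.inter_halfSide_nonempty hAs h1 hh
  rw [← hAs h hh] at hb
  obtain ⟨b', hb', rfl⟩ := hb
  rw [hi] at haA
  exact ⟨b', hb', hmem _ hg _ haA⟩

variable (F)

/-- The union of the boundaries of the cells of a list of words. -/
def frame (l : List (List S)) : Set ℂ := ⋃ v ∈ l, F.Ψw v '' F.poly.bdry

variable {F}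

theorem mem_frame {l : List (List S)} {z : ℂ} :
    z ∈ F.frame l ↔ ∃ v ∈ l, z ∈ F.Ψw v '' F.poly.bdry := by
  simp only [frame, Set.mem_iUnion, exists_prop]

theorem image_bdry_subset_frame {l : List (List S)} {v : List S} (hv : v ∈ l) :
    F.Ψw v '' F.poly.bdry ⊆ F.frame l := fun _ hz => mem_frame.2 ⟨v, hv, hz⟩

theorem isCompact_frame (l : List (List S)) : IsCompact (F.frame l) :=
  (List.finite_toSet l).isCompact_biUnion
    fun v _ => F.poly.isCompact_bdry.image (F.continuous_Ψw v)

theorem frame_subset_K (hF : F.IsBorderedCarpet) (l : List (List S)) : F.frame l ⊆ F.K := by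
  intro z hz
  obtain ⟨v, -, y, hy, rfl⟩ := mem_frame.1 hz
  exact F.Ψw_mem_K v (F.bdry_subset_K hF hy)

theorem isPathConnected_frame (hF : F.IsBorderedCarpet) {s : ℝ} {w v : List S}
    (p : (F.graph (F.cut s : Set (List S))).Walk w v) : IsPathConnected (F.frame p.support) := by
  have himg : ∀ u, IsPathConnected (F.Ψw u '' F.poly.bdry) := fun u =>
    F.poly.isPathConnected_bdry.image (F.continuous_Ψw u)
  induction p with
  | @nil u =>
    have : F.frame (SimpleGraph.Walk.nil : (F.graph (F.cut s : Set (List S))).Walk u u).support =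
        F.Ψw u '' F.poly.bdry := by simp [frame]
    rw [this]; exact himg u
  | @cons u x y h p ih =>
    have : F.frame (SimpleGraph.Walk.cons h p).support =
        F.Ψw u '' F.poly.bdry ∪ F.frame p.support := by
      simp [frame, SimpleGraph.Walk.support_cons]
    rw [this]
    refine (himg u).union ih ?_
    obtain ⟨hu, hx, hux, z, hzu, hzx⟩ := h
    have hdis := F.disjoint_interior_cut hF (F.mem_cut.1 hu) (F.mem_cut.1 hx) hux
    refine ⟨z, F.mem_image_bdry_of_disjoint hdis (F.cell_subset_body u hzu)
      (F.cell_subset_body x hzx), image_bdry_subset_frame p.start_mem_support ?_⟩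
    exact F.mem_image_bdry_of_disjoint hdis.symm (F.cell_subset_body x hzx)
      (F.cell_subset_body u hzu)

/-- A function that is nearly constant along a chain of cells which crosses two consecutive axes,
and along the images of the chain, is nearly constant on the whole orbit of the chain. -/
theorem abs_sub_le_of_orbit (hF : F.IsBorderedCarpet) {s θ D : ℝ} {f : List S → ℝ}
    (hf : F.energy (F.cut s) f ≤ D ^ 2) (hD : 0 ≤ D) {l : List (List S)} {w₀ : List S}
    (hl : ∀ v ∈ l, v ∈ F.cut s)
    (hθ : ∀ v ∈ l, ∀ g ∈ F.poly.symmetries, |f (F.act hF g v) - f (F.act hF g w₀)| ≤ θ)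
    {k : ℕ} (h1 : ∃ x ∈ F.frame l, F.poly.refl k x = x)
    (h2 : ∃ x ∈ F.frame l, F.poly.refl (k + 1) x = x) {v : List S} (hv : v ∈ l)
    {g : ℂ ≃ᵢ ℂ} (hg : g ∈ F.poly.symmetries) :
    |f (F.act hF g v) - f (F.act hF (IsometryEquiv.refl ℂ) w₀)| ≤
      θ + (2 * F.poly.N + 1) * (2 * θ + D) := by
  have hθ0 : 0 ≤ θ := (abs_nonneg _).trans (hθ v hv g hg)
  have hstep : ∀ j, (∃ x ∈ F.frame l, F.poly.refl j x = x) → ∀ (n : ℕ), ∀ g ∈ F.poly.symmetries,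
      |f (F.act hF g w₀) - f (F.act hF (IsometryEquiv.refl ℂ) w₀)| ≤ n * (2 * θ + D) →
      |f (F.act hF ((F.poly.refl j).trans g) w₀) - f (F.act hF (IsometryEquiv.refl ℂ) w₀)| ≤
        ((n + 1 : ℕ) : ℝ) * (2 * θ + D) := by
    rintro j ⟨x, hx, hjx⟩ n g hg hn
    obtain ⟨u, hu, hxu⟩ := mem_frame.1 hx
    have hjg := F.poly.symm_trans (F.poly.refl_mem j) hg
    have hxc := F.image_bdry_subset_cell hF u hxu
    have a1 := hθ u hu g hg
    have a2 := hθ u hu _ hjg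
    -- the cell and its reflected copy both contain the fixed point `x`, before and after applying `g`
    have a3 := F.abs_sub_le_sqrt_energy (A := F.cut s) (act_mem_cut hF (g := g) (hl u hu))
      (act_mem_cut hF (g := (F.poly.refl j).trans g) (hl u hu)) (by
        rw [cell_act hF hg, cell_act hF hjg]
        refine ⟨g x, ⟨x, hxc, rfl⟩, x, hxc, ?_⟩
        rw [IsometryEquiv.trans_apply, hjx]) f
    have a4 : √(F.energy (F.cut s) f) ≤ D := by
      rw [← Real.sqrt_sq hD]; exact Real.sqrt_le_sqrt hf
    have a5 := a3.trans a4
    push_cast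
    rw [abs_le] at *
    constructor <;> linarith [a1.1, a1.2, a2.1, a2.2, a5.1, a5.2, hn.1, hn.2]
  obtain ⟨n, hn, hQ⟩ := F.poly.exists_steps k
    (Q := fun n g => |f (F.act hF g w₀) - f (F.act hF (IsometryEquiv.refl ℂ) w₀)| ≤
      n * (2 * θ + D)) (by simp) (fun n g hg => hstep k h1 n g hg)
    (fun n g hg => hstep (k + 1) h2 n g hg) hg
  have hn' : (n : ℝ) ≤ 2 * F.poly.N + 1 := by exact_mod_cast hn
  have h3 := mul_le_mul_of_nonneg_right hn' (show 0 ≤ 2 * θ + D by linarith)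
  have h4 := hθ v hv g hg
  have := abs_sub_le (f (F.act hF g v)) (f (F.act hF g w₀))
    (f (F.act hF (IsometryEquiv.refl ℂ) w₀))
  linarith

end PolygonIFS

namespace PolygonIFS

open scoped Classical

variable {S : Type*} [Fintype S] {F : PolygonIFS S}

/-! ### The maximal resistance is at most a multiple of the resistance between half-sides -/

theorem mem_of_mem_support {A : Finset (List S)} {w v : List S}
    (p : (F.graph (A : Set (List S))).Walk w v) (hw : w ∈ A) : ∀ x ∈ p.support, x ∈ A := by
  induction p with
  | nil => simpa using hw
  | cons h p ih =>
    intro x hx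
    rw [SimpleGraph.Walk.support_cons, List.mem_cons] at hx
    rcases hx with rfl | hx
    · exact hw
    · exact ih h.2.1 x hx

theorem zoom_mem_cut (hF : F.IsBorderedCarpet) {s : ℝ} {τ w : List S} (hw : w ∈ F.cut s)
    (hs : 0 < s) (g : ℂ ≃ᵢ ℂ) : F.tr (s / F.ρw τ) (F.act hF g w) ∈ F.cut (s / F.ρw τ) := by
  refine F.tr_mem_cut ?_ (act_mem_cut hF hw)
  rw [le_div_iff₀ (F.ρw_pos τ)]
  exact mul_le_of_le_one_right hs.le (F.ρw_le_one τ)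

/-- Oscillation of a function of unit energy within the cell of `τ`. -/
theorem abs_sub_append_le (hF : F.IsBorderedCarpet) {C s₀ : ℝ} (hC : 0 < C)
    (H : ∀ (s s' : ℝ) (k : ℕ), 0 < s → s ≤ s₀ → s ≤ s' → s' ≤ 1 → s ≤ F.ρmin ^ k * s' →
      F.maxRes s' ≤ C * F.areaRatio ^ k * F.maxRes s)
    {s : ℝ} (hs : 0 < s) (hs₀ : s ≤ s₀) {u : List S → ℝ} (hu : F.energy (F.cut s) u ≤ 1)
    {τ : List S} (hsτ : s ≤ F.ρw τ) {k : ℕ} (hk : F.ρw τ ≤ F.ρmin ^ k) {v v' : List S}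
    (hv : v ∈ F.cut (s / F.ρw τ)) (hv' : v' ∈ F.cut (s / F.ρw τ)) :
    |u (τ ++ v) - u (τ ++ v')| ≤ √(C * F.areaRatio ^ k) * √(F.maxRes s) := by
  have hp := F.ρw_pos τ
  have h1 := (F.energy_append_le (s := s) (τ := τ) (fun v hv => F.append_mem_cut hsτ hv) u).trans hu
  refine (F.abs_sub_le_maxRes hF h1 hv hv').trans ?_
  have hq := F.areaRatio_pos
  rw [← Real.sqrt_mul (by positivity)]
  refine Real.sqrt_le_sqrt (H s _ k hs hs₀ ?_ ?_ ?_)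
  · rw [le_div_iff₀ hp]; exact mul_le_of_le_one_right hs.le (F.ρw_le_one τ)
  · rw [div_le_one hp]; exact hsτ
  · rw [mul_div_assoc', le_div_iff₀ hp, mul_comm]
    exact mul_le_mul_of_nonneg_right hk hs.le

/-- If the resistance between two cells near different half-sides is small, the values of a
function of unit energy at the copies of one of these cells form a profile. The corner steps come
from the loop intersection condition for the orbit of a chain of cells. -/
theorem exists_isProfile (hF : F.IsBorderedCarpet) (hLI : F.LoopIntersection) {C s₀ : ℝ}
    (hC : 0 < C)
    (H : ∀ (s s' : ℝ) (k : ℕ), 0 < s → s ≤ s₀ → s ≤ s' → s' ≤ 1 → s ≤ F.ρmin ^ k * s' →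
      F.maxRes s' ≤ C * F.areaRatio ^ k * F.maxRes s) (L : ℕ) :
    ∃ C' : ℝ, 0 ≤ C' ∧ ∀ s, 0 < s → s ≤ s₀ → s ≤ F.ρmin ^ L → ∀ u,
      F.energy (F.cut s) u ≤ 1 → ∀ R : ℝ, 0 < R → ∀ w₀ ∈ F.cut s, ∀ v₀, w₀ ≠ v₀ →
      (∀ f : List S → ℝ, (f w₀ - f v₀) ^ 2 ≤ R * F.energy (F.cut s) f) →
      (F.Ψw w₀ '' F.poly.bdry ∩ F.poly.side 1).Nonempty →
      (∀ X : Set ℂ, IsPreconnected X → F.Ψw w₀ '' F.poly.bdry ⊆ X → F.Ψw v₀ '' F.poly.bdry ⊆ X →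
        ∃ k, (∃ x ∈ X, F.poly.height (F.poly.axis k) x = 0) ∧
          ∃ x ∈ X, F.poly.height (F.poly.axis (k + 1)) x = 0) →
      F.IsProfile (fun k => 2 * √(C * F.areaRatio ^ k)) L (C' * √R) (√(F.maxRes s))
        (fun τ => F.zoom s u τ (F.act hF (IsometryEquiv.refl ℂ) w₀)) := by
  obtain ⟨D, hD, hDe⟩ := F.exists_energy_zoom_le hF L
  obtain ⟨Cw, hCw, hwalk⟩ := F.exists_walk hF L
  obtain ⟨d, -, hd⟩ := F.exists_degree_bound hF
  set N₁ : ℝ := 2 * F.poly.N + 1 with hN₁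
  have hN0 : 0 ≤ N₁ := by positivity
  refine ⟨2 * (Cw + N₁ * (2 * Cw + D * √d)) + √d, by positivity, fun s hs hs₀ hsL u hu R hR w₀ hw₀
    v₀ hne hres hside haxes => ?_⟩
  -- `R` is bounded below, so additive constants are at most multiples of `√R`
  have hone : 1 ≤ √d * √R := by
    rw [← Real.sqrt_mul (Nat.cast_nonneg _), Real.one_le_sqrt]
    exact F.one_le_of_resistance (hd s) hR.le hw₀ hne hres
  have hRs := Real.sqrt_nonneg R
  obtain ⟨p, hp⟩ := hwalk s hs hsL u hu R hR w₀ hw₀ v₀ hres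
  have hps := mem_of_mem_support p hw₀
  set X := F.frame p.support with hX
  have hXp : IsPathConnected X := isPathConnected_frame hF p
  obtain ⟨k, ⟨x, hx, hx0⟩, y, hy, hy0⟩ := haxes X hXp.isConnected.isPreconnected
    (image_bdry_subset_frame p.start_mem_support) (image_bdry_subset_frame p.end_mem_support)
  have hk1 : ∃ x ∈ X, F.poly.refl k x = x := ⟨x, hx, F.poly.refl_eq_of_height hx0⟩
  have hk2 : ∃ x ∈ X, F.poly.refl (k + 1) x = x := ⟨y, hy, F.poly.refl_eq_of_height hy0⟩
  set A := F.poly.orbit X with hA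
  have hAs : ∀ g ∈ F.poly.symmetries, g '' A = A := fun g hg => UnitPolygon.image_orbit hg X
  have hAp : IsPathConnected A := UnitPolygon.isPathConnected_orbit hXp hk1 hk2
  have hAc : IsClosed A := (UnitPolygon.isCompact_orbit (isCompact_frame _)).isClosed
  have hAK : A ⊆ F.K := by
    intro z hz
    obtain ⟨g, hg, y, hy, rfl⟩ := UnitPolygon.mem_orbit.1 hz
    rw [← F.image_K_of_mem hF hg]
    exact ⟨y, frame_subset_K hF _ hy, rfl⟩
  have hA1 : (A ∩ F.poly.side 1).Nonempty := by
    obtain ⟨z, hz, hz1⟩ := hside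
    exact ⟨z, UnitPolygon.subset_orbit X (image_bdry_subset_frame p.start_mem_support hz), hz1⟩
  have horb : ∀ τ : List S, τ.length ≤ L → ∀ v ∈ p.support, ∀ g ∈ F.poly.symmetries,
      |F.zoom s u τ (F.act hF g v) - F.zoom s u τ (F.act hF (IsometryEquiv.refl ℂ) w₀)| ≤
        Cw * √R + N₁ * (2 * (Cw * √R) + D) := fun τ hτ v hv g hg =>
    abs_sub_le_of_orbit hF (hDe s hs hsL u hu τ hτ) hD hps
      (fun v hv g hg => hp v hv g hg τ hτ) hk1 hk2 hv hg
  have hcellA : ∀ z ∈ A, ∃ g ∈ F.poly.symmetries, ∃ v ∈ p.support,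
      z ∈ F.cell (F.act hF g v) := by
    intro z hz
    obtain ⟨g, hg, x, hx, rfl⟩ := UnitPolygon.mem_orbit.1 hz
    obtain ⟨v, hv, hxv⟩ := mem_frame.1 hx
    refine ⟨g, hg, v, hv, ?_⟩
    rw [cell_act hF hg]
    exact ⟨x, F.image_bdry_subset_cell hF v hxv, rfl⟩
  refine ⟨Real.sqrt_nonneg _, fun τ c hτ hc => ?_, fun k τ τ' hτ hτ' hk hk' hm => ?_⟩
  -- a point of `A` whose image in the corner cell lies in `A`, too: near that image the zooms at
  -- `τ` and at `τ c` read neighbouring values of `u`, and both zooms are nearly constant along `A`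
  · obtain ⟨b, hbA, hcb⟩ := hLI.exists_Ψ_mem hF hAK hAc hAp hAs hA1 hc
    obtain ⟨g, hg, v, hv, hzα⟩ := hcellA _ hcb
    obtain ⟨g', hg', v', hv', hbβ⟩ := hcellA _ hbA
    set α := F.act hF g v with hα
    set β := F.act hF g' v' with hβ
    have hτc : (τ ++ [c]).length ≤ L := by simpa using hτ
    have hτ' : τ.length ≤ L := by omega
    have h1 := horb τ hτ' v hv g hg
    have h2 := horb _ hτc v' hv' g' hg'
    have hsτ := F.le_ρw_of_length hsL hτ'
    have hsτc := F.le_ρw_of_length hsL hτc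
    have hpτ := F.ρw_pos τ
    have hst : s ≤ s / F.ρw τ := by
      rw [le_div_iff₀ hpτ]; exact mul_le_of_le_one_right hs.le (F.ρw_le_one τ)
    have e : F.zoom s u (τ ++ [c]) β = u (τ ++ F.tr (s / F.ρw τ) (c :: β)) := by
      have h3 := F.tr_append (s := s / F.ρw τ) (u := [c]) (v := β) (by
        rw [div_le_iff₀ hpτ, mul_comm, ← ρw_append]; exact hsτc)
      rw [List.singleton_append, div_div, ← ρw_append] at h3
      rw [h3, zoom, List.append_assoc]
    have hαc : F.tr (s / F.ρw τ) α ∈ F.cut (s / F.ρw τ) := zoom_mem_cut hF (hps v hv) hs g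
    have hβc : F.tr (s / F.ρw τ) (c :: β) ∈ F.cut (s / F.ρw τ) := by
      refine F.mem_cut.2 (F.isCut_tr ?_)
      have h4 := IsCut.le F (F.mem_cut.1 (act_mem_cut hF (g := g') (hps v' hv')))
      rw [ρw_cons]
      refine le_trans ?_ hst
      exact (mul_le_of_le_one_left (F.ρw_pos _).le (F.ρ_lt_one c).le).trans h4
    have hmeet : (F.cell α ∩ F.cell (c :: β)).Nonempty := by
      refine ⟨F.Ψ c b, hzα, ?_⟩
      have := F.cell_append [c] β
      rw [List.singleton_append, Ψw_singleton] at this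
      rw [this]; exact ⟨b, hbβ, rfl⟩
    have h3 := F.abs_sub_le_sqrt_energy (F.append_mem_cut hsτ hαc) (F.append_mem_cut hsτ hβc)
      (F.append_inter_nonempty τ (F.tr_inter_nonempty (s / F.ρw τ) hmeet)) u
    have h4 := h3.trans (Real.sqrt_le_one.2 hu)
    rw [← e] at h4
    change |F.zoom s u τ α - _| ≤ _ at h4
    have h5 : |F.zoom s u τ (F.act hF (IsometryEquiv.refl ℂ) w₀) -
        F.zoom s u (τ ++ [c]) (F.act hF (IsometryEquiv.refl ℂ) w₀)| ≤
        2 * (Cw * √R + N₁ * (2 * (Cw * √R) + D)) + 1 := by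
      rw [abs_le] at *
      constructor <;> linarith [h1.1, h1.2, h2.1, h2.2, h4.1, h4.2]
    refine h5.trans ?_
    have h6 : N₁ * D * 1 ≤ N₁ * D * (√d * √R) :=
      mul_le_mul_of_nonneg_left hone (mul_nonneg hN0 hD)
    nlinarith
  -- intersecting small cells: only the oscillation of `u` inside each of them matters
  · obtain ⟨z, hz, hz'⟩ := hm
    obtain ⟨v, hv, hzv⟩ := F.exists_isCut_of_mem_cell hs hz
    obtain ⟨v', hv', hzv'⟩ := F.exists_isCut_of_mem_cell hs hz'
    rw [← mem_cut] at hv hv'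
    have hsτ := F.le_ρw_of_length hsL hτ
    have hsτ' := F.le_ρw_of_length hsL hτ'
    have h1 := abs_sub_append_le hF hC H hs hs₀ hu hsτ hk
      (zoom_mem_cut hF (τ := τ) hw₀ hs (IsometryEquiv.refl ℂ)) hv
    have h2 := abs_sub_append_le hF hC H hs hs₀ hu hsτ' hk' hv'
      (zoom_mem_cut hF (τ := τ') hw₀ hs (IsometryEquiv.refl ℂ))
    have h3 := (F.abs_sub_le_sqrt_energy (F.append_mem_cut hsτ hv) (F.append_mem_cut hsτ' hv')
      ⟨z, hzv, hzv'⟩ u).trans (Real.sqrt_le_one.2 hu)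
    have h4 : |F.zoom s u τ (F.act hF (IsometryEquiv.refl ℂ) w₀) -
        F.zoom s u τ' (F.act hF (IsometryEquiv.refl ℂ) w₀)| ≤
        1 + 2 * √(C * F.areaRatio ^ k) * √(F.maxRes s) := by
      unfold zoom
      rw [abs_le] at *
      constructor <;> linarith [h1.1, h1.2, h2.1, h2.2, h3.1, h3.2]
    refine h4.trans (add_le_add_left ?_ _)
    refine hone.trans (mul_le_mul_of_nonneg_right ?_ hRs)
    have : 0 ≤ 2 * (Cw + N₁ * (2 * Cw + D * √d)) := by positivity
    linarith

/-- If the resistance between two half-sides is small, a function of unit energy with almost maximal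
oscillation is close to its profile, and its profile is nearly constant. -/
theorem exists_maxRes_le_mul (hF : F.IsBorderedCarpet) (hLI : F.LoopIntersection) :
    ∃ C : ℝ, 0 < C ∧ ∃ m₀ : ℕ, ∀ m ≥ m₀, 1 ≤ m → ∀ i ∈ F.poly.halfIndex,
      1 ≤ F.poly.halfDist 1 i → ∀ w ∈ F.halfSideCells 1 m, ∀ v ∈ F.halfSideCells i m,
      ∀ R : ℝ, 0 < R → (∀ f : List S → ℝ, (f w - f v) ^ 2 ≤ R * F.energy (F.Λ m) f) →
        F.maxRes (F.ρmin ^ m) ≤ C * R := by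
  obtain ⟨C, hC, s₀, hs₀, H⟩ := F.exists_maxRes_le hF
  have hρ := F.ρmin_pos
  have hq := F.areaRatio_pos
  set η : ℕ → ℝ := fun k => 2 * √(C * F.areaRatio ^ k) with hηdef
  have hη : ∀ ε > 0, ∃ k, η k ≤ ε := by
    intro ε hε
    obtain ⟨k, hk⟩ := exists_pow_lt_of_lt_one (show 0 < (ε / 2) ^ 2 / C by positivity)
      (F.areaRatio_lt_one hF)
    refine ⟨k, ?_⟩
    rw [lt_div_iff₀ hC, mul_comm] at hk
    have := Real.sqrt_le_sqrt hk.le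
    rw [Real.sqrt_sq (by positivity)] at this
    simp only [hηdef]; linarith
  -- The cells at scale `ρ_* ^ k` have oscillation at most `√M / 16`, and the values of the
  -- profile at their words deviate from that at the empty word by at most `√M / 16` and a multiple of
  -- `√R`. The oscillation is thus at most `√M / 4` and a multiple of `√R`,
  -- but `u` is chosen with an oscillation above `√M / 2`.
  obtain ⟨k, hk⟩ := hη (1 / 8) (by norm_num)
  set T := F.cut (F.ρmin ^ k) with hT
  choose Cf hCf Lf hLf using fun τ : List S => close_nil hF hη τ (1 / 16) (by norm_num)
  set L := T.sup (fun τ => max (Lf τ) τ.length) with hL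
  have hLT : ∀ τ ∈ T, Lf τ ≤ L ∧ τ.length ≤ L := fun τ hτ =>
    max_le_iff.1 (Finset.le_sup (f := fun τ => max (Lf τ) τ.length) hτ)
  set Cs := ∑ τ ∈ T, Cf τ with hCs
  have hCs0 : 0 ≤ Cs := Finset.sum_nonneg fun τ _ => hCf τ
  have hCT : ∀ τ ∈ T, Cf τ ≤ Cs := fun τ hτ =>
    Finset.single_le_sum (f := Cf) (fun τ _ => hCf τ) hτ
  obtain ⟨Cp, hCp, hprof⟩ := exists_isProfile hF hLI hC H L
  obtain ⟨m₁, hm₁⟩ := F.exists_ne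
  obtain ⟨m₂, hm₂⟩ := exists_pow_lt_of_lt_one
    (lt_min hs₀ (lt_min (pow_pos hρ L) (pow_pos hρ k))) F.ρmin_lt_one
  refine ⟨(8 * Cs * Cp) ^ 2 + 1, by positivity, max m₁ m₂, fun m hm hm1 i hi hd w hw v hv R hR
    hres => ?_⟩
  set s := F.ρmin ^ m with hs
  have hs0 : 0 < s := pow_pos hρ m
  have hsm := (pow_le_pow_of_le_one hρ.le F.ρmin_lt_one.le ((le_max_right _ _).trans hm)).trans
    hm₂.le
  rw [← hs, le_min_iff, le_min_iff] at hsm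
  obtain ⟨hss₀, hsL, hsk⟩ := hsm
  rw [F.Λ_eq_cut hm1] at hres
  obtain ⟨⟨hwΛ, x, hxw, hxs⟩, -⟩ := F.mem_halfSideCells_one hw
  rw [F.Λ_eq_cut hm1] at hwΛ
  set M := F.maxRes s with hM
  rcases (F.maxRes_nonneg s).eq_or_lt with h0 | hMpos
  · rw [hM, ← h0]; positivity
  rw [← hM] at hMpos
  obtain ⟨u, hu, w₁, hw₁, v₁, hv₁, hlt⟩ := F.exists_lt_maxRes (s := s) (c := M / 4)
    (by linarith) (by linarith)
  have hP := hprof s hs0 hss₀ hsL u hu R hR w hwΛ v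
    (hm₁ m ((le_max_left _ _).trans hm) hm1 i hi hd w hw v hv) hres
    ⟨x, F.mem_image_bdry (F.cell_subset_body w hxw) (F.poly.side_subset_bdry _ hxs), hxs⟩
    (fun X hX h1 h2 => F.exists_axes hi hd hw hv hX h1 h2)
  set a : List S → ℝ := fun τ => F.zoom s u τ (F.act hF (IsometryEquiv.refl ℂ) w) with ha
  have hμ := Real.sqrt_nonneg M
  have hδ : 0 ≤ Cp * √R := by positivity
  have hk' : √(C * F.areaRatio ^ k) ≤ 1 / 16 := by
    simp only [hηdef] at hk; linarith
  have hnear : ∀ y ∈ F.cut s, |u y - a []| ≤ Cs * (Cp * √R) + 1 / 8 * √M := by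
    intro y hy
    have hτ : F.tr (F.ρmin ^ k) y ∈ T := F.tr_mem_cut hsk hy
    set τ := F.tr (F.ρmin ^ k) y with hτdef
    obtain ⟨z, hz⟩ := F.tr_prefix (F.ρmin ^ k) y
    rw [← hτdef] at hz
    have hsτ := F.le_ρw_of_length hsL (hLT τ hτ).2
    have hzc : z ∈ F.cut (s / F.ρw τ) := by
      rw [← hz] at hy
      exact F.mem_cut.2 (IsCut.of_append F (F.mem_cut.1 hy))
    have h1 := abs_sub_append_le hF hC H hs0 hss₀ hu hsτ (IsCut.le F (F.mem_cut.1 hτ)) hzc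
      (zoom_mem_cut hF (τ := τ) hwΛ hs0 (IsometryEquiv.refl ℂ))
    rw [hz] at h1
    have h2 := hLf τ L (hLT τ hτ).1 _ _ a hP
    have h3 := mul_le_mul_of_nonneg_right (hCT τ hτ) hδ
    have h4 := mul_le_mul_of_nonneg_right hk' hμ
    have e : u y - a [] = (u y - a τ) + (a τ - a []) := by ring
    rw [e]
    refine (abs_add_le _ _).trans ?_
    rw [abs_sub_comm (a τ)]
    have h5 : |u y - a τ| ≤ 1 / 16 * √M := h1.trans h4
    linarith
  have h1 := hnear w₁ hw₁
  have h2 := hnear v₁ hv₁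
  have h3 : |u w₁ - u v₁| ≤ 2 * (Cs * (Cp * √R)) + 1 / 4 * √M := by
    rw [abs_le] at *
    constructor <;> linarith [h1.1, h1.2, h2.1, h2.2]
  have h4 : √M / 2 < |u w₁ - u v₁| := by
    have := Real.sqrt_lt_sqrt (by linarith) hlt
    rw [Real.sqrt_sq_eq_abs, Real.sqrt_div hMpos.le,
      show (4 : ℝ) = 2 ^ 2 by norm_num, Real.sqrt_sq (by norm_num)] at this
    exact this
  have h5 : √M ≤ 8 * Cs * Cp * √R := by linarith
  have h6 := pow_le_pow_left₀ hμ h5 2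
  rw [Real.sq_sqrt hMpos.le, mul_pow, Real.sq_sqrt hR.le] at h6
  linarith

/-- A lower bound for the normalized energies bounds the resistance in its variational form. -/
theorem sq_sub_le_of_lt_iInf {A : Finset (List S)} {w v : List S} {x : ℝ} (hx : 0 < x)
    (h : ENNReal.ofReal x⁻¹ ≤ ⨅ (f : List S → ℝ) (_ : (∀ a ∈ ({w} : Set (List S)), f a = 1) ∧
      ∀ a ∈ ({v} : Set (List S)), f a = 0), ENNReal.ofReal (F.energy A f)) (f : List S → ℝ) :
    (f w - f v) ^ 2 ≤ x * F.energy A f := by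
  rcases eq_or_ne (f w) (f v) with he | he
  · rw [he, sub_self]
    have := mul_nonneg hx.le (F.energy_nonneg A f)
    simpa using this
  have hd : f w - f v ≠ 0 := sub_ne_zero.2 he
  -- normalize `f` to have the values `1` at `w` and `0` at `v`
  set c := (f w - f v)⁻¹ with hc
  have h1 := h.trans (iInf₂_le (fun a => c * (f a - f v))
    ⟨by rintro a rfl; exact inv_mul_cancel₀ hd, by rintro a rfl; simp⟩)
  rw [energy_smul F A c (fun a => f a - f v)] at h1
  have h2 : F.energy A (fun a => f a - f v) ≤ F.energy A f :=
    F.energy_le_of_le fun a _ b _ _ => by rw [sub_sub_sub_cancel_right]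
  have h3 : x⁻¹ ≤ c ^ 2 * F.energy A f := by
    refine le_trans ((ENNReal.ofReal_le_ofReal_iff ?_).1 h1)
      (mul_le_mul_of_nonneg_left h2 (sq_nonneg c))
    exact mul_nonneg (sq_nonneg c) (F.energy_nonneg A _)
  rw [hc, inv_pow, inv_mul_eq_div, le_div_iff₀ (by positivity), inv_mul_eq_div,
    div_le_iff₀ hx] at h3
  linarith

end PolygonIFS

end PolygonCarpet

end

theorem theorem6p1 {S : Type*} [Fintype S] (F : PolygonCarpet.PolygonIFS S)
    (hF : F.IsBorderedCarpet) (hLI : F.LoopIntersection) :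
    ∃ C : ℝ, 0 < C ∧ ∃ m₀ : ℕ, 1 ≤ m₀ ∧ ∀ m ≥ m₀,
      ∀ i ∈ F.poly.halfIndex, 1 ≤ F.poly.halfDist 1 i →
        ∀ w ∈ F.halfSideCells 1 m, ∀ v ∈ F.halfSideCells i m,
          ENNReal.ofReal C * F.sigma m ≤ F.R m {w} {v} := by
  obtain ⟨C₁, hC₁, m₁, hm₁, h₁⟩ := F.exists_sigma_le hF
  obtain ⟨C₂, hC₂, m₂, h₂⟩ := PolygonCarpet.PolygonIFS.exists_maxRes_le_mul hF hLI
  obtain ⟨m₃, h₃⟩ := F.exists_ne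
  -- the factor `2` turns the bound `M ≤ C₂ x` for `x = M / (2 C₂)` into a contradiction
  refine ⟨1 / (2 * C₁ * C₂), by positivity, m₁ + m₂ + m₃, by omega,
    fun m hm i hi hd w hw v hv => ?_⟩
  have hne : w ≠ v := h₃ m (by omega) (by omega) i hi hd w hw v hv
  set M := F.maxRes (F.ρmin ^ m) with hM
  have hle : ENNReal.ofReal (1 / (2 * C₁ * C₂)) * F.sigma m ≤ ENNReal.ofReal (M / (2 * C₂)) := by
    refine (mul_le_mul_right (h₁ m (by omega)) _).trans ?_
    rw [← ENNReal.ofReal_mul (by positivity)]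
    refine ENNReal.ofReal_le_ofReal (le_of_eq ?_)
    rw [← hM]; field_simp
  refine hle.trans ?_
  rcases (F.maxRes_nonneg (F.ρmin ^ m)).eq_or_lt with h0 | hpos
  · rw [hM, ← h0]; simp
  rw [← hM] at hpos
  have hx : 0 < M / (2 * C₂) := by positivity
  have hdisj : ¬ (({w} : Set (List S)) ∩ {v}).Nonempty := by
    rintro ⟨a, rfl, h⟩
    exact hne h
  unfold PolygonCarpet.PolygonIFS.R
  rw [if_neg hdisj, ENNReal.le_inv_iff_le_inv, ← ENNReal.ofReal_inv_of_pos hx]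
  by_contra hlt
  have hres := PolygonCarpet.PolygonIFS.sq_sub_le_of_lt_iInf hx (not_le.1 hlt).le
  have := h₂ m (by omega) (by omega) i hi hd w hw v hv _ hx hres
  rw [← hM] at this
  have e : C₂ * (M / (2 * C₂)) = M / 2 := by field_simp
  linarith
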